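/- Let $(M,g)$ be a smooth, connected, paracompact (Hausdorff) pseudo-Riemannian manifold of signature $(p,q)$ with $p-q\equiv 3$ or $7 \pmod 8$, and let $d=p+q=\dim M$. Let $\mathrm{Cl}(M,g)$ be the Clifford bundle of $(T^*M,g^*)$, with the convention $\xi^2=g^*(\xi,\xi)$. Let $(S,\gamma)$ be an elementary real pinor bundle, i.e. a real vector bundle $S$ over $M$ with a smooth morphism $\gamma:\mathrm{Cl}(M,g)\to \mathrm{End}_{\mathbb R}(S)$ of bundles of unital $\mathbb R$-algebras whose restriction to every fiber is a finite-dimensional irreducible real representation. Let $L^c\subset \mathrm{Cl}(M,g)$ be the complex orientation bundle, with fibers $L^c_x=\mathbb R\oplus\Lambda^dT_x^*M$, and let $\Sigma\subset \mathrm{End}_{\mathbb R}(S)$ be the Schur bundle, with fibers $\Sigma_x=\{T : T\gamma_x(\xi)=\gamma_x(\xi)T \text{ for all } \xi\in T_x^*M\}$. Let $(V,h)$ be a quadratic space of signature $(p,q)$ and put $\alpha=-1$ if $p-q\equiv 3$ and $\alpha=+1$ if $p-q\equiv 7 \pmod 8$. Let $\mathrm{Cl}_2(\alpha)$ be the real algebra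 generated by $e_1,e_2$ with $e_1^2=e_2^2=\alpha$ and $e_1e_2=-e_2e_1$, and let $\mathrm{Spin}_2(\alpha)\subset\mathrm{Pin}_2(\alpha)\subset\mathrm{Cl}_2(\alpha)^\times$ be its spin and pin groups. Put $$\mathrm{Spin}^o(V,h)=\big(\mathrm{Spin}(V,h)\times \mathrm{Pin}_2(\alpha)\big)/\{(1,1),(-1,-1)\},$$ $$\mathrm{Spin}^c(V,h)=\{[a,z] : a\in \mathrm{Spin}(V,h),\ z\in \mathrm{Spin}_2(\alpha)\}\subset \mathrm{Spin}^o(V,h).$$ Let $\gamma_0:\mathrm{Cl}(V,h)\to\mathrm{End}_{\mathbb R}(S_0)$ be an irreducible finite-dimensional real representation, let $\nu$ be a Clifford volume element of $(V,h)$ and $J=\gamma_0(\nu)$, and let $D\in\mathrm{End}_{\mathbb R}(S_0)$ satisfy $DJ=-JD$, $D\gamma_0(v)=-\gamma_0(v)D$ for all $v\in V$, and $D^2=\alpha\,\mathrm{id}$. Let $\gamma_2:\mathrm{Cl}_2(\alpha)\to\mathrm{End}_{\mathbb R}(S_0)$ be the representation with $\gamma_2(e_1)=D$ and $\gamma_2(e_2)=-\alpha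 JD$, and let $\gamma_o([a,b])=\gamma_0(a)\gamma_2(b)$ be the twisted elementary representation of $\mathrm{Spin}^o(V,h)$ on $S_0$. Then: 1. $L^c$ and $\Sigma$ are smooth rank-two bundles of unital subalgebras of $\mathrm{Cl}(M,g)$ and $\mathrm{End}_{\mathbb R}(S)$ respectively, and $\gamma$ restricts to an isomorphism of bundles of unital algebras from $L^c$ to $\Sigma$. 2. $(S,\gamma)$ has an adapted $\mathrm{Spin}^o$ structure: a principal $\mathrm{Spin}^o(V,h)$-bundle $Q$ over $M$, equivariantly mapped to the bundle of isometries $(V,h)\to (T_x^*M,g^*_x)$, such that $S\simeq Q\times_{\gamma_o}S_0$ with Clifford multiplication induced by $\gamma_0$. For every such $Q$ the following statements are equivalent: (a) $M$ is orientable; (b) the Schur bundle $\Sigma$ is trivial; (c) the structure group of $S$ reduces from $\mathrm{Spin}^o(V,h)$ to $\mathrm{Spin}^c(V,h)$, i.e. $Q$ has a reduction to a principal $\mathrm{Spin}^c(V,h)$-sub-bundle. In (b), triviality as a real vector bundle and triviality as a bundle of unital real algebras (i.e. $\Sigma\simeq M\times\mathbb C$) are both equivalent to (a) and (c). -/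

import Mathlib

open scoped Manifold ContDiff
open Bundle

noncomputable section

namespace PinorGeom

/-! ### Quadratic spaces, Clifford volume elements, spin groups -/

section Algebra

variable {V : Type*} [AddCommGroup V] [Module ℝ V]

/-- A real quadratic form has signature `(p, q)` if it is isometric to
`x₁² + ⋯ + x_p² - y₁² - ⋯ - y_q²`. -/
def HasSignature (h : QuadraticForm ℝ V) (p q : ℕ) : Prop :=
  h.Equivalent (QuadraticMap.weightedSumSquares ℝ
    (Sum.elim (fun _ : Fin p => (1 : ℝ)) (fun _ : Fin q => (-1 : ℝ))))

/-- The Clifford volume elements `e₁ e₂ ⋯ e_d`, where `(e₁, …, e_d)` runs over the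
pseudo-orthonormal bases of `(V, h)`; the order of the basis accounts for the orientation. -/
def volumeElements (h : QuadraticForm ℝ V) : Set (CliffordAlgebra h) :=
  {ν | ∃ e : Module.Basis (Fin (Module.finrank ℝ V)) ℝ V,
    (∀ i j, i ≠ j → QuadraticMap.polar h (e i) (e j) = 0) ∧
    (∀ i, h (e i) = 1 ∨ h (e i) = -1) ∧
    ν = (List.ofFn fun i => CliffordAlgebra.ι h (e i)).prod}

/-- The (ordinary, untwisted) Clifford group: the units `x` of the Clifford algebra with
`x V x⁻¹ = V`. -/
def cliffordGroup (h : QuadraticForm ℝ V) : Subgroup (CliffordAlgebra h)ˣ where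
  carrier := {x |
    (∀ v, ∃ w, (x : CliffordAlgebra h) * CliffordAlgebra.ι h v * (x⁻¹ : (CliffordAlgebra h)ˣ) =
      CliffordAlgebra.ι h w) ∧
    (∀ v, ∃ w, ((x⁻¹ : (CliffordAlgebra h)ˣ) : CliffordAlgebra h) * CliffordAlgebra.ι h v * x =
      CliffordAlgebra.ι h w)}
  one_mem' := ⟨fun v => ⟨v, by simp⟩, fun v => ⟨v, by simp⟩⟩
  mul_mem' := by
    rintro x y ⟨hx, hx'⟩ ⟨hy, hy'⟩
    refine ⟨fun v => ?_, fun v => ?_⟩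
    · obtain ⟨w, hw⟩ := hy v
      obtain ⟨u, hu⟩ := hx w
      refine ⟨u, ?_⟩
      rw [← hu, ← hw]
      simp [mul_assoc]
    · obtain ⟨w, hw⟩ := hx' v
      obtain ⟨u, hu⟩ := hy' w
      refine ⟨u, ?_⟩
      rw [← hu, ← hw]
      simp [mul_assoc]
  inv_mem' := by
    rintro x ⟨hx, hx'⟩
    exact ⟨by simpa using hx', by simpa using hx⟩

/-- The elements of the Clifford group whose twisted Clifford norm `star x * x` (where `star` is
reversion composed with the parity automorphism) is `1` or `-1`. In even dimension this is
`Pin(V, h)`; its even part is `Spin(V, h)` in every dimension. -/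
def pinGroup (h : QuadraticForm ℝ V) : Subgroup (CliffordAlgebra h)ˣ where
  carrier := {x | x ∈ cliffordGroup h ∧
    (star (x : CliffordAlgebra h) * (x : CliffordAlgebra h) = 1 ∨
      star (x : CliffordAlgebra h) * (x : CliffordAlgebra h) = -1)}
  one_mem' := ⟨one_mem _, by simp⟩
  mul_mem' := by
    rintro x y ⟨hx, hx'⟩ ⟨hy, hy'⟩
    refine ⟨mul_mem hx hy, ?_⟩
    have key : star ((x * y : (CliffordAlgebra h)ˣ) : CliffordAlgebra h) *
        ((x * y : (CliffordAlgebra h)ˣ) : CliffordAlgebra h) =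
        star (y : CliffordAlgebra h) *
          (star (x : CliffordAlgebra h) * (x : CliffordAlgebra h)) * y := by
      simp [mul_assoc]
    rw [key]
    rcases hx' with h1 | h1 <;> rcases hy' with h2 | h2 <;> simp [h1, h2]
  inv_mem' := by
    rintro x ⟨hx, hx'⟩
    refine ⟨inv_mem hx, ?_⟩
    have hs : ∀ c : CliffordAlgebra h, star (x : CliffordAlgebra h) * x = c →
        star (x : CliffordAlgebra h) = c * (x⁻¹ : (CliffordAlgebra h)ˣ) := by
      intro c hc
      rw [← hc, mul_assoc, Units.mul_inv, mul_one]
    have hi : star ((x⁻¹ : (CliffordAlgebra h)ˣ) : CliffordAlgebra h) * star (x : CliffordAlgebra h)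
        = 1 := by
      rw [← star_mul, Units.mul_inv, star_one]
    rcases hx' with h1 | h1
    · left
      have := hs _ h1
      rw [this, one_mul] at hi
      exact hi
    · right
      have := hs _ h1
      rw [this, neg_one_mul, mul_neg] at hi
      rw [← hi, neg_neg]

/-- `Spin(V, h)`: the even elements of the Clifford group with Clifford norm `1` or `-1`. -/
def spinGroup (h : QuadraticForm ℝ V) : Subgroup (CliffordAlgebra h)ˣ where
  carrier := {x | x ∈ pinGroup h ∧ (x : CliffordAlgebra h) ∈ CliffordAlgebra.even h}
  one_mem' := ⟨one_mem _, by simp⟩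
  mul_mem' := by
    rintro x y ⟨hx, hx'⟩ ⟨hy, hy'⟩
    refine ⟨mul_mem hx hy, ?_⟩
    rw [Units.val_mul]
    exact mul_mem hx' hy'
  inv_mem' := by
    rintro x ⟨hx, hx'⟩
    refine ⟨inv_mem hx, ?_⟩
    have hst : star (x : CliffordAlgebra h) ∈ CliffordAlgebra.even h := by
      rw [CliffordAlgebra.star_def]
      change _ ∈ CliffordAlgebra.evenOdd h 0
      rw [CliffordAlgebra.reverse_mem_evenOdd_iff, CliffordAlgebra.involute_mem_evenOdd_iff]
      exact hx'
    have hinv : ∀ c : CliffordAlgebra h, star (x : CliffordAlgebra h) * x = c →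
        star (x : CliffordAlgebra h) = c * (x⁻¹ : (CliffordAlgebra h)ˣ) := by
      intro c hc
      rw [← hc, mul_assoc, Units.mul_inv, mul_one]
    rcases hx.2 with h1 | h1
    · have := hinv _ h1
      rw [one_mul] at this
      rw [← this]
      exact hst
    · have := hinv _ h1
      rw [neg_one_mul] at this
      have h2 : ((x⁻¹ : (CliffordAlgebra h)ˣ) : CliffordAlgebra h) =
          -star (x : CliffordAlgebra h) := by rw [this, neg_neg]
      rw [h2]
      exact neg_mem hst

lemma neg_one_mem_pinGroup (h : QuadraticForm ℝ V) : (-1 : (CliffordAlgebra h)ˣ) ∈ pinGroup h :=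
  ⟨⟨fun v => ⟨v, by simp⟩, fun v => ⟨v, by simp⟩⟩, by simp⟩

lemma neg_one_mem_spinGroup (h : QuadraticForm ℝ V) :
    (-1 : (CliffordAlgebra h)ˣ) ∈ spinGroup h :=
  ⟨neg_one_mem_pinGroup h, by
    rw [Units.val_neg, Units.val_one]
    exact neg_mem (one_mem _)⟩

/-- The sign `α_{p,q}`: `-1` if `p - q ≡ 3 (mod 8)` and `+1` if `p - q ≡ 7 (mod 8)`. -/
def alpha (p q : ℕ) : ℝ := if ((p : ℤ) - q) % 8 = 3 then -1 else 1

/-- The form `α (x² + y²)` on `ℝ²`; its Clifford algebra is `Cl₂(α)`. -/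
def planeForm (α : ℝ) : QuadraticForm ℝ (Fin 2 → ℝ) :=
  QuadraticMap.weightedSumSquares ℝ (fun _ : Fin 2 => α)

/-- `Cl₂(α)`. -/
abbrev CliffordTwo (α : ℝ) : Type := CliffordAlgebra (planeForm α)

/-- `Pin₂(α)`. -/
abbrev pinTwo (α : ℝ) : Subgroup (CliffordTwo α)ˣ := pinGroup (planeForm α)

/-- `Spin₂(α) ≃ U(1)`, as a subgroup of `Pin₂(α)`. -/
def spinTwo (α : ℝ) : Subgroup (pinTwo α) := (spinGroup (planeForm α)).subgroupOf (pinTwo α)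

/-- The element `(-1, -1)` of `Spin(V, h) × Pin₂(α)`. -/
def signElement (h : QuadraticForm ℝ V) (α : ℝ) : spinGroup h × pinTwo α :=
  (⟨-1, neg_one_mem_spinGroup h⟩, ⟨-1, neg_one_mem_pinGroup _⟩)

/-- The subgroup `{(1, 1), (-1, -1)}` of `Spin(V, h) × Pin₂(α)`. -/
def signSubgroup (h : QuadraticForm ℝ V) (α : ℝ) : Subgroup (spinGroup h × pinTwo α) :=
  Subgroup.zpowers (signElement h α)

instance signSubgroup_normal (h : QuadraticForm ℝ V) (α : ℝ) : (signSubgroup h α).Normal := by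
  refine ⟨fun n hn g => ?_⟩
  have hc : g * signElement h α = signElement h α * g := by
    refine Prod.ext (Subtype.ext ?_) (Subtype.ext ?_) <;> simp [signElement]
  obtain ⟨k, rfl⟩ := Subgroup.mem_zpowers_iff.1 hn
  have hk : Commute g (signElement h α ^ k) := Commute.zpow_right hc k
  rw [hk.eq, mul_assoc, mul_inv_cancel, mul_one]
  exact hn

/-- `Spin^o_α(V, h) = (Spin(V, h) × Pin₂(α)) / {(1, 1), (-1, -1)}`. -/
abbrev SpinO (h : QuadraticForm ℝ V) (α : ℝ) : Type _ :=
  (spinGroup h × pinTwo α) ⧸ signSubgroup h α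

/-- `Spin^c(V, h)`, embedded in `Spin^o_α(V, h)` as the subgroup of all classes `[a, z]` with
`a ∈ Spin(V, h)` and `z ∈ Spin₂(α)`. -/
def spinC (h : QuadraticForm ℝ V) (α : ℝ) : Subgroup (SpinO h α) :=
  ((⊤ : Subgroup (spinGroup h)).prod (spinTwo α)).map (QuotientGroup.mk' (signSubgroup h α))

/-- A representation of a real algebra is irreducible if it is nonzero and has no invariant
subspaces other than zero and the whole space. -/
def IsIrreducibleRep {A W : Type*} [Ring A] [Algebra ℝ A] [AddCommGroup W] [Module ℝ W]
    (ρ : A →ₐ[ℝ] Module.End ℝ W) : Prop :=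
  Nontrivial W ∧
    ∀ U : Submodule ℝ W, (∀ a, ∀ u ∈ U, ρ a u ∈ U) → U = ⊥ ∨ U = ⊤

variable {S₀ : Type*} [AddCommGroup S₀] [Module ℝ S₀]

/-- The set `𝔇` of operators `D` with `D² = α` which anticommute with all `γ₀(v)` and are antilinear
with respect to the complex structures `± γ₀(ν)`. -/
def conjugations (h : QuadraticForm ℝ V) (α : ℝ)
    (γ₀ : CliffordAlgebra h →ₐ[ℝ] Module.End ℝ S₀) : Set (Module.End ℝ S₀) :=
  {D | (∀ ν ∈ volumeElements h, D * γ₀ ν = -(γ₀ ν * D)) ∧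
    (∀ v, D * γ₀ (CliffordAlgebra.ι h v) = -(γ₀ (CliffordAlgebra.ι h v) * D)) ∧
    D * D = α • 1}

/-- A representation of `Cl₂(α)` compatible with `γ₀`: for some volume element `ν` and some
conjugation `D` it sends `e₁` to `D` and `e₂` to `-α γ₀(ν) D`. -/
def IsCompatible (h : QuadraticForm ℝ V) (α : ℝ)
    (γ₀ : CliffordAlgebra h →ₐ[ℝ] Module.End ℝ S₀)
    (γ₂ : CliffordTwo α →ₐ[ℝ] Module.End ℝ S₀) : Prop :=
  ∃ ν ∈ volumeElements h, ∃ D ∈ conjugations h α γ₀,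
    γ₂ (CliffordAlgebra.ι _ (Pi.single 0 1)) = D ∧
    γ₂ (CliffordAlgebra.ι _ (Pi.single 1 1)) = -α • (γ₀ ν * D)

lemma ι_mul_ι_of_polar {h : QuadraticForm ℝ V} {x y : V} (hxy : QuadraticMap.polar h x y = 0) :
    CliffordAlgebra.ι h x * CliffordAlgebra.ι h y =
      -(CliffordAlgebra.ι h y * CliffordAlgebra.ι h x) := by
  have := CliffordAlgebra.ι_mul_ι_add_swap (Q := h) x y
  rw [hxy, map_zero] at this
  exact eq_neg_of_add_eq_zero_left this

lemma prod_mul_ι_of_polar {h : QuadraticForm ℝ V} {x : V} (l : List V)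
    (hl : ∀ y ∈ l, QuadraticMap.polar h x y = 0) :
    (l.map (CliffordAlgebra.ι h)).prod * CliffordAlgebra.ι h x =
      (-1 : ℝ) ^ l.length • (CliffordAlgebra.ι h x * (l.map (CliffordAlgebra.ι h)).prod) := by
  induction l with
  | nil => simp
  | cons a l ih =>
    have h1 := ι_mul_ι_of_polar (hl a (by simp))
    have h2 := ih fun y hy => hl y (by simp [hy])
    rw [List.map_cons, List.prod_cons, mul_assoc, h2, ← mul_assoc (CliffordAlgebra.ι h x), h1,
      List.length_cons, pow_succ, mul_smul_comm]
    simp [mul_assoc]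

lemma ι_mul_prod_of_mem {h : QuadraticForm ℝ V} (l : List V)
    (hl : l.Pairwise fun x y => QuadraticMap.polar h x y = 0) (x : V) (hx : x ∈ l) :
    CliffordAlgebra.ι h x * (l.map (CliffordAlgebra.ι h)).prod =
      (-1 : ℝ) ^ (l.length + 1) •
        ((l.map (CliffordAlgebra.ι h)).prod * CliffordAlgebra.ι h x) := by
  induction l with
  | nil => simp at hx
  | cons a l ih =>
    rw [List.pairwise_cons] at hl
    rw [List.map_cons, List.prod_cons, List.length_cons]
    rcases List.mem_cons.1 hx with rfl | hx
    · rw [mul_assoc (CliffordAlgebra.ι h x), prod_mul_ι_of_polar l hl.1, mul_smul_comm, smul_smul,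
        ← pow_add, Even.neg_one_pow ⟨l.length + 1, by ring⟩, one_smul]
    · have h1 := ι_mul_ι_of_polar (hl.1 x hx)
      have h2 := ih hl.2 hx
      rw [← mul_assoc, ← neg_eq_iff_eq_neg.2 h1, neg_mul, mul_assoc, h2, mul_smul_comm, pow_succ _
        (l.length + 1)]
      simp [mul_assoc]

lemma ι_mul_volume {h : QuadraticForm ℝ V} {ν : CliffordAlgebra h} (hν : ν ∈ volumeElements h)
    (v : V) : CliffordAlgebra.ι h v * ν =
      (-1 : ℝ) ^ (Module.finrank ℝ V + 1) • (ν * CliffordAlgebra.ι h v) := by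
  obtain ⟨e, he, -, rfl⟩ := hν
  have hlist : (List.ofFn fun i => CliffordAlgebra.ι h (e i)) =
      (List.ofFn e).map (CliffordAlgebra.ι h) := by
    rw [List.map_ofFn]
    rfl
  rw [hlist]
  have hv : v ∈ Submodule.span ℝ (Set.range e) := by rw [e.span_eq]; trivial
  induction hv using Submodule.span_induction with
  | mem x hx =>
    obtain ⟨i, rfl⟩ := hx
    have := ι_mul_prod_of_mem (h := h) (List.ofFn e)
      (by
        rw [List.pairwise_ofFn]
        intro i j hij
        exact he i j hij.ne) (e i) (by simp)
    simpa using this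
  | zero => simp
  | add x y _ _ hx hy => rw [map_add, add_mul, hx, hy, mul_add, smul_add]
  | smul a x _ hx =>
    rw [map_smul, smul_mul_assoc, hx, mul_smul_comm, smul_comm]

lemma volume_commute_even {h : QuadraticForm ℝ V} {ν : CliffordAlgebra h}
    (hν : ν ∈ volumeElements h) {a : CliffordAlgebra h} (ha : a ∈ CliffordAlgebra.even h) :
    Commute a ν := by
  have ha' : a ∈ CliffordAlgebra.evenOdd h 0 := ha
  induction a, ha' using CliffordAlgebra.even_induction with
  | algebraMap r => exact Algebra.commutes r ν
  | add x y hx hy h1 h2 => exact (h1 hx).add_left (h2 hy)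
  | ι_mul_ι_mul m₁ m₂ x hx h1 =>
    have key : Commute (CliffordAlgebra.ι h m₁ * CliffordAlgebra.ι h m₂) ν := by
      change _ * _ = _ * _
      rw [mul_assoc, ι_mul_volume hν m₂, mul_smul_comm, ← mul_assoc, ι_mul_volume hν m₁,
        smul_mul_assoc, smul_smul, ← pow_add, Even.neg_one_pow ⟨_, rfl⟩, one_smul, mul_assoc]
    exact key.mul_left (h1 hx)

lemma conjugation_commute_even {h : QuadraticForm ℝ V} {α : ℝ}
    {γ₀ : CliffordAlgebra h →ₐ[ℝ] Module.End ℝ S₀} {D : Module.End ℝ S₀}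
    (hD : D ∈ conjugations h α γ₀) {a : CliffordAlgebra h} (ha : a ∈ CliffordAlgebra.even h) :
    Commute (γ₀ a) D := by
  have ha' : a ∈ CliffordAlgebra.evenOdd h 0 := ha
  induction a, ha' using CliffordAlgebra.even_induction with
  | algebraMap r =>
    rw [AlgHom.commutes]
    exact Algebra.commutes r D
  | add x y hx hy h1 h2 =>
    rw [map_add]
    exact (h1 hx).add_left (h2 hy)
  | ι_mul_ι_mul m₁ m₂ x hx h1 =>
    have e1 := hD.2.1 m₁
    have e2 := hD.2.1 m₂
    have key : Commute (γ₀ (CliffordAlgebra.ι h m₁) * γ₀ (CliffordAlgebra.ι h m₂)) D := by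
      change _ * _ = _ * _
      rw [← mul_assoc, e1, neg_mul, mul_assoc, mul_assoc, e2, mul_neg, neg_neg]
    rw [map_mul, map_mul]
    exact key.mul_left (h1 hx)

lemma compatible_commute {h : QuadraticForm ℝ V} {α : ℝ}
    {γ₀ : CliffordAlgebra h →ₐ[ℝ] Module.End ℝ S₀}
    {γ₂ : CliffordTwo α →ₐ[ℝ] Module.End ℝ S₀} (hc : IsCompatible h α γ₀ γ₂)
    {a : CliffordAlgebra h} (ha : a ∈ CliffordAlgebra.even h) (b : CliffordTwo α) :
    Commute (γ₀ a) (γ₂ b) := by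
  obtain ⟨ν, hν, D, hD, h1, h2⟩ := hc
  have c1 : Commute (γ₀ a) D := conjugation_commute_even hD ha
  have c2 : Commute (γ₀ a) (γ₀ ν) := (volume_commute_even hν ha).map γ₀
  induction b using CliffordAlgebra.induction with
  | algebraMap r =>
    rw [AlgHom.commutes]
    exact (Algebra.commutes r _).symm
  | ι v =>
    have hv : v = v 0 • Pi.single 0 1 + v 1 • Pi.single 1 1 := by
      ext i
      fin_cases i <;> simp
    rw [hv]
    simp only [map_add, map_smul, h1, h2]
    exact (c1.smul_right _).add_right (((c2.mul_right c1).smul_right _).smul_right _)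
  | mul x y hx hy =>
    rw [map_mul]
    exact hx.mul_right hy
  | add x y hx hy =>
    rw [map_add]
    exact hx.add_right hy

/-- The twisted elementary representation `γ_o([a, b]) = γ₀(a) γ₂(b)` of `Spin^o_α(V, h)`. -/
def twistedRep (h : QuadraticForm ℝ V) (α : ℝ)
    (γ₀ : CliffordAlgebra h →ₐ[ℝ] Module.End ℝ S₀)
    (γ₂ : CliffordTwo α →ₐ[ℝ] Module.End ℝ S₀) (hc : IsCompatible h α γ₀ γ₂) :
    SpinO h α →* (Module.End ℝ S₀)ˣ :=
  QuotientGroup.lift (signSubgroup h α)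
    (MonoidHom.noncommCoprod
      ((Units.map (γ₀ : CliffordAlgebra h →* Module.End ℝ S₀)).comp (spinGroup h).subtype)
      ((Units.map (γ₂ : CliffordTwo α →* Module.End ℝ S₀)).comp (pinTwo α).subtype)
      (fun a b => Units.ext (compatible_commute hc a.2.2 (b : (CliffordTwo α)ˣ))))
    (by
      rw [signSubgroup, Subgroup.zpowers_le]
      refine MonoidHom.mem_ker.2 (Units.ext ?_)
      simp [signElement, MonoidHom.noncommCoprod])

end Algebra

/-! ### Pseudo-Riemannian manifolds, the Clifford bundle and the complex orientation bundle -/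

section Geometry

variable {p q : ℕ} {M : Type*} [TopologicalSpace M]
  [ChartedSpace (EuclideanSpace ℝ (Fin (p + q))) M] [IsManifold (𝓡 (p + q)) ∞ M]

/-- The cotangent space at `x`. -/
abbrev Cotangent (p q : ℕ) {M : Type*} [TopologicalSpace M]
    [ChartedSpace (EuclideanSpace ℝ (Fin (p + q))) M] (x : M) : Type :=
  TangentSpace (𝓡 (p + q)) x →L[ℝ] ℝ

/-- The quadratic form of a continuous bilinear form. -/
def quadOf {W : Type*} [AddCommGroup W] [Module ℝ W] [TopologicalSpace W] [IsTopologicalAddGroup W]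
    [ContinuousConstSMul ℝ W] (B : W →L[ℝ] W →L[ℝ] ℝ) : QuadraticForm ℝ W :=
  LinearMap.BilinMap.toQuadraticMap
    ((ContinuousLinearMap.coeLM ℝ : (W →L[ℝ] ℝ) →ₗ[ℝ] (W →ₗ[ℝ] ℝ)) ∘ₗ B.toLinearMap)

variable (p q M) in
/-- A smooth pseudo-Riemannian metric of signature `(p, q)` on a manifold of dimension `p + q`. -/
structure PseudoRiemannianMetric where
  inner : ∀ x : M, TangentSpace (𝓡 (p + q)) x →L[ℝ] TangentSpace (𝓡 (p + q)) x →L[ℝ] ℝ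
  symm : ∀ x v w, inner x v w = inner x w v
  nondegenerate : ∀ x v, (∀ w, inner x v w = 0) → v = 0
  signature : ∀ x, HasSignature (quadOf (inner x)) p q
  contMDiff : ContMDiff (𝓡 (p + q))
    ((𝓡 (p + q)).prod 𝓘(ℝ, EuclideanSpace ℝ (Fin (p + q)) →L[ℝ]
      EuclideanSpace ℝ (Fin (p + q)) →L[ℝ] ℝ)) ∞
    (fun x => TotalSpace.mk' (EuclideanSpace ℝ (Fin (p + q)) →L[ℝ]
      EuclideanSpace ℝ (Fin (p + q)) →L[ℝ] ℝ) x (inner x))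

instance finiteDimensional_tangentSpace (x : M) :
    FiniteDimensional ℝ (TangentSpace (𝓡 (p + q)) x) :=
  inferInstanceAs (FiniteDimensional ℝ (EuclideanSpace ℝ (Fin (p + q))))

instance t2Space_tangentSpace (x : M) : T2Space (TangentSpace (𝓡 (p + q)) x) :=
  inferInstanceAs (T2Space (EuclideanSpace ℝ (Fin (p + q))))

namespace PseudoRiemannianMetric

variable (g : PseudoRiemannianMetric p q M)

lemma flat_bijective (x : M) : Function.Bijective (g.inner x).toLinearMap := by
  have hinj : Function.Injective (g.inner x).toLinearMap := by
    rw [← LinearMap.ker_eq_bot, LinearMap.ker_eq_bot']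
    intro v hv
    refine g.nondegenerate x v fun w => ?_
    have h0 : g.inner x v = 0 := hv
    rw [h0]
    rfl
  have hfin : Module.finrank ℝ (TangentSpace (𝓡 (p + q)) x) =
      Module.finrank ℝ (Cotangent p q x) := by
    rw [← LinearEquiv.finrank_eq (LinearMap.toContinuousLinearMap (𝕜 := ℝ)
      (E := TangentSpace (𝓡 (p + q)) x) (F' := ℝ))]
    exact Subspace.dual_finrank_eq.symm
  have : FiniteDimensional ℝ (Cotangent p q x) :=
    LinearEquiv.finiteDimensional (LinearMap.toContinuousLinearMap (𝕜 := ℝ)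
      (E := TangentSpace (𝓡 (p + q)) x) (F' := ℝ))
  exact ⟨hinj, (LinearMap.injective_iff_surjective_of_finrank_eq_finrank hfin).1 hinj⟩

/-- The musical isomorphism `v ↦ g(v, ·)`. -/
def flat (x : M) : TangentSpace (𝓡 (p + q)) x ≃ₗ[ℝ] Cotangent p q x :=
  LinearEquiv.ofBijective (g.inner x).toLinearMap (g.flat_bijective x)

/-- The quadratic form of the metric `g*` on the cotangent space:
`g*(ξ, ξ) = g(v, v)` for `ξ = g(v, ·)`. -/
def dualForm (x : M) : QuadraticForm ℝ (Cotangent p q x) :=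
  (quadOf (g.inner x)).comp (g.flat x).symm.toLinearMap

/-- The fiber at `x` of the Clifford bundle of `(T*M, g*)`. -/
abbrev Cl (x : M) : Type := CliffordAlgebra (g.dualForm x)

/-- Smoothness at `x₀` of sections of the Clifford bundle. Locally the smooth sections of the
Clifford bundle are the finite sums of products of smooth functions and smooth one-forms; they form
the sheaf of algebras generated by these. -/
inductive CliffordSmoothAt (x₀ : M) : (∀ x, g.Cl x) → Prop
  | function (f : M → ℝ) (hf : ContMDiffAt (𝓡 (p + q)) 𝓘(ℝ) ∞ f x₀) :
      CliffordSmoothAt x₀ (fun x => algebraMap ℝ (g.Cl x) (f x))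
  | oneForm (β : ∀ x : M, Cotangent p q x)
      (hβ : ContMDiffAt (𝓡 (p + q))
        ((𝓡 (p + q)).prod 𝓘(ℝ, EuclideanSpace ℝ (Fin (p + q)) →L[ℝ] ℝ)) ∞
        (fun x => TotalSpace.mk' (EuclideanSpace ℝ (Fin (p + q)) →L[ℝ] ℝ) x (β x)) x₀) :
      CliffordSmoothAt x₀ (fun x => CliffordAlgebra.ι (g.dualForm x) (β x))
  | add (σ τ : ∀ x, g.Cl x) : CliffordSmoothAt x₀ σ → CliffordSmoothAt x₀ τ →
      CliffordSmoothAt x₀ (fun x => σ x + τ x)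
  | mul (σ τ : ∀ x, g.Cl x) : CliffordSmoothAt x₀ σ → CliffordSmoothAt x₀ τ →
      CliffordSmoothAt x₀ (fun x => σ x * τ x)
  | congr (σ τ : ∀ x, g.Cl x) (hστ : ∀ᶠ x in nhds x₀, σ x = τ x) :
      CliffordSmoothAt x₀ σ → CliffordSmoothAt x₀ τ

/-- The orientation line `L_x = Λ^d T*_x M`, `d = p + q`, inside the Clifford algebra, through the
canonical identification of the Clifford algebra with the exterior algebra. -/
def orientationLine (x : M) : Submodule ℝ (g.Cl x) :=
  (⋀[ℝ]^(p + q) (Cotangent p q x)).map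
    (CliffordAlgebra.equivExterior (g.dualForm x)).symm.toLinearMap

/-- The fiber `L^c_x = ℝ ⊕ L_x` of the complex orientation bundle. -/
def complexOrientation (x : M) : Submodule ℝ (g.Cl x) :=
  Submodule.span ℝ {1} ⊔ g.orientationLine x

end PseudoRiemannianMetric

variable (p q M) in
/-- The manifold `M` is orientable: there is a choice of orientations of the tangent spaces which
is locally constant in the local trivializations of the tangent bundle. -/
def IsOrientable : Prop :=
  ∃ o : ∀ x : M, Orientation ℝ (TangentSpace (𝓡 (p + q)) x) (Fin (p + q)),
    ∀ x₀ : M, ∃ o₀ : Orientation ℝ (EuclideanSpace ℝ (Fin (p + q))) (Fin (p + q)),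
      ∀ᶠ x in nhds x₀, ∀ hx : x ∈ (trivializationAt (EuclideanSpace ℝ (Fin (p + q)))
          (TangentSpace (𝓡 (p + q))) x₀).baseSet,
        Orientation.map (Fin (p + q))
          ((trivializationAt (EuclideanSpace ℝ (Fin (p + q)))
            (TangentSpace (𝓡 (p + q))) x₀).linearEquivAt ℝ x hx) (o x) = o₀

/-! ### Elementary real pinor bundles, the Schur bundle, and reductions of the structure group -/

variable (F : Type*) [NormedAddCommGroup F] [NormedSpace ℝ F]
  (S : M → Type*) [∀ x, AddCommGroup (S x)] [∀ x, Module ℝ (S x)]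
  [∀ x, TopologicalSpace (S x)] [∀ x, IsTopologicalAddGroup (S x)] [∀ x, ContinuousSMul ℝ (S x)]
  [TopologicalSpace (TotalSpace F S)] [FiberBundle F S] [VectorBundle ℝ F S]

/-- Smoothness at `x₀` of sections of `S`. -/
def SectionSmoothAt (s : ∀ x, S x) (x₀ : M) : Prop :=
  ContMDiffAt (𝓡 (p + q)) ((𝓡 (p + q)).prod 𝓘(ℝ, F)) ∞ (fun x => TotalSpace.mk' F x (s x)) x₀

/-- Smoothness at `x₀` of sections of the endomorphism bundle of `S`. -/
def EndSmoothAt (T : ∀ x, S x →L[ℝ] S x) (x₀ : M) : Prop :=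
  ContMDiffAt (𝓡 (p + q)) ((𝓡 (p + q)).prod 𝓘(ℝ, F →L[ℝ] F)) ∞
    (fun x => TotalSpace.mk' (F →L[ℝ] F) x (T x)) x₀

/-- The algebra of continuous endomorphisms inside that of all linear endomorphisms (in finite
dimension they agree). -/
def endHom (W : Type*) [AddCommGroup W] [Module ℝ W] [TopologicalSpace W]
    [IsTopologicalAddGroup W] [ContinuousConstSMul ℝ W] : (W →L[ℝ] W) →ₐ[ℝ] Module.End ℝ W :=
  { ContinuousLinearMap.toLinearMapRingHom with commutes' := fun _ => rfl }

/-- An elementary real pinor bundle structure on the real vector bundle `S`: a smooth morphism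
`γ` of bundles of unital algebras from the Clifford bundle to the endomorphism bundle of `S` whose
restriction to every fiber is an irreducible representation. -/
structure ElementaryPinorStructure (g : PseudoRiemannianMetric p q M) where
  γ : ∀ x, g.Cl x →ₐ[ℝ] (S x →L[ℝ] S x)
  smooth : ∀ (σ : ∀ x, g.Cl x) (x₀ : M), g.CliffordSmoothAt x₀ σ →
    EndSmoothAt (p := p) (q := q) F S (fun x => γ x (σ x)) x₀
  irreducible : ∀ x, IsIrreducibleRep ((endHom (S x)).comp (γ x))

variable {F S} {g : PseudoRiemannianMetric p q M} (γ : ElementaryPinorStructure F S g)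

/-- The fiber `Σ_x` of the Schur bundle: the endomorphisms of `S_x` which commute with
`γ_x(v)` for all `v` in the cotangent space. -/
def schurAlgebra (x : M) : Subalgebra ℝ (S x →L[ℝ] S x) :=
  Subalgebra.centralizer ℝ (Set.range fun v => γ.γ x (CliffordAlgebra.ι (g.dualForm x) v))

/-- `L^c` is a smooth rank two sub-bundle of unital subalgebras of the Clifford bundle, `Σ` is a
smooth rank two sub-bundle of the endomorphism bundle of `S`, and `γ` restricts to an isomorphism
of bundles of unital algebras from `L^c` to `Σ` (it is fiberwise bijective, and a section of `L^c`
is smooth precisely when its image is smooth). -/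
structure RestrictsToIsomorphism : Prop where
  mul_mem : ∀ x, ∀ a ∈ g.complexOrientation x, ∀ b ∈ g.complexOrientation x,
    a * b ∈ g.complexOrientation x
  source_frames : ∀ x₀ : M, ∃ σ : Fin 2 → ∀ x, g.Cl x, ∀ᶠ x in nhds x₀,
    (∀ i, g.CliffordSmoothAt x (σ i)) ∧ LinearIndependent ℝ (fun i => σ i x) ∧
      Submodule.span ℝ (Set.range fun i => σ i x) = g.complexOrientation x
  target_frames : ∀ x₀ : M, ∃ T : Fin 2 → ∀ x, S x →L[ℝ] S x, ∀ᶠ x in nhds x₀,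
    (∀ i, EndSmoothAt (p := p) (q := q) F S (T i) x) ∧ LinearIndependent ℝ (fun i => T i x) ∧
      Submodule.span ℝ (Set.range fun i => T i x) = Subalgebra.toSubmodule (schurAlgebra γ x)
  bijOn : ∀ x, Set.BijOn (γ.γ x) (g.complexOrientation x) (schurAlgebra γ x)
  smooth_iff : ∀ σ : ∀ x, g.Cl x, (∀ x, σ x ∈ g.complexOrientation x) → ∀ x₀,
    g.CliffordSmoothAt x₀ σ ↔ EndSmoothAt (p := p) (q := q) F S (fun x => γ.γ x (σ x)) x₀

/-- The Schur bundle is trivial as a real vector bundle. -/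
def SchurTrivialVectorBundle : Prop :=
  ∃ T : Fin 2 → ∀ x, S x →L[ℝ] S x, (∀ i x, EndSmoothAt (p := p) (q := q) F S (T i) x) ∧
    ∀ x, LinearIndependent ℝ (fun i => T i x) ∧
      Submodule.span ℝ (Set.range fun i => T i x) = Subalgebra.toSubmodule (schurAlgebra γ x)

/-- The Schur bundle is trivial as a bundle of unital real algebras: it is isomorphic to the
product bundle with fiber `ℂ`. -/
def SchurTrivialAlgebraBundle : Prop :=
  ∃ φ : ∀ x, ℂ ≃ₐ[ℝ] schurAlgebra γ x, ∀ z x₀,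
    EndSmoothAt (p := p) (q := q) F S (fun x => (φ x z : S x →L[ℝ] S x)) x₀

variable (F S) in
/-- Let `ρ : G → GL(S₀)` be a faithful representation and let `H` be a subgroup of `G`. A family
`P` of sets of frames `S₀ ≃ S_x` is a principal `H`-bundle to which `S` is associated through `ρ`
if `P` has smooth local sections, and `H` acts on each `P_x` simply transitively through
`f · k = f ∘ ρ(k)`. -/
structure IsPrincipalFrameBundle {S₀ : Type*} [AddCommGroup S₀] [Module ℝ S₀]
    {G : Type*} [Group G] (ρ : G →* (Module.End ℝ S₀)ˣ) (H : Subgroup G)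
    (P : ∀ x, Set (S₀ ≃ₗ[ℝ] S x)) : Prop where
  simply_transitive : ∀ x, ∀ f ∈ P x, ∀ f' : S₀ ≃ₗ[ℝ] S x,
    f' ∈ P x ↔ ∃! k : G, k ∈ H ∧ ∀ s, f' s = f ((ρ k : Module.End ℝ S₀) s)
  local_sections : ∀ x₀ : M, ∃ f : ∀ x, S₀ ≃ₗ[ℝ] S x, ∀ᶠ x in nhds x₀,
    f x ∈ P x ∧ ∀ s, SectionSmoothAt (p := p) (q := q) F S (fun y => f y s) x

/-- `Q` is an adapted `Spin^o` structure of the pinor bundle `(S, γ)`: a principal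
`Spin^o(V, h)`-bundle of frames of `S`, with `S = Q ×_{γ_o} S₀`, each of whose elements
`f : S₀ ≃ S_x` covers an isometry `φ : V ≃ T*_x M` with `γ_x(φ(v)) = f γ₀(v) f⁻¹`. The assignment
`f ↦ φ` is the map from `Q` to the orthonormal coframe bundle, and Clifford multiplication on `S`
is induced by `γ₀`. -/
structure IsAdaptedSpinO {V : Type*} [AddCommGroup V] [Module ℝ V] (h : QuadraticForm ℝ V)
    {S₀ : Type*} [AddCommGroup S₀] [Module ℝ S₀]
    (γ₀ : CliffordAlgebra h →ₐ[ℝ] Module.End ℝ S₀)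
    (γ₂ : CliffordTwo (alpha p q) →ₐ[ℝ] Module.End ℝ S₀)
    (hc : IsCompatible h (alpha p q) γ₀ γ₂)
    (Q : ∀ x, Set (S₀ ≃ₗ[ℝ] S x)) : Prop where
  principal : IsPrincipalFrameBundle (p := p) (q := q) F S
    (twistedRep h (alpha p q) γ₀ γ₂ hc) ⊤ Q
  adapted : ∀ x, ∀ f ∈ Q x, ∃ φ : h.IsometryEquiv (g.dualForm x), ∀ v s,
    f (γ₀ (CliffordAlgebra.ι h v) s) = γ.γ x (CliffordAlgebra.ι (g.dualForm x) (φ v)) (f s)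

variable (p q F S) in
/-- The structure group reduces from `Spin^o(V, h)` to `Spin^c(V, h)`: the principal
`Spin^o(V, h)`-bundle `Q` contains a principal `Spin^c(V, h)`-sub-bundle. -/
def ReducesToSpinC {V : Type*} [AddCommGroup V] [Module ℝ V] (h : QuadraticForm ℝ V)
    {S₀ : Type*} [AddCommGroup S₀] [Module ℝ S₀]
    (γ₀ : CliffordAlgebra h →ₐ[ℝ] Module.End ℝ S₀)
    (γ₂ : CliffordTwo (alpha p q) →ₐ[ℝ] Module.End ℝ S₀)
    (hc : IsCompatible h (alpha p q) γ₀ γ₂)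
    (Q : ∀ x, Set (S₀ ≃ₗ[ℝ] S x)) : Prop :=
  ∃ P : ∀ x, Set (S₀ ≃ₗ[ℝ] S x), (∀ x, P x ⊆ Q x) ∧
    IsPrincipalFrameBundle (p := p) (q := q) F S
      (twistedRep h (alpha p q) γ₀ γ₂ hc) (spinC h (alpha p q)) P

end Geometry

end PinorGeom
end

/-! The volume element `ν` of a fibre governs everything. For `p - q ≡ 3, 7 (mod 8)` the dimension
is odd, so `ν` is central, and `ν² = -1`. Another pseudo-orthonormal basis changes `ν` only by a
sign, the determinant of the change of basis. Hence the centre of the Clifford algebra is `ℝ ⊕ ℝν ≃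
ℂ`, and a choice between `ν` and `-ν` is a choice of orientation.

No classification of Clifford algebras is used. Its place is taken by one averaging argument,
`exists_intertwiner_mem`: a nonzero linear map between Clifford modules that commutes with `ν`
yields a nonzero intertwiner inside any sub-bimodule containing it. Applied to ideals it gives
faithfulness (`rep_injective`). Applied to all linear maps it gives uniqueness of the irreducible
representation (`exists_intertwiner_equiv`). Applied to the operators `γ₁ u` it gives
Skolem–Noether, so that isometries fixing `ν` lift to the spin group (`exists_spin_of_isometry`).
Together with a complex eigenvalue, Schur's lemma shows that the commutant is `ℝ + ℝ γ(ν)`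
(`exists_eq_of_commutes`). This is the first assertion fibrewise. It becomes smooth through local
signed frames built by Gram–Schmidt and through traces, which recover the coefficients of `1` and
`γ(ν)`.

For the `Spin^o` structure, the twisted representation is faithful, and its image consists exactly
of the operators which cover an isometry of `V` and have determinant `±1`
(`IsPinorModel.rep_covers`, `IsPinorModel.exists_rep_eq`). So `Q` can be the set of adapted frames
of unit density. Smooth adapted frames come from uniqueness at one point followed by averaging, and
the density from a partition of unity.

The equivalences all pass through a smooth section `J` of the Schur bundle with `J² = -1`. In a
fibre only `±γ(ν)` has this property, so `J` is an orientation. The pair `1, J` trivialises the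
Schur bundle. Since `Spin^c` is the subgroup commuting with `γ₀(ν)` (`IsPinorModel.mem_spinC_iff`),
the frames carrying `γ₀(ν)` to `J` form the reduction, and conversely a reduction transports `γ₀(ν)`
to such a `J`. -/

noncomputable section
namespace PinorGeom

/-! ### Pseudo-orthonormal bases and their volume elements -/

section PseudoOrthonormal

variable {V : Type*} [AddCommGroup V] [Module ℝ V] {h : QuadraticForm ℝ V} {n : ℕ}

/-- A family of pairwise orthogonal vectors of square `1` or `-1`. -/
structure IsPseudoOrthonormal (h : QuadraticForm ℝ V) (b : Fin n → V) : Prop where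
  orth : ∀ i j, i ≠ j → QuadraticMap.polar h (b i) (b j) = 0
  unit : ∀ i, h (b i) = 1 ∨ h (b i) = -1

/-- The Clifford product of a family of vectors. -/
def vol (h : QuadraticForm ℝ V) (b : Fin n → V) : CliffordAlgebra h :=
  (List.ofFn fun i => CliffordAlgebra.ι h (b i)).prod

namespace IsPseudoOrthonormal

lemma polar_self_ne_zero {b : Fin n → V} (hb : IsPseudoOrthonormal h b) (i : Fin n) :
    QuadraticMap.polar h (b i) (b i) ≠ 0 := by
  rw [QuadraticMap.polar_self]
  rcases hb.unit i with h1 | h1 <;> rw [h1] <;> norm_num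

lemma linearIndependent {b : Fin n → V} (hb : IsPseudoOrthonormal h b) :
    LinearIndependent ℝ b := by
  rw [Fintype.linearIndependent_iff]
  intro c hc i
  have h1 : QuadraticMap.polarBilin h (∑ j, c j • b j) (b i) = 0 := by
    rw [hc, map_zero, LinearMap.zero_apply]
  rw [map_sum, LinearMap.sum_apply, Finset.sum_eq_single i] at h1
  · simp only [map_smul, LinearMap.smul_apply, QuadraticMap.polarBilin_apply_apply,
      smul_eq_mul, mul_eq_zero] at h1
    exact h1.resolve_right (hb.polar_self_ne_zero i)
  · intro j _ hj
    simp [hb.orth j i hj]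
  · simp

/-- A pseudo-orthonormal family of the right length is a basis. -/
def basis [FiniteDimensional ℝ V] {b : Fin n → V} (hb : IsPseudoOrthonormal h b)
    (hn : Module.finrank ℝ V = n) :
    Module.Basis (Fin n) ℝ V :=
  Module.Basis.mk hb.linearIndependent
    (hb.linearIndependent.span_eq_top_of_card_eq_finrank' (by simp [hn])).ge

@[simp] lemma coe_basis [FiniteDimensional ℝ V] {b : Fin n → V} (hb : IsPseudoOrthonormal h b)
    (hn : Module.finrank ℝ V = n) : ⇑(hb.basis hn) = b := by
  simp [basis]

lemma comp_isometry {W : Type*} [AddCommGroup W] [Module ℝ W] {k : QuadraticForm ℝ W}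
    {b : Fin n → V} (hb : IsPseudoOrthonormal h b) (φ : h.IsometryEquiv k) :
    IsPseudoOrthonormal k (φ ∘ b) := by
  refine ⟨fun i j hij => ?_, fun i => ?_⟩
  · have := hb.orth i j hij
    simp only [QuadraticMap.polar, Function.comp] at this ⊢
    rw [← map_add, φ.map_app, φ.map_app, φ.map_app, this]
  · simpa using hb.unit i

lemma unit_sq {b : Fin n → V} (hb : IsPseudoOrthonormal h b) (i : Fin n) :
    h (b i) * h (b i) = 1 := by
  rcases hb.unit i with h1 | h1 <;> rw [h1] <;> norm_num

lemma ι_mul_ι {b : Fin n → V} (hb : IsPseudoOrthonormal h b) {i j : Fin n} (hij : i ≠ j) :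
    CliffordAlgebra.ι h (b i) * CliffordAlgebra.ι h (b j) =
      -(CliffordAlgebra.ι h (b j) * CliffordAlgebra.ι h (b i)) :=
  ι_mul_ι_of_polar (hb.orth i j hij)

end IsPseudoOrthonormal

lemma vol_mem_volumeElements {b : Module.Basis (Fin n) ℝ V} (hb : IsPseudoOrthonormal h b) :
    vol h b ∈ volumeElements h := by
  obtain rfl : n = Module.finrank ℝ V := by simpa using (Module.finrank_eq_card_basis b).symm
  exact ⟨b, hb.orth, hb.unit, rfl⟩

lemma exists_eq_vol {ν : CliffordAlgebra h} (hν : ν ∈ volumeElements h)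
    (hn : Module.finrank ℝ V = n) : ∃ b : Module.Basis (Fin n) ℝ V,
      IsPseudoOrthonormal h b ∧ ν = vol h b := by
  subst hn
  obtain ⟨b, h1, h2, h3⟩ := hν
  exact ⟨b, ⟨h1, h2⟩, h3⟩

/-- The passage to the exterior algebra corrects a product `ι a * x` by a contraction against the
bilinear form of `a`. Orthogonality makes every such contraction vanish. -/
lemma equivExterior_prod (l : List V)
    (hl : l.Pairwise fun x y => QuadraticMap.polar h x y = 0) :
    CliffordAlgebra.equivExterior h (l.map (CliffordAlgebra.ι h)).prod =
      (l.map (ExteriorAlgebra.ι ℝ)).prod := by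
  induction l with
  | nil => exact CliffordAlgebra.changeForm_one CliffordAlgebra.changeForm.associated_neg_proof
  | cons a l ih =>
    rw [List.pairwise_cons] at hl
    have ih' := ih hl.2
    rw [List.map_cons, List.prod_cons, List.map_cons, List.prod_cons, ← ih']
    refine (CliffordAlgebra.changeForm_ι_mul CliffordAlgebra.changeForm.associated_neg_proof _ _).trans ?_
    refine sub_eq_self.2 ?_
    have key : ∀ (d : Module.Dual ℝ V) (l : List V), (∀ y ∈ l, d y = 0) →
        CliffordAlgebra.contractLeft d
          (l.map (CliffordAlgebra.ι (0 : QuadraticForm ℝ V))).prod = 0 := by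
      intro d l hd
      induction l with
      | nil => exact CliffordAlgebra.contractLeft_one _ d
      | cons y l ih2 =>
        rw [List.map_cons, List.prod_cons, CliffordAlgebra.contractLeft_ι_mul,
          hd y (by simp), ih2 (fun z hz => hd z (List.mem_cons_of_mem _ hz)), zero_smul, mul_zero,
          sub_zero]
    have ih'' : (CliffordAlgebra.changeForm CliffordAlgebra.changeForm.associated_neg_proof)
        (l.map (CliffordAlgebra.ι h)).prod =
        (l.map (CliffordAlgebra.ι (0 : QuadraticForm ℝ V))).prod := ih'
    rw [ih'']
    refine key _ l fun y hy => ?_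
    have := hl.1 y hy
    simp [QuadraticMap.associated_apply, QuadraticMap.polar] at this ⊢
    linarith

lemma equivExterior_vol {b : Fin n → V} (hb : IsPseudoOrthonormal h b) :
    CliffordAlgebra.equivExterior h (vol h b) = ExteriorAlgebra.ιMulti ℝ n b := by
  have h1 : vol h b = ((List.ofFn b).map (CliffordAlgebra.ι h)).prod := by
    rw [List.map_ofFn]; rfl
  rw [h1, equivExterior_prod, ExteriorAlgebra.ιMulti_apply, List.map_ofFn]
  · rfl
  · rw [List.pairwise_ofFn]
    exact fun i j hij => hb.orth i j hij.ne

/-- Both sides are alternating of degree `n`, so it suffices to compare them on injective choices of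
basis vectors. These are permutations, and both sides pick up the same sign. -/
lemma ιMulti_eq_det_smul (b : Module.Basis (Fin n) ℝ V) (v : Fin n → V) :
    ExteriorAlgebra.ιMulti ℝ n v = b.det v • ExteriorAlgebra.ιMulti ℝ n b := by
  have h2 : ExteriorAlgebra.ιMulti ℝ n (M := V) =
      (LinearMap.toSpanSingleton ℝ _ (ExteriorAlgebra.ιMulti ℝ n b)).compAlternatingMap b.det := by
    refine Module.Basis.ext_alternating b fun v hv => ?_
    let σ : Equiv.Perm (Fin n) := Equiv.ofBijective v (Finite.injective_iff_bijective.1 hv)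
    have h3 : (fun i => b (v i)) = b ∘ σ := rfl
    rw [h3, AlternatingMap.map_perm, AlternatingMap.map_perm]
    simp [b.det_self]
  have h3 := congrArg (fun f => f v) h2
  simpa using h3

/-- In the top exterior power a change of basis acts by its determinant. This is the link between
volume elements and orientations. -/
lemma vol_eq_det_smul (b : Module.Basis (Fin n) ℝ V) (hb : IsPseudoOrthonormal h b)
    {b' : Fin n → V} (hb' : IsPseudoOrthonormal h b') : vol h b' = b.det b' • vol h b := by
  apply (CliffordAlgebra.equivExterior h).injective
  rw [map_smul, equivExterior_vol hb, equivExterior_vol hb', ιMulti_eq_det_smul b]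

lemma vol_mul_self_eq (b : Module.Basis (Fin n) ℝ V) (hb : IsPseudoOrthonormal h b)
    {b' : Fin n → V} (hb' : IsPseudoOrthonormal h b') :
    vol h b' * vol h b' = (b.det b') ^ 2 • (vol h b * vol h b) := by
  rw [vol_eq_det_smul b hb hb', smul_mul_smul_comm, pow_two]

lemma algebraMap_injective' : Function.Injective (algebraMap ℝ (CliffordAlgebra h)) :=
  (algebraMap ℝ (CliffordAlgebra h)).injective

/-- The square of a product of `n` pairwise orthogonal vectors. -/
lemma prod_mul_prod (l : List V) (hl : l.Pairwise fun x y => QuadraticMap.polar h x y = 0) :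
    (l.map (CliffordAlgebra.ι h)).prod * (l.map (CliffordAlgebra.ι h)).prod =
      algebraMap ℝ _ ((-1) ^ (l.length * (l.length - 1) / 2) * (l.map h).prod) := by
  induction l with
  | nil => simp
  | cons a l ih =>
    rw [List.pairwise_cons] at hl
    have h1 := prod_mul_ι_of_polar (h := h) l hl.1
    have h2 := ih hl.2
    rw [List.map_cons, List.prod_cons]
    set P := (l.map (CliffordAlgebra.ι h)).prod with hP
    have : CliffordAlgebra.ι h a * P * (CliffordAlgebra.ι h a * P) =
        CliffordAlgebra.ι h a * (P * CliffordAlgebra.ι h a) * P := by noncomm_ring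
    rw [this, h1, mul_smul_comm, ← mul_assoc, CliffordAlgebra.ι_sq_scalar, smul_mul_assoc,
      mul_assoc, h2, Algebra.smul_def, ← map_mul, ← map_mul]
    congr 1
    -- The exponent grows by the length of the tail, the number of factors past which `a` has been
    -- moved.
    have h4 : (a :: l).length * ((a :: l).length - 1) / 2 =
        l.length * (l.length - 1) / 2 + l.length := by
      rw [List.length_cons, Nat.add_sub_cancel, mul_comm]
      rcases l.length with _ | m
      · rfl
      · have : (m + 1) * (m + 1 + 1) = (m + 1) * (m + 1 - 1) + (m + 1) * 2 := by
          simp; ring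
        rw [this, Nat.add_mul_div_right _ _ (by norm_num)]
    rw [h4, pow_add, List.map_cons, List.prod_cons]
    ring

lemma vol_mul_vol {b : Fin n → V} (hb : IsPseudoOrthonormal h b) :
    vol h b * vol h b = algebraMap ℝ _ ((-1) ^ (n * (n - 1) / 2) * ∏ i, h (b i)) := by
  have h1 : vol h b = ((List.ofFn b).map (CliffordAlgebra.ι h)).prod := by
    rw [List.map_ofFn]; rfl
  rw [h1, prod_mul_prod, List.map_ofFn, List.prod_ofFn, List.length_ofFn]
  · rfl
  · rw [List.pairwise_ofFn]
    exact fun i j hij => hb.orth i j hij.ne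

/-- The signs `1, …, 1, -1, …, -1` of a form of signature `(p, q)`. -/
def signs (p q : ℕ) (i : Fin (p + q)) : ℝ :=
  Sum.elim (fun _ : Fin p => (1 : ℝ)) (fun _ : Fin q => (-1 : ℝ)) (finSumFinEquiv.symm i)

lemma signs_eq (p q : ℕ) (i : Fin (p + q)) : signs p q i = 1 ∨ signs p q i = -1 := by
  unfold signs
  rcases finSumFinEquiv.symm i with j | j <;> simp

lemma prod_signs (p q : ℕ) : ∏ i, signs p q i = (-1) ^ q := by
  unfold signs
  rw [Fintype.prod_equiv finSumFinEquiv.symm _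
    (Sum.elim (fun _ : Fin p => (1 : ℝ)) (fun _ : Fin q => (-1 : ℝ))) (fun _ => rfl)]
  simp

lemma HasSignature.exists_basis {p q : ℕ} (hs : HasSignature h p q) :
    ∃ b : Module.Basis (Fin (p + q)) ℝ V,
      (∀ i j, i ≠ j → QuadraticMap.polar h (b i) (b j) = 0) ∧ ∀ i, h (b i) = signs p q i := by
  obtain ⟨φ⟩ := hs
  refine ⟨((Pi.basisFun ℝ (Fin p ⊕ Fin q)).map φ.symm.toLinearEquiv).reindex finSumFinEquiv,
    fun i j hij => ?_, fun i => ?_⟩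
  · have hij' : finSumFinEquiv.symm i ≠ finSumFinEquiv.symm j := by simpa using hij
    simp only [Module.Basis.reindex_apply, Module.Basis.map_apply, Pi.basisFun_apply]
    generalize finSumFinEquiv.symm i = i' at *
    generalize finSumFinEquiv.symm j = j' at *
    have hp : ∀ x y, QuadraticMap.polar h (φ.symm x) (φ.symm y) =
        QuadraticMap.polar (QuadraticMap.weightedSumSquares ℝ
          (Sum.elim (fun _ : Fin p => (1 : ℝ)) (fun _ : Fin q => (-1 : ℝ)))) x y := by
      intro x y
      simp only [QuadraticMap.polar]
      rw [← map_add, φ.symm.map_app, φ.symm.map_app, φ.symm.map_app]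
    refine (hp _ _).trans ?_
    simp only [QuadraticMap.polar, QuadraticMap.weightedSumSquares_apply, ← Finset.sum_sub_distrib]
    refine Finset.sum_eq_zero fun k _ => ?_
    by_cases h1 : k = i' <;> by_cases h2 : k = j' <;>
      simp_all
  · simp only [Module.Basis.reindex_apply, Module.Basis.map_apply, Pi.basisFun_apply]
    refine (φ.symm.map_app _).trans ?_
    simp [QuadraticMap.weightedSumSquares_apply, Pi.single_apply, signs]

lemma isPseudoOrthonormal_of_signs {p q : ℕ} {b : Fin (p + q) → V}
    (h1 : ∀ i j, i ≠ j → QuadraticMap.polar h (b i) (b j) = 0)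
    (h2 : ∀ i, h (b i) = signs p q i) : IsPseudoOrthonormal h b :=
  ⟨h1, fun i => by rw [h2]; exact signs_eq p q i⟩

lemma odd_of_mod {p q : ℕ} (hpq : ((p : ℤ) - q) % 8 = 3 ∨ ((p : ℤ) - q) % 8 = 7) :
    Odd (p + q) := by
  rw [Nat.odd_iff]; omega

/-- The sign is the parity of `d (d - 1) / 2 + q` with `d = p + q = 2 m + 1`. It equals the parity
of `m + q`, which is odd because `p - q ≡ 3 (mod 4)`. -/
lemma vol_sq_of_signs {p q : ℕ} (hpq : ((p : ℤ) - q) % 8 = 3 ∨ ((p : ℤ) - q) % 8 = 7)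
    {b : Fin (p + q) → V} (h1 : ∀ i j, i ≠ j → QuadraticMap.polar h (b i) (b j) = 0)
    (h2 : ∀ i, h (b i) = signs p q i) : vol h b * vol h b = -1 := by
  rw [vol_mul_vol (isPseudoOrthonormal_of_signs h1 h2), Finset.prod_congr rfl fun i _ => h2 i,
    prod_signs, ← pow_add]
  have h3 : Odd ((p + q) * (p + q - 1) / 2 + q) := by
    obtain ⟨m, hm⟩ := odd_of_mod hpq
    have h4 : (p + q) * (p + q - 1) / 2 = (p + q) * m := by
      rw [hm, Nat.add_sub_cancel, mul_left_comm]
      simp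
    rw [h4, hm]
    have h5 : Odd (m + q) := by
      rw [Nat.odd_iff]; omega
    have h6 : (2 * m + 1) * m + q = 2 * (m * m) + (m + q) := by ring
    rw [h6]
    exact (even_two_mul _).add_odd h5
  rw [h3.neg_one_pow, map_neg, map_one]

/-- Any two products of pseudo-orthonormal bases agree up to sign if one of them is a complex
structure. -/
lemma det_eq_one_or_neg_one (b : Module.Basis (Fin n) ℝ V) (hb : IsPseudoOrthonormal h b)
    (hsq : vol h b * vol h b = -1) {b' : Fin n → V} (hb' : IsPseudoOrthonormal h b') :
    b.det b' = 1 ∨ b.det b' = -1 := by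
  have h1 := vol_mul_self_eq b hb hb'
  have h2 := vol_mul_vol hb'
  rw [h1, hsq, smul_neg, ← Algebra.algebraMap_eq_smul_one, ← map_neg] at h2
  have h3 := algebraMap_injective' h2
  -- The square of any such product is the scalar `1` or `-1`, so the squared determinant is a sign.
  -- Being a real square, it is `1`.
  have h4 : (b.det b') ^ 2 = 1 ∨ (b.det b') ^ 2 = -1 := by
    have h5 : (∏ i, h (b' i)) = 1 ∨ (∏ i, h (b' i)) = -1 := by
      refine Finset.prod_induction _ (fun x => x = 1 ∨ x = -1) ?_ (Or.inl rfl)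
        fun i _ => hb'.unit i
      rintro x y (rfl | rfl) (rfl | rfl) <;> norm_num
    rcases neg_one_pow_eq_or ℝ (n * (n - 1) / 2) with h6 | h6 <;> rcases h5 with h5 | h5 <;>
      rw [h5, h6] at h3 <;> [right; left; left; right] <;> linarith
  rcases h4 with h4 | h4
  · exact sq_eq_one_iff.1 h4
  · nlinarith [sq_nonneg (b.det b')]

/-- A basis vector commutes with its own factor and anticommutes with the other `n - 1`, an even
number. -/
lemma vol_commute (hn : Odd n) {b : Module.Basis (Fin n) ℝ V} (hb : IsPseudoOrthonormal h b)
    (x : CliffordAlgebra h) : Commute (vol h b) x := by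
  have hd : Module.finrank ℝ V = n := by simpa using Module.finrank_eq_card_basis b
  induction x using CliffordAlgebra.induction with
  | algebraMap r => exact (Algebra.commutes r _).symm
  | ι v =>
    have := ι_mul_volume (vol_mem_volumeElements hb) v
    rw [hd, (hn.add_odd odd_one).neg_one_pow, one_smul] at this
    exact this.symm
  | mul x y hx hy => exact hx.mul_right hy
  | add x y hx hy => exact hx.add_right hy

lemma involute_vol (hn : Odd n) (b : Fin n → V) :
    CliffordAlgebra.involute (vol h b) = -vol h b := by
  have : ∀ l : List V, CliffordAlgebra.involute (l.map (CliffordAlgebra.ι h)).prod =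
      (-1 : ℝ) ^ l.length • (l.map (CliffordAlgebra.ι h)).prod := by
    intro l
    induction l with
    | nil => simp
    | cons a l ih => simp [ih, pow_succ]
  have h1 : vol h b = ((List.ofFn b).map (CliffordAlgebra.ι h)).prod := by
    rw [List.map_ofFn]; rfl
  rw [h1, this, List.length_ofFn, hn.neg_one_pow, neg_one_smul]

/-- The map `-id` on vectors extends to the grading involution. In odd dimension it therefore
exchanges the two volume elements, and it serves below to switch orientations. -/
lemma vol_neg (hn : Odd n) (b : Fin n → V) : vol h (-b) = -vol h b := by
  rw [← involute_vol hn]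
  unfold vol
  rw [map_list_prod, List.map_ofFn]
  congr 2
  funext i
  simp

end PseudoOrthonormal
end PinorGeom
end

noncomputable section
namespace PinorGeom

/-! ### Averaging linear maps into Clifford intertwiners -/

section Intertwiner

variable {V : Type*} [AddCommGroup V] [Module ℝ V] {h : QuadraticForm ℝ V} {n : ℕ}
  {S₁ S₂ : Type*} [AddCommGroup S₁] [Module ℝ S₁] [AddCommGroup S₂] [Module ℝ S₂]
  (γ₁ : CliffordAlgebra h →ₐ[ℝ] Module.End ℝ S₁) (γ₂ : CliffordAlgebra h →ₐ[ℝ] Module.End ℝ S₂)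

/-- The average of a linear map between Clifford modules over the reflection group of a vector of
square `1` or `-1`. -/
def avg (v : V) (L : S₁ →ₗ[ℝ] S₂) : S₁ →ₗ[ℝ] S₂ :=
  (1 / 2 : ℝ) • (L + h v • (γ₂ (CliffordAlgebra.ι h v) ∘ₗ L ∘ₗ γ₁ (CliffordAlgebra.ι h v)))

variable {γ₁ γ₂}

lemma avg_apply (v : V) (L : S₁ →ₗ[ℝ] S₂) (s : S₁) : avg γ₁ γ₂ v L s = (1 / 2 : ℝ) •
    (L s + h v • γ₂ (CliffordAlgebra.ι h v) (L (γ₁ (CliffordAlgebra.ι h v) s))) := rfl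

lemma rep_mul_apply (γ₁ : CliffordAlgebra h →ₐ[ℝ] Module.End ℝ S₁) (a b : CliffordAlgebra h)
    (s : S₁) : γ₁ (a * b) s = γ₁ a (γ₁ b s) := by
  rw [map_mul]; rfl

lemma rep_ι_ι (γ₁ : CliffordAlgebra h →ₐ[ℝ] Module.End ℝ S₁) (v : V) (s : S₁) :
    γ₁ (CliffordAlgebra.ι h v) (γ₁ (CliffordAlgebra.ι h v) s) = h v • s := by
  rw [← rep_mul_apply, CliffordAlgebra.ι_sq_scalar, AlgHom.commutes]; rfl

/-- As `h v` is its own inverse, `L ↦ h v • v L v` is conjugation by `v`, an involution, and the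
average is its fixed part. -/
lemma avg_comm_self {v : V} (hv : h v * h v = 1) (L : S₁ →ₗ[ℝ] S₂) (s : S₁) :
    γ₂ (CliffordAlgebra.ι h v) (avg γ₁ γ₂ v L s) =
      avg γ₁ γ₂ v L (γ₁ (CliffordAlgebra.ι h v) s) := by
  simp only [avg_apply, map_smul, map_add, rep_ι_ι, smul_smul, hv, one_smul]
  rw [add_comm]

/-- The sign `σ` from exchanging `a` and `v` occurs once on each side of `L` and cancels. Averaging
thus preserves the commutation relations already obtained. -/
lemma avg_comm_of {v : V} {L : S₁ →ₗ[ℝ] S₂} {a : CliffordAlgebra h} {σ : ℝ} (hσ : σ * σ = 1)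
    (hav : a * CliffordAlgebra.ι h v = σ • (CliffordAlgebra.ι h v * a))
    (ha : ∀ s, γ₂ a (L s) = L (γ₁ a s)) (s : S₁) :
    γ₂ a (avg γ₁ γ₂ v L s) = avg γ₁ γ₂ v L (γ₁ a s) := by
  have h1 : γ₂ a (γ₂ (CliffordAlgebra.ι h v) (L (γ₁ (CliffordAlgebra.ι h v) s))) =
      γ₂ (CliffordAlgebra.ι h v) (L (γ₁ (CliffordAlgebra.ι h v) (γ₁ a s))) := by
    rw [← rep_mul_apply γ₂, hav, map_smul, LinearMap.smul_apply, rep_mul_apply, ha,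
      ← rep_mul_apply γ₁, hav, map_smul, LinearMap.smul_apply, rep_mul_apply, map_smul, map_smul,
      smul_smul, hσ, one_smul]
  simp only [avg_apply, map_smul, map_add, h1, ha]

lemma avg_eq_self {v : V} (hv : h v * h v = 1) {L : S₁ →ₗ[ℝ] S₂}
    (ha : ∀ s, γ₂ (CliffordAlgebra.ι h v) (L s) = L (γ₁ (CliffordAlgebra.ι h v) s)) :
    avg γ₁ γ₂ v L = L := by
  ext s
  rw [avg_apply, ha, rep_ι_ι, map_smul, smul_smul, hv, one_smul, ← two_smul ℝ, smul_smul]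
  norm_num

lemma intertwines_of_basis (b : Module.Basis (Fin n) ℝ V) {L : S₁ →ₗ[ℝ] S₂}
    (hL : ∀ i s, γ₂ (CliffordAlgebra.ι h (b i)) (L s) = L (γ₁ (CliffordAlgebra.ι h (b i)) s))
    (a : CliffordAlgebra h) (s : S₁) : γ₂ a (L s) = L (γ₁ a s) := by
  induction a using CliffordAlgebra.induction generalizing s with
  | algebraMap r => simp [Algebra.algebraMap_eq_smul_one]
  | ι v =>
    have hv : v ∈ Submodule.span ℝ (Set.range b) := by rw [b.span_eq]; trivial
    induction hv using Submodule.span_induction with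
    | mem x hx => obtain ⟨i, rfl⟩ := hx; exact hL i s
    | zero => simp
    | add x y _ _ hx hy => simp [hx, hy]
    | smul c x _ hx => simp [hx]
  | mul x y hx hy => rw [rep_mul_apply, rep_mul_apply, hy, hx]
  | add x y hx hy => simp [hx, hy]

/-- Averaging over a whole pseudo-orthonormal list. -/
def avgList (γ₁ : CliffordAlgebra h →ₐ[ℝ] Module.End ℝ S₁)
    (γ₂ : CliffordAlgebra h →ₐ[ℝ] Module.End ℝ S₂) (l : List V) (L : S₁ →ₗ[ℝ] S₂) :
    S₁ →ₗ[ℝ] S₂ :=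
  l.foldr (avg γ₁ γ₂) L

lemma avgList_comm (l : List V) (hu : ∀ v ∈ l, h v * h v = 1)
    (hl : ∀ v ∈ l, ∀ w ∈ l, v ≠ w → QuadraticMap.polar h v w = 0) (L : S₁ →ₗ[ℝ] S₂) :
    ∀ v ∈ l, ∀ s, γ₂ (CliffordAlgebra.ι h v) (avgList γ₁ γ₂ l L s) =
      avgList γ₁ γ₂ l L (γ₁ (CliffordAlgebra.ι h v) s) := by
  induction l with
  | nil => simp
  | cons w l ih =>
    intro v hv
    by_cases hvw : v = w
    · subst hvw
      exact avg_comm_self (hu v (by simp)) _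
    · have hv' : v ∈ l := (List.mem_cons.1 hv).resolve_left hvw
      refine avg_comm_of (σ := -1) (by norm_num) ?_
        (ih (fun x hx => hu x (by simp [hx]))
          (fun x hx y hy => hl x (by simp [hx]) y (by simp [hy])) v hv')
      rw [ι_mul_ι_of_polar (hl v hv w (by simp) hvw), neg_one_smul]

lemma avgList_eq_self (l : List V) (hu : ∀ v ∈ l, h v * h v = 1) (L : S₁ →ₗ[ℝ] S₂)
    (hL : ∀ v ∈ l, ∀ s, γ₂ (CliffordAlgebra.ι h v) (L s) = L (γ₁ (CliffordAlgebra.ι h v) s)) :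
    avgList γ₁ γ₂ l L = L := by
  induction l with
  | nil => rfl
  | cons w l ih =>
    change avg γ₁ γ₂ w (avgList γ₁ γ₂ l L) = L
    rw [ih (fun x hx => hu x (by simp [hx])) (fun x hx => hL x (by simp [hx]))]
    exact avg_eq_self (hu w (by simp)) (hL w (by simp))

lemma rep_ι_surjective (γ₁ : CliffordAlgebra h →ₐ[ℝ] Module.End ℝ S₁) {v : V}
    (hv : h v * h v = 1) : Function.Surjective (γ₁ (CliffordAlgebra.ι h v)) := fun s =>
  ⟨h v • γ₁ (CliffordAlgebra.ι h v) s, by simp [rep_ι_ι, smul_smul, hv]⟩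

/-- A nonzero linear map which commutes with the volume element yields a nonzero intertwiner
inside every sub-bimodule which contains it. -/
theorem exists_intertwiner_mem (b : Module.Basis (Fin n) ℝ V) (hb : IsPseudoOrthonormal h b)
    (hn : Odd n) (hsq : vol h b * vol h b = -1) (N : Submodule ℝ (S₁ →ₗ[ℝ] S₂))
    (hN₂ : ∀ a, ∀ L ∈ N, γ₂ a ∘ₗ L ∈ N) (hN₁ : ∀ a, ∀ L ∈ N, L ∘ₗ γ₁ a ∈ N)
    (L₀ : S₁ →ₗ[ℝ] S₂) (hL₀ : L₀ ∈ N) (hne : L₀ ≠ 0)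
    (hν : ∀ s, γ₂ (vol h b) (L₀ s) = L₀ (γ₁ (vol h b) s)) :
    ∃ L ∈ N, L ≠ 0 ∧ ∀ a s, γ₂ a (L s) = L (γ₁ a s) := by
  -- The last basis vector is set apart. It repairs signs during the induction, and commutation with
  -- it follows at the end from commutation with the volume element.
  obtain ⟨m, rfl⟩ : ∃ m, n = m + 1 := ⟨n - 1, by have := hn.pos; omega⟩
  have hcv : ∀ v, vol h b * CliffordAlgebra.ι h v = (1 : ℝ) • (CliffordAlgebra.ι h v * vol h b) :=
    fun v => by rw [one_smul]; exact vol_commute hn hb _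
  have key : ∀ k ≤ m, ∃ L ∈ N, L ≠ 0 ∧ (∀ s, γ₂ (vol h b) (L s) = L (γ₁ (vol h b) s)) ∧
      ∀ i : Fin (m + 1), (i : ℕ) < k →
        ∀ s, γ₂ (CliffordAlgebra.ι h (b i)) (L s) = L (γ₁ (CliffordAlgebra.ι h (b i)) s) := by
    intro k
    induction k with
    | zero => exact fun _ => ⟨L₀, hL₀, hne, hν, fun i hi => absurd hi (Nat.not_lt_zero _)⟩
    | succ k ih =>
      intro hk
      obtain ⟨L, hLN, hL, hLν, hLi⟩ := ih (by omega)
      set j : Fin (m + 1) := ⟨k, by omega⟩ with hj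
      set l : Fin (m + 1) := Fin.last m with hl
      have hjl : j ≠ l := by simp [hj, hl, Fin.ext_iff]; omega
      -- If the average vanishes, `L` anticommutes with `e_j`, and `L ∘ e_j e_l` is used instead.
      -- The product `e_j e_l` commutes with the earlier `e_i` and anticommutes with `e_j`, which
      -- corrects the sign. It is invertible, so the new map is nonzero.
      by_cases h0 : avg γ₁ γ₂ (b j) L = 0
      · have hanti : ∀ s, γ₂ (CliffordAlgebra.ι h (b j)) (L s) =
            -L (γ₁ (CliffordAlgebra.ι h (b j)) s) := by
          intro s
          have h1 := LinearMap.congr_fun h0 (γ₁ (CliffordAlgebra.ι h (b j)) s)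
          rw [avg_apply, rep_ι_ι, map_smul, map_smul, smul_smul, hb.unit_sq, one_smul,
            LinearMap.zero_apply, smul_eq_zero] at h1
          exact eq_neg_of_add_eq_zero_right (h1.resolve_left (by norm_num))
        refine ⟨(L ∘ₗ γ₁ (CliffordAlgebra.ι h (b j))) ∘ₗ γ₁ (CliffordAlgebra.ι h (b l)),
          hN₁ _ _ (hN₁ _ _ hLN), ?_, ?_, ?_⟩
        · intro h1
          apply hL
          ext s
          obtain ⟨t, rfl⟩ := rep_ι_surjective γ₁ (hb.unit_sq j) s
          obtain ⟨u, rfl⟩ := rep_ι_surjective γ₁ (hb.unit_sq l) t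
          exact LinearMap.congr_fun h1 u
        · intro s
          simp only [LinearMap.comp_apply, hLν, ← rep_mul_apply]
          rw [← mul_assoc, (vol_commute hn hb _).eq, mul_assoc, (vol_commute hn hb _).eq]
        · intro i hi s
          simp only [LinearMap.comp_apply]
          rcases Nat.lt_succ_iff_lt_or_eq.1 hi with hi | hi
          · have hij : i ≠ j := by simp [hj, Fin.ext_iff]; omega
            have hil : i ≠ l := by simp [hl, Fin.ext_iff]; omega
            rw [hLi i hi]
            simp only [← rep_mul_apply]
            rw [← mul_assoc, hb.ι_mul_ι hij, neg_mul, mul_assoc, hb.ι_mul_ι hil, mul_neg, neg_neg]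
          · rw [show i = j from Fin.ext hi, hanti,
              ← rep_mul_apply γ₁ _ (CliffordAlgebra.ι h (b j)) s, hb.ι_mul_ι hjl.symm,
              map_neg, LinearMap.neg_apply, map_neg, map_neg, rep_mul_apply]
      · refine ⟨avg γ₁ γ₂ (b j) L, ?_, h0, ?_, ?_⟩
        · exact N.smul_mem _ (N.add_mem hLN (N.smul_mem _ (hN₂ _ _ (hN₁ _ _ hLN))))
        · exact avg_comm_of (by norm_num) (hcv _) hLν
        · intro i hi
          rcases Nat.lt_succ_iff_lt_or_eq.1 hi with hi | hi
          · have hij : i ≠ j := by simp [hj, Fin.ext_iff]; omega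
            exact avg_comm_of (σ := -1) (by norm_num)
              (by rw [hb.ι_mul_ι hij, neg_one_smul]) (hLi i hi)
          · obtain rfl : i = j := Fin.ext hi
            exact avg_comm_self (hb.unit_sq _) _
  obtain ⟨L, hLN, hL, hLν, hLi⟩ := key m le_rfl
  refine ⟨L, hLN, hL, intertwines_of_basis b fun i => ?_⟩
  by_cases hi : (i : ℕ) < m
  · exact hLi i hi
  have hil : i = Fin.last m := Fin.ext (by simp; omega)
  subst hil
  set e := CliffordAlgebra.ι h (b (Fin.last m)) with he
  -- Let `P` be the product of all vectors but the last one, `e`. From `ν = P e` one gets `P = ± ν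
  -- e`. As `L` commutes with `P` and with the invertible `ν`, it commutes with `e`.
  have hprod : vol h b = (List.ofFn fun i : Fin m => CliffordAlgebra.ι h (b i.castSucc)).prod *
      e := by
    rw [vol, List.ofFn_succ', List.concat_eq_append, List.prod_append, List.prod_singleton]
  have hP : ∀ s, γ₂ (List.ofFn fun i : Fin m => CliffordAlgebra.ι h (b i.castSucc)).prod (L s) =
      L (γ₁ (List.ofFn fun i : Fin m => CliffordAlgebra.ι h (b i.castSucc)).prod s) := by
    have : ∀ l : List (Fin m), ∀ s,
        γ₂ (l.map fun i => CliffordAlgebra.ι h (b i.castSucc)).prod (L s) =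
          L (γ₁ (l.map fun i => CliffordAlgebra.ι h (b i.castSucc)).prod s) := by
      intro l
      induction l with
      | nil => simp
      | cons i l ih =>
        intro s
        rw [List.map_cons, List.prod_cons, rep_mul_apply, rep_mul_apply, ih,
          hLi i.castSucc (by simp)]
    have h1 := this (List.finRange m)
    rwa [← List.ofFn_eq_map] at h1
  set P := (List.ofFn fun i : Fin m => CliffordAlgebra.ι h (b i.castSucc)).prod
  have hPe : P = h (b (Fin.last m)) • (vol h b * e) := by
    rw [hprod, mul_assoc, he, CliffordAlgebra.ι_sq_scalar, ← Algebra.commutes, ← Algebra.smul_def,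
      smul_smul,
      hb.unit_sq, one_smul]
  intro s
  have h1 := hP s
  rw [hPe, map_smul, map_smul, LinearMap.smul_apply, LinearMap.smul_apply, map_smul,
    rep_mul_apply, rep_mul_apply, ← hLν] at h1
  have hc : h (b (Fin.last m)) ≠ 0 := left_ne_zero_of_mul_eq_one (hb.unit_sq _)
  have h2 := congrArg (γ₂ (vol h b)) (smul_right_injective _ hc h1)
  rw [← rep_mul_apply γ₂ (vol h b) (vol h b), ← rep_mul_apply γ₂ (vol h b) (vol h b), hsq, map_neg,
    map_one] at h2
  exact neg_injective h2

end Intertwiner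

/-! ### Schur's lemma for irreducible representations -/

section Schur

variable {A S₁ S₂ : Type*} [Ring A] [Algebra ℝ A] [AddCommGroup S₁] [Module ℝ S₁]
  [AddCommGroup S₂] [Module ℝ S₂] {γ₁ : A →ₐ[ℝ] Module.End ℝ S₁} {γ₂ : A →ₐ[ℝ] Module.End ℝ S₂}

lemma IsIrreducibleRep.injective (hγ : IsIrreducibleRep γ₁) {L : S₁ →ₗ[ℝ] S₂} (hL : L ≠ 0)
    (hi : ∀ a s, γ₂ a (L s) = L (γ₁ a s)) : Function.Injective L := by
  rcases hγ.2 (LinearMap.ker L) fun a u hu => by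
    rw [LinearMap.mem_ker] at hu ⊢
    rw [← hi, hu, map_zero] with h1 | h1
  · exact LinearMap.ker_eq_bot.1 h1
  · exact absurd (LinearMap.ker_eq_top.1 h1) hL

lemma IsIrreducibleRep.surjective (hγ : IsIrreducibleRep γ₂) {L : S₁ →ₗ[ℝ] S₂} (hL : L ≠ 0)
    (hi : ∀ a s, γ₂ a (L s) = L (γ₁ a s)) : Function.Surjective L := by
  rcases hγ.2 (LinearMap.range L) fun a u hu => by
    obtain ⟨s, rfl⟩ := hu
    exact ⟨γ₁ a s, (hi a s).symm⟩ with h1 | h1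
  · exact absurd (LinearMap.range_eq_bot.1 h1) hL
  · exact LinearMap.range_eq_top.1 h1

end Schur

end PinorGeom
end

noncomputable section
namespace PinorGeom

/-! ### The centre of the Clifford algebra -/

section Center

variable {V : Type*} [AddCommGroup V] [Module ℝ V] {h : QuadraticForm ℝ V} {n : ℕ}

/-- The ordered Clifford product of the members of a family with index in `J`. -/
def mon (h : QuadraticForm ℝ V) (b : Fin n → V) (J : Finset (Fin n)) : CliffordAlgebra h :=
  ((List.finRange n).map fun i => if i ∈ J then CliffordAlgebra.ι h (b i) else 1).prod

lemma mon_empty (b : Fin n → V) : mon h b ∅ = 1 := by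
  unfold mon
  refine List.prod_eq_one fun x hx => ?_
  obtain ⟨i, -, rfl⟩ := List.mem_map.1 hx
  simp

lemma mon_univ (b : Fin n → V) : mon h b Finset.univ = vol h b := by
  simp [mon, vol, List.ofFn_eq_map]

/-- Multiplication by `e_i` toggles the membership of `i`: the new index set is the symmetric
difference of `J` and `{i}`. -/
lemma ι_mul_mon {b : Fin n → V} (hb : IsPseudoOrthonormal h b) (i : Fin n)
    (J : Finset (Fin n)) :
    ∃ (c : ℝ) (J' : Finset (Fin n)), CliffordAlgebra.ι h (b i) * mon h b J = c • mon h b J' := by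
  let f : Finset (Fin n) → Fin n → CliffordAlgebra h :=
    fun J j => if j ∈ J then CliffordAlgebra.ι h (b j) else 1
  let J' := symmDiff J {i}
  have hne : ∀ j, j ≠ i → f J' j = f J j := by
    intro j hj
    have : j ∈ J' ↔ j ∈ J := by simp [J', Finset.mem_symmDiff, hj]
    simp [f, this]
  have key : ∀ l : List (Fin n), l.Nodup → i ∈ l → ∃ c : ℝ,
      CliffordAlgebra.ι h (b i) * (l.map (f J)).prod = c • (l.map (f J')).prod := by
    intro l
    induction l with
    | nil => simp
    | cons j l ih =>
      intro hl hi
      rw [List.nodup_cons] at hl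
      rw [List.map_cons, List.prod_cons, List.map_cons, List.prod_cons]
      by_cases hji : j = i
      · subst hji
        have h1 : l.map (f J') = l.map (f J) :=
          List.map_congr_left fun k hk => hne k (fun hkj => hl.1 (hkj ▸ hk))
        rw [h1, ← mul_assoc]
        by_cases hJ : j ∈ J
        · refine ⟨h (b j), ?_⟩
          have : j ∉ J' := by simp [J', Finset.mem_symmDiff, hJ]
          simp only [f, hJ, this, if_true, if_false, one_mul]
          rw [CliffordAlgebra.ι_sq_scalar, ← Algebra.smul_def]
        · refine ⟨1, ?_⟩
          have : j ∈ J' := by simp [J', Finset.mem_symmDiff, hJ]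
          simp only [f, hJ, this, if_true, if_false, mul_one, one_smul]
      · obtain ⟨c, hc⟩ := ih hl.2 ((List.mem_cons.1 hi).resolve_left (Ne.symm hji))
        rw [hne j hji]
        by_cases hJ : j ∈ J
        · refine ⟨-c, ?_⟩
          simp only [f, hJ, if_true]
          rw [← mul_assoc, hb.ι_mul_ι (Ne.symm hji), neg_mul, mul_assoc]
          rw [show CliffordAlgebra.ι h (b i) * (List.map (fun j => if j ∈ J then
            CliffordAlgebra.ι h (b j) else 1) l).prod = _ from hc, mul_smul_comm, neg_smul]
        · refine ⟨c, ?_⟩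
          simp only [f, hJ, if_false, one_mul]
          exact hc
  obtain ⟨c, hc⟩ := key _ (List.nodup_finRange n) (List.mem_finRange i)
  exact ⟨c, J', hc⟩

lemma span_mon (b : Module.Basis (Fin n) ℝ V) (hb : IsPseudoOrthonormal h b) :
    Submodule.span ℝ (Set.range (mon h b)) = ⊤ := by
  have hmul : ∀ v, ∀ x ∈ Submodule.span ℝ (Set.range (mon h b)),
      CliffordAlgebra.ι h v * x ∈ Submodule.span ℝ (Set.range (mon h b)) := by
    intro v x hx
    have hv : v ∈ Submodule.span ℝ (Set.range b) := by rw [b.span_eq]; trivial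
    induction hv using Submodule.span_induction with
    | mem w hw =>
      obtain ⟨i, rfl⟩ := hw
      induction hx using Submodule.span_induction with
      | mem y hy =>
        obtain ⟨J, rfl⟩ := hy
        obtain ⟨c, J', hc⟩ := ι_mul_mon hb i J
        rw [hc]
        exact Submodule.smul_mem _ _ (Submodule.subset_span ⟨J', rfl⟩)
      | zero => rw [mul_zero]; exact Submodule.zero_mem _
      | add y z _ _ hy hz => rw [mul_add]; exact Submodule.add_mem _ hy hz
      | smul c y _ hy => rw [mul_smul_comm]; exact Submodule.smul_mem _ _ hy
    | zero => rw [map_zero, zero_mul]; exact Submodule.zero_mem _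
    | add y z _ _ hy hz => rw [map_add, add_mul]; exact Submodule.add_mem _ hy hz
    | smul c y _ hy => rw [map_smul, smul_mul_assoc]; exact Submodule.smul_mem _ _ hy
  refine eq_top_iff.2 fun x _ => ?_
  induction x using CliffordAlgebra.left_induction with
  | algebraMap r =>
    rw [Algebra.algebraMap_eq_smul_one, ← mon_empty (h := h) b]
    exact Submodule.smul_mem _ _ (Submodule.subset_span ⟨∅, rfl⟩)
  | add x y hx hy => exact Submodule.add_mem _ (hx trivial) (hy trivial)
  | ι_mul x v hx => exact hmul v x (hx trivial)

/-- Only the factors different from `e_i` contribute a sign, whence the cardinality of `J.erase i`.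
-/
lemma ι_mul_mon_comm {b : Fin n → V} (hb : IsPseudoOrthonormal h b) (i : Fin n)
    (J : Finset (Fin n)) : CliffordAlgebra.ι h (b i) * mon h b J =
      (-1 : ℝ) ^ (J.erase i).card • (mon h b J * CliffordAlgebra.ι h (b i)) := by
  have key : ∀ l : List (Fin n), CliffordAlgebra.ι h (b i) *
      (l.map fun j => if j ∈ J then CliffordAlgebra.ι h (b j) else 1).prod =
      (l.map fun j => if j ∈ J.erase i then (-1 : ℝ) else 1).prod •
        ((l.map fun j => if j ∈ J then CliffordAlgebra.ι h (b j) else 1).prod *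
          CliffordAlgebra.ι h (b i)) := by
    intro l
    induction l with
    | nil => simp
    | cons j l ih =>
      rw [List.map_cons, List.prod_cons, List.map_cons, List.prod_cons, mul_smul,
        mul_assoc (ite _ _ _), ← mul_smul_comm, ← ih, ← mul_assoc, ← mul_assoc]
      by_cases hJ : j ∈ J
      · by_cases hji : j = i
        · simp [hji]
        · simp [hJ, hji, hb.ι_mul_ι (Ne.symm hji)]
      · simp [hJ]
  unfold mon
  rw [key]
  congr 1
  rw [← List.ofFn_eq_map, List.prod_ofFn, Finset.prod_ite_mem, Finset.univ_inter,
    Finset.prod_const]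

/-- The central elements of an odd Clifford algebra are the combinations of `1` and the volume
element. -/
lemma exists_eq_of_central (b : Module.Basis (Fin n) ℝ V) (hb : IsPseudoOrthonormal h b)
    {x : CliffordAlgebra h} (hx : ∀ v, CliffordAlgebra.ι h v * x = x * CliffordAlgebra.ι h v) :
    ∃ r s : ℝ, x = r • 1 + s • vol h b := by
  -- `P i` averages over conjugation by `e_i`. A central element is fixed by every `P i`, while a
  -- monomial is fixed or killed according to whether it commutes or anticommutes with `e_i`.
  let P : Fin n → CliffordAlgebra h →ₗ[ℝ] CliffordAlgebra h := fun i =>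
    (1 / 2 : ℝ) • (LinearMap.id + h (b i) • (LinearMap.mulLeft ℝ (CliffordAlgebra.ι h (b i)) ∘ₗ
      LinearMap.mulRight ℝ (CliffordAlgebra.ι h (b i))))
  have hP : ∀ i y, P i y = (1 / 2 : ℝ) • (y + h (b i) •
      (CliffordAlgebra.ι h (b i) * (y * CliffordAlgebra.ι h (b i)))) := fun i y => rfl
  have hPc : ∀ i y (c : ℝ), CliffordAlgebra.ι h (b i) * y = c • (y * CliffordAlgebra.ι h (b i)) →
      P i y = ((1 + c) / 2) • y := by
    intro i y c hy
    rw [hP, ← mul_assoc, hy, smul_mul_assoc, mul_assoc, CliffordAlgebra.ι_sq_scalar,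
      ← Algebra.commutes, ← Algebra.smul_def, smul_smul, smul_smul, mul_right_comm, hb.unit_sq,
      one_mul]
    module
  let Q : List (Fin n) → CliffordAlgebra h →ₗ[ℝ] CliffordAlgebra h :=
    fun l => l.foldr (fun i f => P i ∘ₗ f) LinearMap.id
  have hQx : ∀ l, Q l x = x := by
    intro l
    induction l with
    | nil => rfl
    | cons i l ih =>
      change P i (Q l x) = x
      rw [ih, hPc i x 1 (by rw [one_smul, hx])]
      norm_num
  have hQJ : ∀ J : Finset (Fin n), ∀ l : List (Fin n), ∃ c : ℝ, Q l (mon h b J) = c • mon h b J ∧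
      ((∃ i ∈ l, Odd (J.erase i).card) → c = 0) := by
    intro J l
    induction l with
    | nil => exact ⟨1, (one_smul _ _).symm, by simp⟩
    | cons i l ih =>
      obtain ⟨c, hc, hc'⟩ := ih
      refine ⟨c * ((1 + (-1) ^ (J.erase i).card) / 2), ?_, ?_⟩
      · change P i (Q l (mon h b J)) = _
        rw [hc, map_smul, hPc i _ _ (ι_mul_mon_comm hb i J), smul_smul]
      · rintro ⟨j, hj, hodd⟩
        rcases List.mem_cons.1 hj with rfl | hj
        · rw [hodd.neg_one_pow]; norm_num
        · rw [hc' ⟨j, hj, hodd⟩, zero_mul]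
  have hspan : ∀ y ∈ Submodule.span ℝ (Set.range (mon h b)), ∃ r s : ℝ,
      Q (List.finRange n) y = r • 1 + s • vol h b := by
    intro y hy
    induction hy using Submodule.span_induction with
    | mem y hy =>
      obtain ⟨J, rfl⟩ := hy
      obtain ⟨c, hc, hc'⟩ := hQJ J (List.finRange n)
      by_cases h0 : J = ∅
      · exact ⟨c, 0, by rw [hc, h0, mon_empty]; simp⟩
      by_cases h1 : J = Finset.univ
      · exact ⟨0, c, by rw [hc, h1, mon_univ]; simp⟩
      -- Some `e_i` anticommutes with the monomial: an index inside `J` if `J` has even cardinality,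
      -- one outside `J` if it has odd cardinality.
      have : ∃ i ∈ List.finRange n, Odd (J.erase i).card := by
        rcases Nat.even_or_odd J.card with he | ho
        · obtain ⟨i, hi⟩ := Finset.nonempty_iff_ne_empty.2 h0
          refine ⟨i, List.mem_finRange i, ?_⟩
          rw [Finset.card_erase_of_mem hi]
          exact Nat.Even.sub_odd (Finset.card_pos.2 ⟨i, hi⟩) he odd_one
        · obtain ⟨i, hi⟩ : ∃ i, i ∉ J := by
            by_contra! hcon
            exact h1 (Finset.eq_univ_iff_forall.2 hcon)
          exact ⟨i, List.mem_finRange i, by rwa [Finset.erase_eq_of_notMem hi]⟩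
      exact ⟨0, 0, by rw [hc, hc' this]; simp⟩
    | zero => exact ⟨0, 0, by simp⟩
    | add y z _ _ hy hz =>
      obtain ⟨r, s, h1⟩ := hy
      obtain ⟨r', s', h2⟩ := hz
      exact ⟨r + r', s + s', by rw [map_add, h1, h2]; module⟩
    | smul c y _ hy =>
      obtain ⟨r, s, h1⟩ := hy
      exact ⟨c * r, c * s, by rw [map_smul, h1]; module⟩
  have := hspan x (by rw [span_mon b hb]; trivial)
  rwa [hQx] at this

end Center

/-! ### Faithfulness, commutant and uniqueness of irreducible representations -/

section Faithful

variable {V : Type*} [AddCommGroup V] [Module ℝ V] {h : QuadraticForm ℝ V} {n : ℕ}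
  {S₁ S₂ : Type*} [AddCommGroup S₁] [Module ℝ S₁] [AddCommGroup S₂] [Module ℝ S₂]
  {γ₁ : CliffordAlgebra h →ₐ[ℝ] Module.End ℝ S₁} {γ₂ : CliffordAlgebra h →ₐ[ℝ] Module.End ℝ S₂}

/-- If `J` is a complex structure then `r + s J = 0` only for `r = s = 0`. -/
lemma eq_zero_of_complex {A : Type*} [Ring A] [Algebra ℝ A] [Nontrivial A] {J : A}
    (hJ : J * J = -1) {r s : ℝ} (hrs : r • (1 : A) + s • J = 0) : r = 0 ∧ s = 0 := by
  have h1 : (r • (1 : A) + s • J) * (r • (1 : A) - s • J) = (r ^ 2 + s ^ 2) • (1 : A) := by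
    simp only [mul_sub, add_mul, smul_mul_smul_comm, one_mul, mul_one, hJ]
    module
  rw [hrs, zero_mul] at h1
  have h2 := (smul_eq_zero.1 h1.symm).resolve_right one_ne_zero
  constructor <;> nlinarith [sq_nonneg r, sq_nonneg s]

lemma rep_vol_sq (γ₁ : CliffordAlgebra h →ₐ[ℝ] Module.End ℝ S₁) {b : Fin n → V}
    (hsq : vol h b * vol h b = -1) : γ₁ (vol h b) * γ₁ (vol h b) = -1 := by
  rw [← map_mul, hsq, map_neg, map_one]

/-- Every nonzero module over the Clifford algebra is faithful. -/
theorem rep_injective (b : Module.Basis (Fin n) ℝ V) (hb : IsPseudoOrthonormal h b)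
    (hn : Odd n) (hsq : vol h b * vol h b = -1) [Nontrivial S₁]
    (γ₁ : CliffordAlgebra h →ₐ[ℝ] Module.End ℝ S₁) : Function.Injective γ₁ := by
  rw [injective_iff_map_eq_zero]
  intro a ha
  by_contra ha0
  -- The kernel is a two-sided ideal, regarded as a bimodule of left multiplications. An intertwiner
  -- among them is multiplication by a central element `r + s ν` of the kernel, and `γ₁` kills such
  -- an element only if `r = s = 0`.
  let lm : CliffordAlgebra h →ₐ[ℝ] Module.End ℝ (CliffordAlgebra h) := Algebra.lmul ℝ _
  let N : Submodule ℝ (CliffordAlgebra h →ₗ[ℝ] CliffordAlgebra h) :=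
    (LinearMap.ker γ₁.toLinearMap).map lm.toLinearMap
  obtain ⟨L, hL, hL0, hLi⟩ := exists_intertwiner_mem (γ₁ := lm) (γ₂ := lm) b hb hn hsq N
    (by
      rintro c _ ⟨x, hx, rfl⟩
      refine ⟨c * x, ?_, ?_⟩
      · have : γ₁ x = 0 := hx
        simp [this]
      · exact map_mul lm c x)
    (by
      rintro c _ ⟨x, hx, rfl⟩
      refine ⟨x * c, ?_, ?_⟩
      · have : γ₁ x = 0 := hx
        simp [this]
      · exact map_mul lm x c)
    (lm a) ⟨a, ha, rfl⟩
    (by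
      intro h0
      apply ha0
      have := LinearMap.congr_fun h0 1
      simpa [lm] using this)
    (by
      intro s
      change vol h b * (a * s) = a * (vol h b * s)
      rw [← mul_assoc, (vol_commute hn hb a).eq, mul_assoc])
  obtain ⟨x, hx, rfl⟩ := hL
  have hx0 : γ₁ x = 0 := hx
  have hcen : ∀ v, CliffordAlgebra.ι h v * x = x * CliffordAlgebra.ι h v := by
    intro v
    have := hLi (CliffordAlgebra.ι h v) 1
    simpa [lm] using this
  obtain ⟨r, s, hrs⟩ := exists_eq_of_central b hb hcen
  rw [hrs, map_add, map_smul, map_smul, map_one] at hx0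
  obtain ⟨rfl, rfl⟩ := eq_zero_of_complex (rep_vol_sq γ₁ hsq) hx0
  apply hL0
  rw [hrs]
  simp

/-- The commutant of an irreducible representation consists of the operators `r + s γ(ν)`. -/
theorem exists_eq_of_commutes (b : Module.Basis (Fin n) ℝ V) (hb : IsPseudoOrthonormal h b)
    (hn : Odd n) (hsq : vol h b * vol h b = -1) [FiniteDimensional ℝ S₁]
    (hγ : IsIrreducibleRep γ₁) {T : Module.End ℝ S₁}
    (hT : ∀ v, T * γ₁ (CliffordAlgebra.ι h v) = γ₁ (CliffordAlgebra.ι h v) * T) :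
    ∃ r s : ℝ, T = r • 1 + s • γ₁ (vol h b) := by
  have hTa : ∀ a, T * γ₁ a = γ₁ a * T := by
    intro a
    refine LinearMap.ext fun s => ?_
    exact (intertwines_of_basis (γ₁ := γ₁) (γ₂ := γ₁) b (L := T)
      (fun i s => (LinearMap.congr_fun (hT (b i)) s).symm) a s).symm
  have : Nontrivial S₁ := hγ.1
  set J := γ₁ (vol h b) with hJ
  have hJ2 : J * J = -1 := rep_vol_sq γ₁ hsq
  -- `J` turns `S₁` into a complex vector space on which `T` is complex linear. With a complex
  -- eigenvalue `μ`, the intertwiner `T - f μ` has a nonzero kernel, so it vanishes by Schur's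
  -- lemma.
  let f : ℂ →ₐ[ℝ] Module.End ℝ S₁ := Complex.lift ⟨J, hJ2⟩
  have hf : ∀ z : ℂ, f z = z.re • 1 + z.im • J := by
    intro z
    simp [f, Complex.liftAux_apply, Algebra.algebraMap_eq_smul_one]
  let _ : Module ℂ S₁ := Module.compHom S₁ f.toRingHom
  have hsmul : ∀ (z : ℂ) (s : S₁), z • s = f z s := fun z s => rfl
  have : IsScalarTower ℝ ℂ S₁ := ⟨fun r z s => by simp [hsmul]⟩
  have : FiniteDimensional ℂ S₁ := FiniteDimensional.right ℝ ℂ S₁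
  let T' : Module.End ℂ S₁ :=
    { toFun := T
      map_add' := map_add T
      map_smul' := fun z s => by
        have h1 : T * f z = f z * T := by
          rw [hf, mul_add, add_mul, mul_smul_comm, mul_smul_comm, hJ, hTa]
          simp
        exact LinearMap.congr_fun h1 s }
  obtain ⟨μ, hμ⟩ := Module.End.exists_eigenvalue T'
  obtain ⟨s, hs⟩ := hμ.exists_hasEigenvector
  have hs1 : T s = f μ s := hs.apply_eq_smul
  have hs0 : s ≠ 0 := hs.2
  refine ⟨μ.re, μ.im, ?_⟩
  rw [← hf]
  by_contra hne
  have hinj := hγ.injective (γ₂ := γ₁) (L := T - f μ) (sub_ne_zero.2 hne) (by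
    intro a s
    have h1 : γ₁ a * (T - f μ) = (T - f μ) * γ₁ a := by
      have h2 : γ₁ a * f μ = f μ * γ₁ a := by
        rw [hf, mul_add, add_mul, mul_smul_comm, smul_mul_assoc, mul_smul_comm, smul_mul_assoc,
          mul_one, one_mul, hJ, ← map_mul, ← map_mul, (vol_commute hn hb a).eq]
      rw [mul_sub, sub_mul, hTa, h2]
    exact LinearMap.congr_fun h1 s)
  exact hs0 (hinj (by rw [map_zero, LinearMap.sub_apply, hs1, sub_self]))

/-- From an irreducible representation there is an injective intertwiner to every nonzero one. -/
theorem exists_injective_intertwiner (b : Module.Basis (Fin n) ℝ V)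
    (hb : IsPseudoOrthonormal h b) (hn : Odd n) (hsq : vol h b * vol h b = -1)
    (hγ : IsIrreducibleRep γ₁) [Nontrivial S₂] :
    ∃ L : S₁ →ₗ[ℝ] S₂, Function.Injective L ∧ ∀ a s, γ₂ a (L s) = L (γ₁ a s) := by
  have : Nontrivial S₁ := hγ.1
  obtain ⟨s, hs⟩ := exists_ne (0 : S₁)
  obtain ⟨t, ht⟩ := exists_ne (0 : S₂)
  obtain ⟨φ, hφ⟩ : ∃ φ : Module.Dual ℝ S₁, φ s ≠ 0 := by
    by_contra! hcon
    exact hs ((Module.forall_dual_apply_eq_zero_iff ℝ s).1 hcon)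
  set J₁ := γ₁ (vol h b) with hJ₁
  set J₂ := γ₂ (vol h b) with hJ₂
  have h1 : ∀ x, J₁ (J₁ x) = -x := fun x => LinearMap.congr_fun (rep_vol_sq γ₁ hsq) x
  have h2 : ∀ x, J₂ (J₂ x) = -x := fun x => LinearMap.congr_fun (rep_vol_sq γ₂ hsq) x
  -- `L₀` is twice the complex linear part of the rank one map `E`. It does not kill `s`, since `φ s
  -- • t = φ (J₁ s) • J₂ t` is impossible: `t` and `J₂ t` are independent and `φ s ≠ 0`.
  let E : S₁ →ₗ[ℝ] S₂ := LinearMap.toSpanSingleton ℝ S₂ t ∘ₗ φ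
  let L₀ : S₁ →ₗ[ℝ] S₂ := E - J₂ ∘ₗ E ∘ₗ J₁
  have hL₀ : L₀ ≠ 0 := by
    intro h0
    have h3 : φ s • t = φ (J₁ s) • J₂ t := by
      have := LinearMap.congr_fun h0 s
      simpa [L₀, E, sub_eq_zero] using this
    have h4 := congrArg J₂ h3
    rw [map_smul, map_smul, h2] at h4
    have h5 : (φ s * φ s + φ (J₁ s) * φ (J₁ s)) • t = 0 := by
      rw [add_smul, mul_smul, mul_smul, h3, smul_comm (φ s), h4]
      simp
    have h6 := (smul_eq_zero.1 h5).resolve_right ht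
    exact hφ (by nlinarith [mul_self_nonneg (φ s), mul_self_nonneg (φ (J₁ s))])
  obtain ⟨L, -, hL0, hL⟩ := exists_intertwiner_mem (γ₁ := γ₁) (γ₂ := γ₂) b hb hn hsq ⊤
    (fun _ _ _ => trivial) (fun _ _ _ => trivial) L₀ trivial hL₀ (by
      intro x
      simp only [L₀, LinearMap.sub_apply, LinearMap.comp_apply, map_sub, ← hJ₁, ← hJ₂, h1, h2,
        map_neg]
      abel)
  exact ⟨L, hγ.injective hL0 hL, hL⟩

/-- Any two irreducible representations are equivalent. -/
theorem exists_intertwiner_equiv (b : Module.Basis (Fin n) ℝ V)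
    (hb : IsPseudoOrthonormal h b) (hn : Odd n) (hsq : vol h b * vol h b = -1)
    (hγ₁ : IsIrreducibleRep γ₁) (hγ₂ : IsIrreducibleRep γ₂) :
    ∃ L : S₁ ≃ₗ[ℝ] S₂, ∀ a s, γ₂ a (L s) = L (γ₁ a s) := by
  have : Nontrivial S₁ := hγ₁.1
  have : Nontrivial S₂ := hγ₂.1
  obtain ⟨L, hL, hi⟩ := exists_injective_intertwiner (γ₂ := γ₂) b hb hn hsq hγ₁
  have hL0 : L ≠ 0 := by
    rintro rfl
    obtain ⟨s, hs⟩ := exists_ne (0 : S₁)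
    exact hs (hL rfl)
  exact ⟨LinearEquiv.ofBijective L ⟨hL, hγ₂.surjective hL0 hi⟩, hi⟩

lemma det_dualMap {S : Type*} [AddCommGroup S] [Module ℝ S] [FiniteDimensional ℝ S]
    (T : Module.End ℝ S) : LinearMap.det T.dualMap = LinearMap.det T := by
  classical
  let B := Module.finBasis ℝ S
  rw [← LinearMap.det_toMatrix B.dualBasis, ← LinearMap.det_toMatrix B]
  rw [show LinearMap.toMatrix B.dualBasis B.dualBasis T.dualMap =
    (LinearMap.toMatrix B B T).transpose
    from LinearMap.toMatrix_transpose _, Matrix.det_transpose]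

/-- The determinant of an irreducible representation is invariant under the Clifford conjugation. -/
theorem det_rep_star (b : Module.Basis (Fin n) ℝ V) (hb : IsPseudoOrthonormal h b)
    (hn : Odd n) (hsq : vol h b * vol h b = -1) [FiniteDimensional ℝ S₁]
    (hγ : IsIrreducibleRep γ₁) (a : CliffordAlgebra h) :
    LinearMap.det (γ₁ (star a)) = LinearMap.det (γ₁ a) := by
  have : Nontrivial S₁ := hγ.1
  -- The transposes of `γ₁ (star a)` form a representation on the dual space. An injective
  -- intertwiner from `γ₁` to it is bijective for reasons of dimension, so the two have equal
  -- determinants.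
  let δ : CliffordAlgebra h →ₐ[ℝ] Module.End ℝ (Module.Dual ℝ S₁) :=
    CliffordAlgebra.lift h ⟨
      { toFun := fun v => -(γ₁ (CliffordAlgebra.ι h v)).dualMap
        map_add' := fun v w => LinearMap.ext fun φ => LinearMap.ext fun s => by simp; ring
        map_smul' := fun c v => LinearMap.ext fun φ => LinearMap.ext fun s => by simp }, by
      intro v
      refine LinearMap.ext fun φ => LinearMap.ext fun s => ?_
      simp [rep_ι_ι, Algebra.algebraMap_eq_smul_one]⟩
  have hδ : ∀ a, δ a = (γ₁ (star a)).dualMap := by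
    intro a
    induction a using CliffordAlgebra.induction with
    | algebraMap r =>
      rw [AlgHom.commutes, CliffordAlgebra.star_algebraMap, AlgHom.commutes]
      refine LinearMap.ext fun φ => LinearMap.ext fun s => ?_
      simp [Algebra.algebraMap_eq_smul_one]
    | ι v =>
      rw [CliffordAlgebra.lift_ι_apply, CliffordAlgebra.star_ι]
      refine LinearMap.ext fun φ => LinearMap.ext fun s => ?_
      simp
    | mul x y hx hy =>
      rw [map_mul, hx, hy, star_mul, map_mul]
      rfl
    | add x y hx hy =>
      rw [map_add, hx, hy, star_add, map_add]
      exact LinearMap.ext fun φ => LinearMap.ext fun s => (map_add φ _ _).symm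
  obtain ⟨L, hL, hi⟩ := exists_injective_intertwiner (γ₁ := γ₁) (γ₂ := δ) b hb hn hsq hγ
  let e : S₁ ≃ₗ[ℝ] Module.Dual ℝ S₁ :=
    LinearEquiv.ofInjectiveOfFinrankEq L hL Subspace.dual_finrank_eq.symm
  have he : ∀ s, e s = L s := fun s => rfl
  have h1 : δ a = (e : S₁ →ₗ[ℝ] Module.Dual ℝ S₁) ∘ₗ γ₁ a ∘ₗ
      (e.symm : Module.Dual ℝ S₁ →ₗ[ℝ] S₁) := by
    refine LinearMap.ext fun φ => ?_
    obtain ⟨s, rfl⟩ := e.surjective φ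
    simp only [LinearMap.comp_apply, LinearEquiv.coe_coe, e.symm_apply_apply]
    exact hi a s
  rw [← det_dualMap, ← hδ, h1, LinearMap.det_conj]

end Faithful
end PinorGeom
end

noncomputable section
namespace PinorGeom

/-! ### Lifting isometries to the spin group -/

section CliffordGroups

variable {V : Type*} [AddCommGroup V] [Module ℝ V] {h : QuadraticForm ℝ V} {n : ℕ}

lemma mem_even_iff_involute {x : CliffordAlgebra h} :
    x ∈ CliffordAlgebra.even h ↔ CliffordAlgebra.involute x = x := by
  refine ⟨fun hx => CliffordAlgebra.involute_eq_of_mem_even hx, fun hx => ?_⟩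
  obtain ⟨x₀, hx₀, x₁, hx₁, rfl⟩ := Submodule.mem_sup.1
    ((CliffordAlgebra.evenOdd_isCompl (Q := h)).sup_eq_top.ge (Submodule.mem_top (x := x)))
  rw [map_add, CliffordAlgebra.involute_eq_of_mem_even hx₀,
    CliffordAlgebra.involute_eq_of_mem_odd hx₁, add_right_inj, neg_eq_iff_add_eq_zero,
    ← two_smul ℝ, smul_eq_zero] at hx
  rw [hx.resolve_left two_ne_zero, add_zero]
  exact hx₀

lemma ι_injective_of_basis (b : Module.Basis (Fin n) ℝ V) (hb : IsPseudoOrthonormal h b) :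
    Function.Injective (CliffordAlgebra.ι h) := by
  rw [injective_iff_map_eq_zero]
  intro v hv
  have h1 : ∀ w, QuadraticMap.polar h v w = 0 := by
    intro w
    apply algebraMap_injective' (h := h)
    rw [← CliffordAlgebra.ι_mul_ι_add_swap, hv]
    simp
  rw [← b.sum_repr v]
  refine Finset.sum_eq_zero fun i _ => ?_
  have h2 := h1 (b i)
  rw [← QuadraticMap.polarBilin_apply_apply, ← b.sum_repr v, map_sum, LinearMap.sum_apply,
    Finset.sum_eq_single i] at h2
  · simp only [map_smul, LinearMap.smul_apply, QuadraticMap.polarBilin_apply_apply,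
      smul_eq_mul, mul_eq_zero] at h2
    rw [h2.resolve_right (hb.polar_self_ne_zero i), zero_smul]
  · intro j _ hj
    simp [hb.orth j i hj]
  · simp

/-- Conjugation by an element of the Clifford group is an isometry. -/
lemma exists_isometry_of_mem_cliffordGroup (hι : Function.Injective (CliffordAlgebra.ι h))
    {x : (CliffordAlgebra h)ˣ} (hx : x ∈ cliffordGroup h) :
    ∃ R : h.IsometryEquiv h, ∀ v, (x : CliffordAlgebra h) * CliffordAlgebra.ι h v =
      CliffordAlgebra.ι h (R v) * x := by
  choose f hf using hx.1
  choose g hg using hx.2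
  have hfg : ∀ v, f (g v) = v := by
    intro v
    apply hι
    rw [← hf, ← hg]
    simp [mul_assoc]
  have hgf : ∀ v, g (f v) = v := by
    intro v
    apply hι
    rw [← hg, ← hf]
    simp [mul_assoc]
  let e : V ≃ₗ[ℝ] V :=
    { toFun := f
      map_add' := fun v w => hι (by rw [← hf, map_add, map_add, ← hf, ← hf, mul_add, add_mul])
      map_smul' := fun c v => hι (by
        rw [← hf, map_smul, RingHom.id_apply, map_smul, ← hf, mul_smul_comm, smul_mul_assoc])
      invFun := g
      left_inv := hgf
      right_inv := hfg }
  refine ⟨⟨e, fun v => ?_⟩, fun v => ?_⟩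
  · apply algebraMap_injective' (h := h)
    change algebraMap ℝ _ (h (f v)) = _
    rw [← CliffordAlgebra.ι_sq_scalar, ← hf]
    have : (x : CliffordAlgebra h) * CliffordAlgebra.ι h v * (x⁻¹ : (CliffordAlgebra h)ˣ) *
        (x * CliffordAlgebra.ι h v * (x⁻¹ : (CliffordAlgebra h)ˣ)) =
        x * (CliffordAlgebra.ι h v * CliffordAlgebra.ι h v) * (x⁻¹ : (CliffordAlgebra h)ˣ) := by
      simp only [mul_assoc, Units.inv_mul_cancel_left]
    rw [this, CliffordAlgebra.ι_sq_scalar, ← Algebra.commutes, mul_assoc, Units.mul_inv, mul_one]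
  · change _ = CliffordAlgebra.ι h (f v) * x
    rw [← hf]
    simp

/-- A vector of square `1` or `-1` as a unit of the Clifford algebra. -/
def vecUnit (h : QuadraticForm ℝ V) (v : V) (hv : h v * h v = 1) : (CliffordAlgebra h)ˣ where
  val := CliffordAlgebra.ι h v
  inv := h v • CliffordAlgebra.ι h v
  val_inv := by
    rw [mul_smul_comm, CliffordAlgebra.ι_sq_scalar, Algebra.smul_def, ← map_mul, hv, map_one]
  inv_val := by
    rw [smul_mul_assoc, CliffordAlgebra.ι_sq_scalar, Algebra.smul_def, ← map_mul, hv, map_one]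

lemma vecUnit_mem_pinGroup (v : V) (hv : h v * h v = 1) : vecUnit h v hv ∈ pinGroup h := by
  have h1 : ∀ w, CliffordAlgebra.ι h v * CliffordAlgebra.ι h w * CliffordAlgebra.ι h v =
      CliffordAlgebra.ι h (QuadraticMap.polar h v w • v - h v • w) :=
    fun w => CliffordAlgebra.ι_mul_ι_mul_ι _ _
  refine ⟨⟨fun w => ⟨h v • (QuadraticMap.polar h v w • v - h v • w), ?_⟩,
    fun w => ⟨h v • (QuadraticMap.polar h v w • v - h v • w), ?_⟩⟩, ?_⟩
  · rw [map_smul, ← h1]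
    change _ * _ * (h v • _) = _
    rw [mul_smul_comm]
    rfl
  · rw [map_smul, ← h1]
    change (h v • _) * _ * _ = _
    rw [smul_mul_assoc, smul_mul_assoc]
    rfl
  · change star (CliffordAlgebra.ι h v) * CliffordAlgebra.ι h v = 1 ∨
      star (CliffordAlgebra.ι h v) * CliffordAlgebra.ι h v = -1
    rw [CliffordAlgebra.star_ι, neg_mul, CliffordAlgebra.ι_sq_scalar]
    rcases mul_self_eq_one_iff.1 hv with h2 | h2 <;> rw [h2]
    · right; simp
    · left; simp

/-- An isometry which preserves the volume element is induced by an element of the spin group. -/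
theorem exists_spin_of_isometry {S₁ : Type*} [AddCommGroup S₁] [Module ℝ S₁]
    [FiniteDimensional ℝ S₁] {γ₁ : CliffordAlgebra h →ₐ[ℝ] Module.End ℝ S₁}
    (b : Module.Basis (Fin n) ℝ V) (hb : IsPseudoOrthonormal h b)
    (hn : Odd n) (hsq : vol h b * vol h b = -1) (hγ : IsIrreducibleRep γ₁)
    (R : h.IsometryEquiv h) (hR : vol h (R ∘ b) = vol h b) :
    ∃ a : spinGroup h, ∀ v, (a : (CliffordAlgebra h)ˣ) * CliffordAlgebra.ι h v =
      CliffordAlgebra.ι h (R v) * ((a : (CliffordAlgebra h)ˣ) : CliffordAlgebra h) := by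
  have : Nontrivial S₁ := hγ.1
  have hinj := rep_injective b hb hn hsq γ₁
  let m : CliffordAlgebra h →ₐ[ℝ] CliffordAlgebra h := CliffordAlgebra.map R.toIsometry
  have hm : ∀ v, m (CliffordAlgebra.ι h v) = CliffordAlgebra.ι h (R v) :=
    CliffordAlgebra.map_apply_ι R.toIsometry
  have hmν : m (vol h b) = vol h b := by
    rw [← hR]
    conv_lhs => rw [hR]
    unfold vol
    rw [map_list_prod, List.map_ofFn]
    congr 2
    funext i
    exact hm _
  -- Skolem–Noether: the bimodule is the image of `γ₁`, with left action twisted by `R`, and the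
  -- starting map is the identity. It commutes with the volume element because `R` fixes `ν`. The
  -- intertwiner obtained is some `γ₁ u`, so `u` implements `R`.
  obtain ⟨L, ⟨u, rfl⟩, hL0, hLi⟩ := exists_intertwiner_mem (γ₁ := γ₁) (γ₂ := γ₁.comp m) b hb hn hsq
    (LinearMap.range γ₁.toLinearMap)
    (by rintro c _ ⟨x, rfl⟩; exact ⟨m c * x, map_mul γ₁ _ _⟩)
    (by rintro c _ ⟨x, rfl⟩; exact ⟨x * c, map_mul γ₁ _ _⟩)
    (γ₁ 1) ⟨1, rfl⟩ (by rw [map_one]; exact one_ne_zero) (by intro s; simp [hmν])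
  have hu0 : u ≠ 0 := by
    rintro rfl
    exact hL0 (map_zero γ₁)
  have huv : ∀ v, u * CliffordAlgebra.ι h v = CliffordAlgebra.ι h (R v) * u := by
    intro v
    apply hinj
    rw [map_mul, map_mul]
    refine LinearMap.ext fun s => ?_
    have := hLi (CliffordAlgebra.ι h v) s
    rw [AlgHom.comp_apply, hm] at this
    exact this.symm
  -- An even choice of `u`: the sum of `u` and its involute is twice the even part. If it vanishes,
  -- `u` is odd and `u ν` is even, as `ν` is odd and central.
  obtain ⟨u, hu0, huv, hue⟩ : ∃ u : CliffordAlgebra h, u ≠ 0 ∧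
      (∀ v, u * CliffordAlgebra.ι h v = CliffordAlgebra.ι h (R v) * u) ∧
      CliffordAlgebra.involute u = u := by
    by_cases h0 : u + CliffordAlgebra.involute u = 0
    · refine ⟨u * vol h b, ?_, ?_, ?_⟩
      · intro h1
        apply hu0
        have h2 : u * (vol h b * vol h b) = 0 := by rw [← mul_assoc, h1, zero_mul]
        rwa [hsq, mul_neg_one, neg_eq_zero] at h2
      · intro v
        rw [mul_assoc, (vol_commute hn hb _).eq, ← mul_assoc, huv, mul_assoc]
      · rw [map_mul, involute_vol hn, (eq_neg_of_add_eq_zero_right h0), neg_mul_neg]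
    · refine ⟨_, h0, ?_, ?_⟩
      · intro v
        have h1 := congrArg CliffordAlgebra.involute (huv v)
        rw [map_mul, map_mul, CliffordAlgebra.involute_ι, CliffordAlgebra.involute_ι, mul_neg,
          neg_mul, neg_inj] at h1
        rw [add_mul, mul_add, huv, h1]
      · rw [map_add, CliffordAlgebra.involute_involute, add_comm]
  have hstar : ∀ v, CliffordAlgebra.ι h v * star u = star u * CliffordAlgebra.ι h (R v) := by
    intro v
    have h1 := congrArg star (huv v)
    rw [star_mul, star_mul, CliffordAlgebra.star_ι, CliffordAlgebra.star_ι, neg_mul, mul_neg,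
      neg_inj] at h1
    exact h1
  -- The norm of `u` commutes with all vectors, so it is `r + s ν`. It is even, hence `s = 0`, and
  -- division of `u` by the square root of `|r|` makes the norm `±1`.
  obtain ⟨r, s, hrs⟩ := exists_eq_of_central b hb (x := star u * u) (by
    intro v
    rw [← mul_assoc, hstar, mul_assoc, ← huv, mul_assoc])
  have hstare : CliffordAlgebra.involute (star u) = star u := by
    rw [← mem_even_iff_involute] at hue ⊢
    rw [CliffordAlgebra.star_def]
    change _ ∈ CliffordAlgebra.evenOdd h 0
    rw [CliffordAlgebra.reverse_mem_evenOdd_iff, CliffordAlgebra.involute_mem_evenOdd_iff]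
    exact hue
  have hs : s = 0 := by
    have h1 := congrArg CliffordAlgebra.involute hrs
    rw [map_mul, hstare, hue, hrs, map_add, map_smul, map_smul, map_one, involute_vol hn] at h1
    have h2 : (0 : ℝ) • (1 : CliffordAlgebra h) + (2 * s) • vol h b = 0 := by
      rw [zero_smul, zero_add, two_mul, add_smul]
      have := add_left_cancel h1
      rw [smul_neg] at this
      exact eq_neg_iff_add_eq_zero.1 this
    linarith [(eq_zero_of_complex hsq h2).2]
  rw [hs, zero_smul, add_zero] at hrs
  -- `γ₁ u` is injective by Schur's lemma, hence bijective in finite dimension. Thus `u` can be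
  -- cancelled on the right, which yields `r ≠ 0` and `u * star u = r`.
  have hbij : Function.Surjective (γ₁ u) := by
    have h1 : Function.Injective (γ₁ u) := hγ.injective (γ₂ := γ₁.comp m) (L := γ₁ u)
      (fun h0 => hu0 (hinj (h0.trans (map_zero γ₁).symm))) (intertwines_of_basis b (by
        intro i s
        rw [AlgHom.comp_apply, hm, ← rep_mul_apply, ← rep_mul_apply, huv]))
    exact LinearMap.injective_iff_surjective.1 h1
  have hcancel : ∀ x, x * u = 0 → x = 0 := by
    intro x hx
    apply hinj
    rw [map_zero]
    refine LinearMap.ext fun t => ?_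
    obtain ⟨t, rfl⟩ := hbij t
    rw [← rep_mul_apply, hx, map_zero]
    rfl
  have hr : r ≠ 0 := by
    rintro rfl
    rw [zero_smul] at hrs
    have h1 := hcancel _ hrs
    apply hu0
    rw [← star_star u, h1, star_zero]
  have hrs' : u * star u = r • 1 := by
    refine sub_eq_zero.1 (hcancel _ ?_)
    rw [sub_mul, mul_assoc, hrs]
    simp
  set t : ℝ := (Real.sqrt |r|)⁻¹ with ht
  have ht2 : t * t * |r| = 1 := by
    rw [ht, ← mul_inv, Real.mul_self_sqrt (abs_nonneg r), inv_mul_cancel₀ (abs_ne_zero.2 hr)]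
  set c : ℝ := t * t * r with hc
  have hc1 : c = 1 ∨ c = -1 := by
    rcases abs_cases r with ⟨h1, -⟩ | ⟨h1, -⟩ <;> rw [h1] at ht2
    · left; exact ht2
    · right; linarith
  have hcc : c * c = 1 := by rcases hc1 with h1 | h1 <;> rw [h1] <;> norm_num
  have ht0 : t ≠ 0 := by
    intro h0
    rw [h0] at ht2
    norm_num at ht2
  have hsu : star (t • u) * (t • u) = c • 1 := by
    rw [CliffordAlgebra.star_smul, smul_mul_smul_comm, hrs, smul_smul]
  have hus : (t • u) * star (t • u) = c • 1 := by
    rw [CliffordAlgebra.star_smul, smul_mul_smul_comm, hrs', smul_smul]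
  let a : (CliffordAlgebra h)ˣ :=
    { val := t • u
      inv := c • star (t • u)
      val_inv := by rw [mul_smul_comm, hus, smul_smul, hcc, one_smul]
      inv_val := by rw [smul_mul_assoc, hsu, smul_smul, hcc, one_smul] }
  have hav : ∀ v, (a : CliffordAlgebra h) * CliffordAlgebra.ι h v =
      CliffordAlgebra.ι h (R v) * a := by
    intro v
    change (t • u) * _ = _ * (t • u)
    rw [smul_mul_assoc, huv, mul_smul_comm]
  refine ⟨⟨a, ⟨⟨fun v => ⟨R v, ?_⟩, fun v => ⟨R.symm v, ?_⟩⟩, ?_⟩, ?_⟩, hav⟩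
  · rw [hav]; simp
  · have h1 := hav (R.symm v)
    rw [R.apply_symm_apply] at h1
    rw [mul_assoc, ← h1]
    simp
  · change star (t • u) * (t • u) = 1 ∨ star (t • u) * (t • u) = -1
    rw [hsu]
    rcases hc1 with h1 | h1 <;> rw [h1] <;> simp
  · rw [mem_even_iff_involute]
    change CliffordAlgebra.involute (t • u) = t • u
    rw [map_smul, hue]

end CliffordGroups

/-! ### The groups `Pin₂(α)` and `Spin₂(α)` -/

section Plane

lemma eq_zero_of_two_smul {E : Type*} [AddCommGroup E] [Module ℝ E] {x : E}
    (hx : (2 : ℝ) • x = 0) : x = 0 :=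
  (smul_eq_zero.1 hx).resolve_left two_ne_zero

variable (α : ℝ)

/-- The first generator of `Cl₂(α)`. -/
def e₁ : CliffordTwo α := CliffordAlgebra.ι (planeForm α) (Pi.single 0 1)

/-- The second generator of `Cl₂(α)`. -/
def e₂ : CliffordTwo α := CliffordAlgebra.ι (planeForm α) (Pi.single 1 1)

lemma planeForm_single (i : Fin 2) : planeForm α (Pi.single i 1) = α := by
  fin_cases i <;> simp [planeForm, QuadraticMap.weightedSumSquares_apply]

lemma e₁_sq : e₁ α * e₁ α = α • 1 := by
  rw [e₁, CliffordAlgebra.ι_sq_scalar, planeForm_single, Algebra.algebraMap_eq_smul_one]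

lemma e₂_sq : e₂ α * e₂ α = α • 1 := by
  rw [e₂, CliffordAlgebra.ι_sq_scalar, planeForm_single, Algebra.algebraMap_eq_smul_one]

lemma e₂_mul_e₁ : e₂ α * e₁ α = -(e₁ α * e₂ α) := by
  refine ι_mul_ι_of_polar ?_
  simp [QuadraticMap.polar, planeForm, QuadraticMap.weightedSumSquares_apply]

/-- The product of the two generators of `Cl₂(α)`. -/
def e₁₂ : CliffordTwo α := e₁ α * e₂ α

lemma ι_plane (v : Fin 2 → ℝ) :
    CliffordAlgebra.ι (planeForm α) v = v 0 • e₁ α + v 1 • e₂ α := by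
  have hv : v = v 0 • Pi.single 0 1 + v 1 • Pi.single 1 1 := by
    ext i
    fin_cases i <;> simp
  conv_lhs => rw [hv, map_add, map_smul, map_smul]
  rfl

variable {α}

lemma e₁_mul_e₁₂ : e₁ α * e₁₂ α = α • e₂ α := by
  rw [e₁₂, ← mul_assoc, e₁_sq, smul_mul_assoc, one_mul]

lemma e₂_mul_e₁₂ : e₂ α * e₁₂ α = -(α • e₁ α) := by
  rw [e₁₂, ← mul_assoc, e₂_mul_e₁, neg_mul, mul_assoc, e₂_sq, mul_smul_comm, mul_one]

lemma e₁₂_mul_e₁ : e₁₂ α * e₁ α = -(α • e₂ α) := by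
  rw [e₁₂, mul_assoc, e₂_mul_e₁, mul_neg, ← mul_assoc, e₁_sq, smul_mul_assoc, one_mul]

lemma e₁₂_mul_e₂ : e₁₂ α * e₂ α = α • e₁ α := by
  rw [e₁₂, mul_assoc, e₂_sq, mul_smul_comm, mul_one]

lemma e₁₂_sq (hα : α * α = 1) : e₁₂ α * e₁₂ α = -1 := by
  conv_lhs => rw [e₁₂]
  rw [mul_assoc, ← e₁₂, e₂_mul_e₁₂, mul_neg, mul_smul_comm, e₁_sq, smul_smul, hα, one_smul]

lemma involute_e₁ : CliffordAlgebra.involute (e₁ α) = -e₁ α := CliffordAlgebra.involute_ι _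

lemma involute_e₂ : CliffordAlgebra.involute (e₂ α) = -e₂ α := CliffordAlgebra.involute_ι _

lemma involute_e₁₂ : CliffordAlgebra.involute (e₁₂ α) = e₁₂ α := by
  rw [e₁₂, map_mul, involute_e₁, involute_e₂, neg_mul_neg]

lemma star_e₁₂ : star (e₁₂ α) = -e₁₂ α := by
  rw [e₁₂, star_mul, e₁, e₂, CliffordAlgebra.star_ι, CliffordAlgebra.star_ι, neg_mul_neg]
  exact e₂_mul_e₁ α

lemma exists_plane_eq (x : CliffordTwo α) :
    ∃ r s t u : ℝ, x = r • 1 + s • e₁₂ α + (t • e₁ α + u • e₂ α) := by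
  induction x using CliffordAlgebra.left_induction with
  | algebraMap r => exact ⟨r, 0, 0, 0, by simp [Algebra.algebraMap_eq_smul_one]⟩
  | add x y hx hy =>
    obtain ⟨r, s, t, u, rfl⟩ := hx
    obtain ⟨r', s', t', u', rfl⟩ := hy
    exact ⟨r + r', s + s', t + t', u + u', by module⟩
  | ι_mul x v hx =>
    obtain ⟨r, s, t, u, rfl⟩ := hx
    refine ⟨α * (v 0 * t + v 1 * u), v 0 * u - v 1 * t, v 0 * r - α * s * v 1,
      v 1 * r + α * s * v 0, ?_⟩
    rw [ι_plane]
    simp only [mul_add, add_mul, smul_mul_smul_comm, mul_one, e₁_mul_e₁₂, e₂_mul_e₁₂, e₁_sq, e₂_sq,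
      e₂_mul_e₁]
    rw [← e₁₂]
    module

/-- The commutator with a generator is that invertible generator times twice the terms anticommuting
with it. Those terms therefore vanish, and the linear independence of `1, e₁, e₂, e₁e₂` is not
needed. -/
lemma eq_smul_one_of_plane_central (hα : α * α = 1) {x : CliffordTwo α}
    (hx : ∀ v, CliffordAlgebra.ι (planeForm α) v * x = x * CliffordAlgebra.ι (planeForm α) v) :
    ∃ r : ℝ, x = r • 1 := by
  have h1 : e₁ α * x = x * e₁ α := hx _
  have h2 : e₂ α * x = x * e₂ α := hx _
  have hc1 : ∀ y, e₁ α * y = 0 → y = 0 := by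
    intro y hy
    have : (α • e₁ α) * (e₁ α * y) = y := by
      rw [← mul_assoc, smul_mul_assoc, e₁_sq, smul_smul, hα, one_smul, one_mul]
    rw [← this, hy, mul_zero]
  have hc2 : ∀ y, e₂ α * y = 0 → y = 0 := by
    intro y hy
    have : (α • e₂ α) * (e₂ α * y) = y := by
      rw [← mul_assoc, smul_mul_assoc, e₂_sq, smul_smul, hα, one_smul, one_mul]
    rw [← this, hy, mul_zero]
  obtain ⟨r, s, t, u, rfl⟩ := exists_plane_eq x
  have k1 : s • e₁₂ α + u • e₂ α = 0 := by
    refine eq_zero_of_two_smul ?_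
    apply hc1
    have h3 := sub_eq_zero.2 h1
    rw [← h3]
    simp only [mul_add, add_mul, mul_smul_comm, smul_mul_assoc, mul_one, one_mul, e₁_mul_e₁₂,
      e₁₂_mul_e₁, e₂_mul_e₁]
    module
  have k2 : s • e₁₂ α + t • e₁ α = 0 := by
    refine eq_zero_of_two_smul ?_
    apply hc2
    have h3 := sub_eq_zero.2 h2
    rw [← h3]
    simp only [mul_add, add_mul, mul_smul_comm, smul_mul_assoc, mul_one, one_mul, e₂_mul_e₁₂,
      e₁₂_mul_e₂, e₂_mul_e₁]
    module
  have hx1 : r • (1 : CliffordTwo α) + s • e₁₂ α + (t • e₁ α + u • e₂ α) = r • 1 + t • e₁ α := by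
    rw [show r • (1 : CliffordTwo α) + s • e₁₂ α + (t • e₁ α + u • e₂ α) =
      r • 1 + t • e₁ α + (s • e₁₂ α + u • e₂ α) by abel, k1, add_zero]
  rw [hx1] at h2 ⊢
  refine ⟨r, ?_⟩
  have k3 : t • e₁ α = 0 := by
    refine eq_zero_of_two_smul ?_
    apply hc2
    rw [← sub_eq_zero.2 h2]
    simp only [mul_add, add_mul, mul_smul_comm, smul_mul_assoc, mul_one, one_mul, e₂_mul_e₁]
    module
  rw [k3, add_zero]

/-- The element `r + s e₁e₂` of `Cl₂(α)`. -/
def rot (α r s : ℝ) : CliffordTwo α := r • 1 + s • e₁₂ α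

lemma rot_mul_rot_neg (hα : α * α = 1) (r s : ℝ) :
    rot α r s * rot α r (-s) = (r ^ 2 + s ^ 2) • 1 := by
  simp only [rot, mul_add, add_mul, smul_mul_smul_comm, one_mul, mul_one, e₁₂_sq hα]
  module

lemma star_rot (r s : ℝ) : star (rot α r s) = rot α r (-s) := by
  rw [rot, star_add, CliffordAlgebra.star_smul, CliffordAlgebra.star_smul, star_one, star_e₁₂, rot,
    smul_neg, neg_smul]

lemma involute_rot (r s : ℝ) : CliffordAlgebra.involute (rot α r s) = rot α r s := by
  rw [rot, map_add, map_smul, map_smul, map_one, involute_e₁₂]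

/-- Elements of `Cl₂(α)` of the form `r + s e₁e₂` with `r² + s² = 1`, as units. -/
def rotUnit (hα : α * α = 1) (r s : ℝ) (hrs : r ^ 2 + s ^ 2 = 1) : (CliffordTwo α)ˣ where
  val := rot α r s
  inv := rot α r (-s)
  val_inv := by rw [rot_mul_rot_neg hα, hrs, one_smul]
  inv_val := by
    have := rot_mul_rot_neg hα r (-s)
    rwa [neg_neg, neg_sq, hrs, one_smul] at this

lemma rot_conj (hα : α * α = 1) (r s : ℝ) (v : Fin 2 → ℝ) :
    ∃ w, rot α r s * CliffordAlgebra.ι (planeForm α) v * rot α r (-s) =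
      CliffordAlgebra.ι (planeForm α) w := by
  -- Moving `v` across `rot α r (-s)` turns it into `rot α r s`, so the conjugate is the square of
  -- `rot α r s` times `v`: a rotation by the doubled angle.
  refine ⟨(r ^ 2 - s ^ 2) • v + (2 * r * s * α) • ![v 1, -v 0], ?_⟩
  have h1 : CliffordAlgebra.ι (planeForm α) v * rot α r (-s) =
      rot α r s * CliffordAlgebra.ι (planeForm α) v := by
    rw [ι_plane, rot, rot]
    simp only [mul_add, add_mul, mul_smul_comm, smul_mul_assoc, one_mul, mul_one, e₁₂_mul_e₁,
      e₁₂_mul_e₂, e₁_mul_e₁₂, e₂_mul_e₁₂]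
    module
  have h2 : rot α r s * rot α r s = rot α (r ^ 2 - s ^ 2) (2 * r * s) := by
    simp only [rot, mul_add, add_mul, smul_mul_smul_comm, one_mul, mul_one, e₁₂_sq hα]
    module
  rw [mul_assoc, h1, ← mul_assoc, h2, ι_plane, ι_plane, rot]
  simp only [mul_add, add_mul, mul_smul_comm, smul_mul_assoc, one_mul, e₁₂_mul_e₁, e₁₂_mul_e₂,
    Pi.add_apply, Pi.smul_apply, Matrix.cons_val_zero, Matrix.cons_val_one, smul_eq_mul]
  module

lemma rotUnit_mem_pinTwo (hα : α * α = 1) (r s : ℝ) (hrs : r ^ 2 + s ^ 2 = 1) :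
    rotUnit hα r s hrs ∈ pinTwo α := by
  refine ⟨⟨fun v => rot_conj hα r s v, fun v => ?_⟩, Or.inl ?_⟩
  · have := rot_conj hα r (-s) v
    rwa [neg_neg] at this
  · change star (rot α r s) * rot α r s = 1
    rw [star_rot]
    have := rot_mul_rot_neg hα r (-s)
    rwa [neg_neg, neg_sq, hrs, one_smul] at this

/-- The generator `e₁` as an element of the pin group. -/
def e₁Pin (hα : α * α = 1) : pinTwo α :=
  ⟨vecUnit (planeForm α) (Pi.single 0 1) (by rw [planeForm_single, hα]), vecUnit_mem_pinGroup _ _⟩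

/-- An element fixed by the involution has only the terms `r + s e₁e₂`. Its Clifford norm is `r² +
s²`, which cannot be `-1`. -/
lemma exists_eq_rot_of_involute (hα : α * α = 1) {x : (CliffordTwo α)ˣ} (hx : x ∈ pinTwo α)
    (hinv : CliffordAlgebra.involute (x : CliffordTwo α) = x) :
    ∃ r s : ℝ, r ^ 2 + s ^ 2 = 1 ∧ (x : CliffordTwo α) = rot α r s := by
  obtain ⟨r, s, t, u, hx'⟩ := exists_plane_eq (x : CliffordTwo α)
  have h1 : (x : CliffordTwo α) = rot α r s := by
    rw [hx', map_add, map_add, map_add] at hinv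
    simp only [map_smul, involute_e₁, involute_e₂, involute_e₁₂, map_one] at hinv
    have h2 : (2 : ℝ) • (t • e₁ α + u • e₂ α) = 0 := by
      rw [← sub_eq_zero.2 hinv.symm]
      module
    rw [hx', eq_zero_of_two_smul h2, add_zero, rot]
  refine ⟨r, s, ?_, h1⟩
  have h2 := hx.2
  have h3 := rot_mul_rot_neg hα r (-s)
  rw [neg_neg, neg_sq] at h3
  rw [h1, star_rot, h3, ← Algebra.algebraMap_eq_smul_one, ← map_one (algebraMap ℝ (CliffordTwo α)),
    ← map_neg] at h2
  rcases h2 with h2 | h2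
  · exact algebraMap_injective' h2
  · have := algebraMap_injective' h2
    nlinarith [sq_nonneg r, sq_nonneg s]

/-- The elements of `Pin₂(α)`. -/
theorem pinTwo_cases (hα : α * α = 1) (x : pinTwo α) :
    (∃ r s : ℝ, r ^ 2 + s ^ 2 = 1 ∧ ((x : (CliffordTwo α)ˣ) : CliffordTwo α) = rot α r s) ∨
    ∃ r s : ℝ, r ^ 2 + s ^ 2 = 1 ∧ ((x : (CliffordTwo α)ˣ) : CliffordTwo α) =
      rot α r s * e₁ α := by
  obtain ⟨x, hx⟩ := x
  let y : (CliffordTwo α)ˣ :=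
    Units.map (CliffordAlgebra.involute (Q := planeForm α) : CliffordTwo α →* CliffordTwo α) x
  have hy : (y : CliffordTwo α) = CliffordAlgebra.involute (x : CliffordTwo α) := rfl
  have hyi : ((y⁻¹ : (CliffordTwo α)ˣ) : CliffordTwo α) =
      CliffordAlgebra.involute ((x⁻¹ : (CliffordTwo α)ˣ) : CliffordTwo α) := rfl
  -- `x` and its involute `y` conjugate vectors in the same way, the signs cancelling. So `y⁻¹ x` is
  -- a central scalar `r`, and applying the involution twice gives `r = ±1`: `x` is even or odd. An
  -- odd `x` becomes even after multiplication by `e₁⁻¹`.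
  have hcen : ∀ v, CliffordAlgebra.ι (planeForm α) v * (((y⁻¹ * x : (CliffordTwo α)ˣ)) :
      CliffordTwo α) = ((y⁻¹ * x : (CliffordTwo α)ˣ) : CliffordTwo α) *
        CliffordAlgebra.ι (planeForm α) v := by
    intro v
    obtain ⟨w, hw⟩ := hx.1.1 v
    have h1 := congrArg CliffordAlgebra.involute hw
    rw [map_mul, map_mul, CliffordAlgebra.involute_ι, CliffordAlgebra.involute_ι, mul_neg, neg_mul,
      neg_inj, ← hy, ← hyi, ← hw, Units.mul_inv_eq_iff_eq_mul] at h1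
    rw [Units.val_mul, mul_assoc, Units.eq_inv_mul_iff_mul_eq, ← mul_assoc, h1]
    simp [mul_assoc]
  obtain ⟨r, hr⟩ := eq_smul_one_of_plane_central hα hcen
  have hxy : (x : CliffordTwo α) = r • CliffordAlgebra.involute (x : CliffordTwo α) := by
    rw [← hy, ← mul_one (y : CliffordTwo α), ← mul_smul_comm, ← hr]
    simp
  have hrr : r = 1 ∨ r = -1 := by
    have h1 := congrArg CliffordAlgebra.involute hxy
    rw [map_smul, CliffordAlgebra.involute_involute] at h1
    rw [h1, smul_smul] at hxy
    have h2 : (1 - r * r) • (x : CliffordTwo α) = 0 := by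
      rw [sub_smul, one_smul, ← hxy, sub_self]
    have h3 := (smul_eq_zero.1 h2).resolve_right x.ne_zero
    exact mul_self_eq_one_iff.1 (by linarith)
  rcases hrr with rfl | rfl
  · rw [one_smul] at hxy
    exact Or.inl (exists_eq_rot_of_involute hα hx hxy.symm)
  · right
    rw [neg_one_smul] at hxy
    obtain ⟨r, s, hrs, hz⟩ := exists_eq_rot_of_involute hα (x := x * (e₁Pin hα :
      (CliffordTwo α)ˣ)⁻¹)
      (mul_mem hx (inv_mem (e₁Pin hα).2)) (by
        change CliffordAlgebra.involute ((x : CliffordTwo α) * (planeForm α _ • e₁ α)) =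
          x * (planeForm α _ • e₁ α)
        rw [map_mul, map_smul, involute_e₁, show CliffordAlgebra.involute (x : CliffordTwo α) = -x
          from neg_eq_iff_eq_neg.1 hxy.symm, smul_neg, neg_mul_neg])
    refine ⟨r, s, hrs, ?_⟩
    rw [← hz]
    change (x : CliffordTwo α) = (x * (e₁Pin hα : (CliffordTwo α)ˣ)⁻¹ : (CliffordTwo α)ˣ) *
      ((e₁Pin hα : (CliffordTwo α)ˣ) : CliffordTwo α)
    rw [← Units.val_mul, inv_mul_cancel_right]

end Plane

end PinorGeom
end

noncomputable section
namespace PinorGeom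

/-! ### The twisted elementary representation and its image -/

section Model

variable {V : Type*} [AddCommGroup V] [Module ℝ V] {h : QuadraticForm ℝ V} {α : ℝ}
  {S₀ : Type*} [AddCommGroup S₀] [Module ℝ S₀]
  {γ₀ : CliffordAlgebra h →ₐ[ℝ] Module.End ℝ S₀} {γ₂ : CliffordTwo α →ₐ[ℝ] Module.End ℝ S₀}
  {n : ℕ} {b : Module.Basis (Fin n) ℝ V}

variable (h α γ₀ γ₂ b) in
/-- The algebraic data of the twisted elementary representation, for the volume element of a chosen
pseudo-orthonormal basis. -/
structure IsPinorModel : Prop where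
  odd : Odd n
  orth : IsPseudoOrthonormal h b
  vol_sq : vol h b * vol h b = -1
  irr : IsIrreducibleRep γ₀
  alpha_sq : α * α = 1
  anti : γ₂ (e₁ α) * γ₀ (vol h b) = -(γ₀ (vol h b) * γ₂ (e₁ α))
  anti_ι : ∀ v, γ₂ (e₁ α) * γ₀ (CliffordAlgebra.ι h v) = -(γ₀ (CliffordAlgebra.ι h v) * γ₂ (e₁ α))
  e₂_eq : γ₂ (e₂ α) = -α • (γ₀ (vol h b) * γ₂ (e₁ α))

lemma rep_e₁_sq (γ₂ : CliffordTwo α →ₐ[ℝ] Module.End ℝ S₀) :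
    γ₂ (e₁ α) * γ₂ (e₁ α) = α • 1 := by
  rw [← map_mul, e₁_sq, map_smul, map_one]

lemma det_sq_of_mul_self {T : Module.End ℝ S₀} (hT : LinearMap.det (T * T) ^ 2 = 1) :
    LinearMap.det T ^ 2 = 1 := by
  rw [map_mul] at hT
  have h1 : (LinearMap.det T ^ 2) ^ 2 = 1 := by rw [← hT]; ring
  rcases sq_eq_one_iff.1 h1 with h2 | h2
  · exact h2
  · nlinarith [sq_nonneg (LinearMap.det T)]

lemma alpha_mul_alpha (p q : ℕ) : alpha p q * alpha p q = 1 := by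
  unfold alpha
  split_ifs <;> norm_num

lemma exists_isPinorModel {p q : ℕ} (hpq : ((p : ℤ) - q) % 8 = 3 ∨ ((p : ℤ) - q) % 8 = 7)
    (hsig : HasSignature h p q) {γ₂ : CliffordTwo (alpha p q) →ₐ[ℝ] Module.End ℝ S₀}
    (hγ₀ : IsIrreducibleRep γ₀) (hc : IsCompatible h (alpha p q) γ₀ γ₂) :
    ∃ b : Module.Basis (Fin (p + q)) ℝ V, IsPinorModel h (alpha p q) γ₀ γ₂ b := by
  obtain ⟨b₀, hb₀, hb₀'⟩ := hsig.exists_basis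
  have hon := isPseudoOrthonormal_of_signs hb₀ hb₀'
  have hsq := vol_sq_of_signs hpq hb₀ hb₀'
  have hd : Module.finrank ℝ V = p + q := by simpa using Module.finrank_eq_card_basis b₀
  obtain ⟨ν, hν, D, hD, h1, h2⟩ := hc
  obtain ⟨b, hb, rfl⟩ := exists_eq_vol hν hd
  refine ⟨b, odd_of_mod hpq, hb, ?_, hγ₀, alpha_mul_alpha p q, ?_, ?_, ?_⟩
  · rw [vol_mul_self_eq b₀ hon hb, hsq]
    rcases det_eq_one_or_neg_one b₀ hon hsq hb with h3 | h3 <;> rw [h3] <;> norm_num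
  · rw [e₁, h1]; exact hD.1 _ hν
  · intro v; rw [e₁, h1]; exact hD.2.1 v
  · rw [e₁, h1, e₂, h2]

namespace IsPinorModel

variable (hm : IsPinorModel h α γ₀ γ₂ b)
include hm

lemma J_sq : γ₀ (vol h b) * γ₀ (vol h b) = -1 := rep_vol_sq γ₀ hm.vol_sq

/-- With `D = γ₂ (e₁ α)` and `J = γ₀ (vol h b)`, one has `D (-α J D) = α J D² = α² J = J`. Hence
`Spin₂(α)` acts by the unit complex numbers `r + s J`. -/
lemma map_e₁₂ : γ₂ (e₁₂ α) = γ₀ (vol h b) := by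
  rw [e₁₂, map_mul, hm.e₂_eq, mul_smul_comm, ← mul_assoc, hm.anti, neg_mul, mul_assoc, rep_e₁_sq,
    mul_smul_comm, mul_one, smul_neg, smul_smul, neg_mul, hm.alpha_sq, neg_smul, one_smul, neg_neg]

lemma map_rot (r s : ℝ) : γ₂ (rot α r s) = γ₀ (r • 1 + s • vol h b) := by
  rw [rot, map_add, map_smul, map_smul, map_one, hm.map_e₁₂, map_add, map_smul, map_smul, map_one]

lemma injective : Function.Injective γ₀ :=
  have := hm.irr.1
  rep_injective b hm.orth hm.odd hm.vol_sq γ₀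

lemma rot_commute (r s : ℝ) (x : CliffordAlgebra h) : Commute (γ₀ (r • 1 + s • vol h b)) (γ₀ x) :=
  Commute.map (((Commute.one_left x).smul_left r).add_left
    ((vol_commute hm.odd hm.orth x).smul_left s)) γ₀

lemma det_D_sq : LinearMap.det (γ₂ (e₁ α)) ^ 2 = 1 := by
  refine det_sq_of_mul_self ?_
  rw [rep_e₁_sq, LinearMap.det_smul, map_one, mul_one, ← pow_mul, mul_comm, pow_mul, sq,
    hm.alpha_sq,
    one_pow]

/-- Conjugation by `D` carries `r + s J` to `r - s J`. The two have equal determinants, and their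
product is the scalar `r² + s²`. -/
lemma det_rot_sq (r s : ℝ) : LinearMap.det (γ₀ (r • 1 + s • vol h b)) ^ 2 =
    (r ^ 2 + s ^ 2) ^ Module.finrank ℝ S₀ := by
  have h1 : γ₂ (e₁ α) * γ₀ (r • 1 + s • vol h b) = γ₀ (r • 1 + (-s) • vol h b) * γ₂ (e₁ α) := by
    simp only [map_add, map_smul, map_one, mul_add, add_mul, mul_smul_comm, smul_mul_assoc,
      mul_one, one_mul, hm.anti]
    module
  have h2 : LinearMap.det (γ₀ (r • 1 + s • vol h b)) =
      LinearMap.det (γ₀ (r • 1 + (-s) • vol h b)) := by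
    have h3 := congrArg LinearMap.det h1
    rw [map_mul, map_mul, mul_comm] at h3
    refine mul_right_cancel₀ ?_ h3
    intro h0
    have := hm.det_D_sq
    rw [h0] at this
    norm_num at this
  rw [sq]
  nth_rewrite 2 [h2]
  rw [← map_mul, ← map_mul]
  have h3 : (r • (1 : CliffordAlgebra h) + s • vol h b) * (r • 1 + (-s) • vol h b) =
      (r ^ 2 + s ^ 2) • 1 := by
    simp only [mul_add, add_mul, smul_mul_smul_comm, one_mul, mul_one, hm.vol_sq]
    module
  rw [h3, map_smul, map_one, LinearMap.det_smul, map_one, mul_one]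

/-- The Clifford conjugation preserves determinants, so the squared determinant is that of the
Clifford norm `±1`. Its own square is `1`, and as a real square it cannot be `-1`. -/
lemma det_spin_sq [FiniteDimensional ℝ S₀] (a : spinGroup h) :
    LinearMap.det (γ₀ ((a : (CliffordAlgebra h)ˣ) : CliffordAlgebra h)) ^ 2 = 1 := by
  set x := ((a : (CliffordAlgebra h)ˣ) : CliffordAlgebra h)
  have h1 : LinearMap.det (γ₀ (star x * x)) = LinearMap.det (γ₀ x) ^ 2 := by
    rw [map_mul, map_mul, det_rep_star b hm.orth hm.odd hm.vol_sq hm.irr, sq]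
  rcases a.2.1.2 with h2 | h2
  · rw [← h1, h2, map_one, map_one]
  · have h3 : LinearMap.det (γ₀ (star x * x)) ^ 2 = 1 := by
      rw [h2, map_neg, map_one, ← neg_one_smul ℝ, LinearMap.det_smul, map_one, mul_one, ← pow_mul,
        mul_comm, pow_mul, neg_one_sq, one_pow]
    rw [h1] at h3
    rcases sq_eq_one_iff.1 h3 with h4 | h4
    · exact h4
    · nlinarith [sq_nonneg (LinearMap.det (γ₀ x))]

end IsPinorModel

lemma twistedRep_mk (hc : IsCompatible h α γ₀ γ₂) (a : spinGroup h) (c : pinTwo α) :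
    ((twistedRep h α γ₀ γ₂ hc (QuotientGroup.mk (a, c)) : (Module.End ℝ S₀)ˣ) : Module.End ℝ S₀) =
      γ₀ ((a : (CliffordAlgebra h)ˣ) : CliffordAlgebra h) *
        γ₂ ((c : (CliffordTwo α)ˣ) : CliffordTwo α) := rfl

/-- The class of `(1, e₁)` in `Spin^o`. -/
def reflO (h : QuadraticForm ℝ V) (hα : α * α = 1) : SpinO h α :=
  QuotientGroup.mk ((1 : spinGroup h), e₁Pin hα)

namespace IsPinorModel

lemma rep_reflO (hm : IsPinorModel h α γ₀ γ₂ b) (hc : IsCompatible h α γ₀ γ₂) :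
    ((twistedRep h α γ₀ γ₂ hc (reflO h hm.alpha_sq) : (Module.End ℝ S₀)ˣ) : Module.End ℝ S₀) =
      γ₂ (e₁ α) := by
  rw [reflO, twistedRep_mk]
  simp only [OneMemClass.coe_one, Units.val_one, map_one, one_mul]
  rfl

/-- Every element of `Spin^o` acts by `γ₀(a) (r + s J)` or `γ₀(a) (r + s J) D`. -/
lemma rep_cases (hm : IsPinorModel h α γ₀ γ₂ b) (hc : IsCompatible h α γ₀ γ₂) (k : SpinO h α) :
    ∃ (a : spinGroup h) (c : pinTwo α) (r s : ℝ), k = QuotientGroup.mk (a, c) ∧ r ^ 2 + s ^ 2 = 1 ∧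
      (((c : (CliffordTwo α)ˣ) : CliffordTwo α) = rot α r s ∧
        ((twistedRep h α γ₀ γ₂ hc k : (Module.End ℝ S₀)ˣ) : Module.End ℝ S₀) =
          γ₀ ((a : (CliffordAlgebra h)ˣ) : CliffordAlgebra h) * γ₀ (r • 1 + s • vol h b) ∨
      ((c : (CliffordTwo α)ˣ) : CliffordTwo α) = rot α r s * e₁ α ∧
        ((twistedRep h α γ₀ γ₂ hc k : (Module.End ℝ S₀)ˣ) : Module.End ℝ S₀) =
          γ₀ ((a : (CliffordAlgebra h)ˣ) : CliffordAlgebra h) * γ₀ (r • 1 + s • vol h b) *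
            γ₂ (e₁ α)) := by
  obtain ⟨⟨a, c⟩, rfl⟩ := QuotientGroup.mk_surjective k
  rcases pinTwo_cases hm.alpha_sq c with ⟨r, s, hrs, h1⟩ | ⟨r, s, hrs, h1⟩
  · exact ⟨a, c, r, s, rfl, hrs, Or.inl ⟨h1, by rw [twistedRep_mk, h1, hm.map_rot]⟩⟩
  · exact ⟨a, c, r, s, rfl, hrs, Or.inr ⟨h1, by
      rw [twistedRep_mk, h1, map_mul, hm.map_rot, mul_assoc]⟩⟩

/-- The operators of the twisted elementary representation cover isometries of `(V, h)` and have
determinant of square `1`. -/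
theorem rep_covers [FiniteDimensional ℝ S₀] (hm : IsPinorModel h α γ₀ γ₂ b)
    (hc : IsCompatible h α γ₀ γ₂) (k : SpinO h α) :
    (∃ R : h.IsometryEquiv h, ∀ v,
      ((twistedRep h α γ₀ γ₂ hc k : (Module.End ℝ S₀)ˣ) : Module.End ℝ S₀) *
        γ₀ (CliffordAlgebra.ι h v) = γ₀ (CliffordAlgebra.ι h (R v)) *
      ((twistedRep h α γ₀ γ₂ hc k : (Module.End ℝ S₀)ˣ) : Module.End ℝ S₀)) ∧
    LinearMap.det ((twistedRep h α γ₀ γ₂ hc k : (Module.End ℝ S₀)ˣ) : Module.End ℝ S₀) ^ 2 = 1 := by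
  obtain ⟨a, c, r, s, -, hrs, h1⟩ := hm.rep_cases hc k
  obtain ⟨R, hR⟩ := exists_isometry_of_mem_cliffordGroup (ι_injective_of_basis b hm.orth) a.2.1.1
  have hR' : ∀ v, γ₀ ((a : (CliffordAlgebra h)ˣ) : CliffordAlgebra h) * γ₀ (r • 1 + s • vol h b) *
      γ₀ (CliffordAlgebra.ι h v) = γ₀ (CliffordAlgebra.ι h (R v)) *
        (γ₀ ((a : (CliffordAlgebra h)ˣ) : CliffordAlgebra h) * γ₀ (r • 1 + s • vol h b)) := by
    intro v
    rw [mul_assoc, (hm.rot_commute r s _).eq, ← mul_assoc, ← mul_assoc, ← map_mul, hR, map_mul]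
  have hdet : LinearMap.det (γ₀ ((a : (CliffordAlgebra h)ˣ) : CliffordAlgebra h) *
      γ₀ (r • 1 + s • vol h b)) ^ 2 = 1 := by
    rw [map_mul, mul_pow, hm.det_spin_sq, hm.det_rot_sq, hrs, one_pow, one_mul]
  rcases h1 with ⟨-, h1⟩ | ⟨-, h1⟩
  · rw [h1]
    exact ⟨⟨R, hR'⟩, hdet⟩
  · rw [h1]
    -- `D` anticommutes with all vectors, which means that it covers `-id`.
    refine ⟨⟨R.trans ⟨LinearEquiv.neg ℝ, fun v => by simp⟩, fun v => ?_⟩, ?_⟩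
    · change _ = γ₀ (CliffordAlgebra.ι h (-(R v))) * _
      rw [mul_assoc, hm.anti_ι, mul_neg, ← mul_assoc, hR', map_neg, map_neg, neg_mul, mul_assoc,
        mul_assoc]
    · rw [map_mul, mul_pow, hdet, hm.det_D_sq, one_mul]

/-- The twisted elementary representation is faithful. -/
theorem rep_injective (hm : IsPinorModel h α γ₀ γ₂ b) (hc : IsCompatible h α γ₀ γ₂) :
    Function.Injective (twistedRep h α γ₀ γ₂ hc) := by
  have : Nontrivial S₀ := hm.irr.1
  rw [injective_iff_map_eq_one]
  intro k hk
  obtain ⟨a, c, r, s, rfl, hrs, h1⟩ := hm.rep_cases hc k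
  rw [hk, Units.val_one] at h1
  rcases h1 with ⟨hcr, h1⟩ | ⟨-, h1⟩
  · rw [← map_mul, ← map_one γ₀] at h1
    have h2 := hm.injective h1
    -- From `a (r + s ν) = 1` with `a` even, the involution gives `a (r - s ν) = 1`. So `s = 0` and
    -- `r = ±1`, which leaves only the two elements of the sign subgroup.
    have h3 := congrArg CliffordAlgebra.involute h2
    have hae := mem_even_iff_involute.1 a.2.2
    rw [map_one, map_mul, hae, map_add, map_smul, map_smul, map_one, involute_vol hm.odd] at h3
    have h4 := (Units.mul_right_inj (a : (CliffordAlgebra h)ˣ)).1 (h2.symm.trans h3)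
    have h5 : (0 : ℝ) • (1 : CliffordAlgebra h) + (2 * s) • vol h b = 0 := by
      rw [← sub_eq_zero.2 h4]
      module
    have hs : s = 0 := by linarith [(eq_zero_of_complex hm.vol_sq h5).2]
    rw [hs] at h2 hrs hcr
    rw [rot, zero_smul, add_zero] at hcr
    rw [zero_smul, add_zero, mul_smul_comm, mul_one] at h2
    have hr : r = 1 ∨ r = -1 := sq_eq_one_iff.1 (by linarith)
    refine (QuotientGroup.eq_one_iff _).2 ?_
    rcases hr with rfl | rfl
    · have ha1 : a = 1 := by
        apply Subtype.ext
        apply Units.ext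
        simpa using h2.symm
      have hc1 : c = 1 := by
        apply Subtype.ext
        apply Units.ext
        simpa using hcr
      rw [ha1, hc1]
      exact one_mem (signSubgroup h α)
    · have ha1 : a = ⟨-1, neg_one_mem_spinGroup h⟩ := by
        apply Subtype.ext
        apply Units.ext
        rw [neg_one_smul] at h2
        simpa using (neg_eq_iff_eq_neg.1 h2.symm)
      have hc1 : c = ⟨-1, neg_one_mem_pinGroup _⟩ := by
        apply Subtype.ext
        apply Units.ext
        simpa using hcr
      rw [ha1, hc1]
      exact Subgroup.mem_zpowers (signElement h α)
  · exfalso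
    -- `X` commutes with `J` and `D` anticommutes with it, so `X D` anticommutes with `J` and cannot
    -- be the identity.
    set X := γ₀ ((a : (CliffordAlgebra h)ˣ) : CliffordAlgebra h) * γ₀ (r • 1 + s • vol h b) with hX
    have h2 : γ₀ (vol h b) * X = X * γ₀ (vol h b) := by
      rw [hX, ← map_mul, ← map_mul, ← map_mul, (vol_commute hm.odd hm.orth _).eq]
    have h3 : γ₀ (vol h b) = -γ₀ (vol h b) := by
      calc γ₀ (vol h b) = γ₀ (vol h b) * (X * γ₂ (e₁ α)) := by rw [← h1, mul_one]
        _ = X * (γ₀ (vol h b) * γ₂ (e₁ α)) := by rw [← mul_assoc, h2, mul_assoc]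
        _ = -(X * γ₂ (e₁ α) * γ₀ (vol h b)) := by
          rw [mul_assoc X, hm.anti, mul_neg, neg_neg]
        _ = -γ₀ (vol h b) := by rw [← h1, one_mul]
    have h4 : γ₀ (vol h b) = 0 :=
      eq_zero_of_two_smul (by rw [two_smul]; exact eq_neg_iff_add_eq_zero.1 h3)
    have h5 := hm.J_sq
    rw [h4, zero_mul] at h5
    exact one_ne_zero (neg_eq_zero.1 h5.symm)

/-- The subgroup `Spin^c` consists of the elements which act complex linearly. -/
theorem mem_spinC_iff (hm : IsPinorModel h α γ₀ γ₂ b) (hc : IsCompatible h α γ₀ γ₂)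
    (k : SpinO h α) : k ∈ spinC h α ↔
      ((twistedRep h α γ₀ γ₂ hc k : (Module.End ℝ S₀)ˣ) : Module.End ℝ S₀) * γ₀ (vol h b) =
        γ₀ (vol h b) *
          ((twistedRep h α γ₀ γ₂ hc k : (Module.End ℝ S₀)ˣ) : Module.End ℝ S₀) := by
  have : Nontrivial S₀ := hm.irr.1
  constructor
  · rintro ⟨⟨a, c⟩, ⟨-, hcs⟩, rfl⟩
    obtain ⟨r, s, -, hrot⟩ := exists_eq_rot_of_involute hm.alpha_sq c.2
      (mem_even_iff_involute.1 (Subgroup.mem_subgroupOf.1 hcs).2)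
    rw [QuotientGroup.mk'_apply, twistedRep_mk, hrot, hm.map_rot, ← map_mul, ← map_mul, ← map_mul,
      (vol_commute hm.odd hm.orth _).eq]
  · intro hk
    obtain ⟨a, c, r, s, rfl, hrs, h1⟩ := hm.rep_cases hc k
    rcases h1 with ⟨hcr, -⟩ | ⟨-, h1⟩
    · refine ⟨(a, c), ⟨trivial, Subgroup.mem_subgroupOf.2 ⟨c.2, ?_⟩⟩, rfl⟩
      rw [mem_even_iff_involute, hcr, involute_rot]
    -- Here the operator contains the factor `D` and anticommutes with `J`. Commuting with it as
    -- well contradicts invertibility.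
    · exfalso
      set T := ((twistedRep h α γ₀ γ₂ hc (QuotientGroup.mk (a, c)) : (Module.End ℝ S₀)ˣ) :
        Module.End ℝ S₀) with hT
      have h2 : T * γ₀ (vol h b) = -(γ₀ (vol h b) * T) := by
        rw [h1, mul_assoc, hm.anti, mul_neg, ← mul_assoc, ← mul_assoc, ← map_mul, ← map_mul,
          ← map_mul, (vol_commute hm.odd hm.orth _).eq]
      have h3 : T * γ₀ (vol h b) = 0 :=
        eq_zero_of_two_smul (by
          rw [two_smul]
          nth_rewrite 2 [hk]
          exact eq_neg_iff_add_eq_zero.1 h2)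
      have h4 : T * (γ₀ (vol h b) * γ₀ (vol h b)) = 0 := by rw [← mul_assoc, h3, zero_mul]
      rw [hm.J_sq, mul_neg_one, neg_eq_zero] at h4
      exact (twistedRep h α γ₀ γ₂ hc (QuotientGroup.mk (a, c))).ne_zero h4

/-- Operators which cover an isometry preserving the volume element, of determinant `1` or `-1`,
belong to the image of the twisted elementary representation. -/
lemma exists_rep_eq_of_vol [FiniteDimensional ℝ S₀] (hm : IsPinorModel h α γ₀ γ₂ b)
    (hc : IsCompatible h α γ₀ γ₂) {A : Module.End ℝ S₀} (R : h.IsometryEquiv h)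
    (hA : ∀ v, A * γ₀ (CliffordAlgebra.ι h v) = γ₀ (CliffordAlgebra.ι h (R v)) * A)
    (hdet : LinearMap.det A ^ 2 = 1) (hR : vol h (R ∘ b) = vol h b) :
    ∃ k : SpinO h α,
      ((twistedRep h α γ₀ γ₂ hc k : (Module.End ℝ S₀)ˣ) : Module.End ℝ S₀) = A := by
  have : Nontrivial S₀ := hm.irr.1
  -- `γ₀ a` and `A` cover the same isometry, so they differ by an element `r + s J` of the
  -- commutant. The determinant condition forces `r² + s² = 1`, which makes this factor an element
  -- of `Spin₂(α)`.
  obtain ⟨a, ha⟩ := exists_spin_of_isometry b hm.orth hm.odd hm.vol_sq hm.irr R hR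
  set u : (Module.End ℝ S₀)ˣ := Units.map (γ₀ : CliffordAlgebra h →* Module.End ℝ S₀)
    (a : (CliffordAlgebra h)ˣ) with hu
  have huv : (u : Module.End ℝ S₀) = γ₀ ((a : (CliffordAlgebra h)ˣ) : CliffordAlgebra h) := rfl
  have hcomm : ∀ v, ((u⁻¹ : (Module.End ℝ S₀)ˣ) * A) * γ₀ (CliffordAlgebra.ι h v) =
      γ₀ (CliffordAlgebra.ι h v) * ((u⁻¹ : (Module.End ℝ S₀)ˣ) * A) := by
    intro v
    have h1 : (u : Module.End ℝ S₀) * γ₀ (CliffordAlgebra.ι h v) =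
        γ₀ (CliffordAlgebra.ι h (R v)) * u := by
      rw [huv, ← map_mul, ha, map_mul]
    have h2 : γ₀ (CliffordAlgebra.ι h v) * ((u⁻¹ : (Module.End ℝ S₀)ˣ) : Module.End ℝ S₀) =
        ((u⁻¹ : (Module.End ℝ S₀)ˣ) : Module.End ℝ S₀) * γ₀ (CliffordAlgebra.ι h (R v)) := by
      rw [Units.eq_inv_mul_iff_mul_eq, ← mul_assoc, h1, mul_assoc, Units.mul_inv, mul_one]
    rw [mul_assoc, hA, ← mul_assoc, ← h2, mul_assoc]
  obtain ⟨r, s, hrs⟩ := exists_eq_of_commutes b hm.orth hm.odd hm.vol_sq hm.irr hcomm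
  have hA' : A = γ₀ ((a : (CliffordAlgebra h)ˣ) : CliffordAlgebra h) * γ₀ (r • 1 + s • vol h b) :=
      by
    rw [map_add, map_smul, map_smul, map_one, ← hrs, ← huv, ← mul_assoc, Units.mul_inv, one_mul]
  have hone : r ^ 2 + s ^ 2 = 1 := by
    rw [hA', map_mul, mul_pow, hm.det_spin_sq, one_mul, hm.det_rot_sq] at hdet
    exact (pow_eq_one_iff_of_nonneg (by positivity) Module.finrank_pos.ne').1 hdet
  refine ⟨QuotientGroup.mk (a, ⟨rotUnit hm.alpha_sq r s hone, rotUnit_mem_pinTwo _ _ _ _⟩), ?_⟩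
  rw [twistedRep_mk, hA', ← hm.map_rot]
  rfl

/-- Operators which cover an isometry, of determinant `1` or `-1`, belong to the image of the
twisted elementary representation. -/
theorem exists_rep_eq [FiniteDimensional ℝ S₀] (hm : IsPinorModel h α γ₀ γ₂ b)
    (hc : IsCompatible h α γ₀ γ₂) {A : Module.End ℝ S₀} (R : h.IsometryEquiv h)
    (hA : ∀ v, A * γ₀ (CliffordAlgebra.ι h v) = γ₀ (CliffordAlgebra.ι h (R v)) * A)
    (hdet : LinearMap.det A ^ 2 = 1) :
    ∃ k : SpinO h α,
      ((twistedRep h α γ₀ γ₂ hc k : (Module.End ℝ S₀)ˣ) : Module.End ℝ S₀) = A := by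
  have hv := vol_eq_det_smul b hm.orth (hm.orth.comp_isometry R)
  rcases det_eq_one_or_neg_one b hm.orth hm.vol_sq (hm.orth.comp_isometry R) with h1 | h1
  · rw [h1, one_smul] at hv
    exact hm.exists_rep_eq_of_vol hc R hA hdet hv
  · rw [h1, neg_one_smul] at hv
    -- If `R` reverses the volume element, then `A D` covers `-R`, which preserves it because the
    -- dimension is odd.
    obtain ⟨k, hk⟩ := hm.exists_rep_eq_of_vol hc (A := A * γ₂ (e₁ α))
      (R.trans ⟨LinearEquiv.neg ℝ, fun v => by simp⟩)
      (by
        intro v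
        change _ = γ₀ (CliffordAlgebra.ι h (-(R v))) * _
        rw [mul_assoc, hm.anti_ι, mul_neg, ← mul_assoc, hA, map_neg, map_neg, neg_mul, mul_assoc])
      (by rw [map_mul, mul_pow, hdet, hm.det_D_sq, one_mul])
      (by
        change vol h (-(R ∘ b)) = _
        rw [vol_neg hm.odd, hv, neg_neg])
    refine ⟨k * (reflO h hm.alpha_sq)⁻¹, ?_⟩
    rw [map_mul, map_inv, Units.val_mul, hk, ← hm.rep_reflO hc, mul_assoc, Units.mul_inv, mul_one]

end IsPinorModel

end Model

end PinorGeom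
end

noncomputable section
namespace PinorGeom

set_option linter.unusedSectionVars false

/-! ### Smooth sections, frames and endomorphisms of vector bundles -/

section SmoothToolbox

variable {p q : ℕ} {M : Type*} [TopologicalSpace M]
  [ChartedSpace (EuclideanSpace ℝ (Fin (p + q))) M]

lemma contMDiffAt_clm_of_apply {F G : Type*} [NormedAddCommGroup F] [NormedSpace ℝ F]
    [FiniteDimensional ℝ F] [NormedAddCommGroup G] [NormedSpace ℝ G] {f : M → F →L[ℝ] G} {x₀ : M}
    (hf : ∀ w, ContMDiffAt (𝓡 (p + q)) 𝓘(ℝ, G) ∞ (fun x => f x w) x₀) :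
    ContMDiffAt (𝓡 (p + q)) 𝓘(ℝ, F →L[ℝ] G) ∞ f x₀ := by
  let b := Module.finBasis ℝ F
  let c : Fin (Module.finrank ℝ F) → F →L[ℝ] ℝ := fun i => LinearMap.toContinuousLinearMap
      (b.coord i)
  have h1 : f = fun x => ∑ i, ContinuousLinearMap.smulRightL ℝ F G (c i) (f x (b i)) := by
    funext x
    ext w
    conv_lhs => rw [← b.sum_repr w, map_sum]
    simp [c]
  rw [h1]
  refine ContMDiffAt.sum fun i _ => ?_
  exact ((ContinuousLinearMap.smulRightL ℝ F G (c i)).contDiff.contMDiff).contMDiffAt.comp x₀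
    (hf (b i))

variable {F : Type*} [NormedAddCommGroup F] [NormedSpace ℝ F]
  {S : M → Type*} [∀ x, AddCommGroup (S x)] [∀ x, Module ℝ (S x)]
  [∀ x, TopologicalSpace (S x)]
  [TopologicalSpace (TotalSpace F S)] [FiberBundle F S] [VectorBundle ℝ F S]

section Section

variable {s t : ∀ x, S x} {x₀ : M}

lemma SectionSmoothAt.congr (hs : SectionSmoothAt (p := p) (q := q) F S s x₀)
    (hst : ∀ᶠ x in nhds x₀, t x = s x) : SectionSmoothAt (p := p) (q := q) F S t x₀ :=
  ContMDiffAt.congr_of_eventuallyEq hs (hst.mono fun x hx => by simp only [hx])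

lemma SectionSmoothAt.add (hs : SectionSmoothAt (p := p) (q := q) F S s x₀)
    (ht : SectionSmoothAt (p := p) (q := q) F S t x₀) :
    SectionSmoothAt (p := p) (q := q) F S (fun x => s x + t x) x₀ :=
  ContMDiffAt.add_section hs ht

lemma SectionSmoothAt.smul {c : M → ℝ} (hf : ContMDiffAt (𝓡 (p + q)) 𝓘(ℝ) ∞ c x₀)
    (hs : SectionSmoothAt (p := p) (q := q) F S s x₀) :
    SectionSmoothAt (p := p) (q := q) F S (fun x => c x • s x) x₀ :=
  ContMDiffAt.smul_section hf hs

lemma SectionSmoothAt.const_smul (c : ℝ)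
    (hs : SectionSmoothAt (p := p) (q := q) F S s x₀) :
    SectionSmoothAt (p := p) (q := q) F S (fun x => c • s x) x₀ :=
  SectionSmoothAt.smul contMDiffAt_const hs

lemma SectionSmoothAt.sum {ι : Type*} (A : Finset ι) {s : ι → ∀ x, S x}
    (hs : ∀ i ∈ A, SectionSmoothAt (p := p) (q := q) F S (s i) x₀) :
    SectionSmoothAt (p := p) (q := q) F S (fun x => ∑ i ∈ A, s i x) x₀ :=
  ContMDiffAt.sum_section hs

lemma SectionSmoothAt.sub (hs : SectionSmoothAt (p := p) (q := q) F S s x₀)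
    (ht : SectionSmoothAt (p := p) (q := q) F S t x₀) :
    SectionSmoothAt (p := p) (q := q) F S (fun x => s x - t x) x₀ :=
  ContMDiffAt.sub_section hs ht

end Section

/-! ### Smooth local frames -/

variable {S₀ : Type*} [AddCommGroup S₀] [Module ℝ S₀]

variable (p q F S) in
/-- A family of frames `S₀ ≃ S_x` is smooth at `x₀`. -/
def FrameSmoothAt (f : ∀ x, S₀ ≃ₗ[ℝ] S x) (x₀ : M) : Prop :=
  ∀ s, SectionSmoothAt (p := p) (q := q) F S (fun y => f y s) x₀

section Frame
variable [IsManifold (𝓡 (p + q)) ∞ M] [ContMDiffVectorBundle ∞ F S (𝓡 (p + q))]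

variable (F S) in
open Classical in
/-- The frame of a vector bundle given near `x₀` by the trivialization at `x₀`. -/
def trivFrame (x₀ x : M) : F ≃ₗ[ℝ] S x :=
  if hx : x ∈ (trivializationAt F S x₀).baseSet then
    ((trivializationAt F S x₀).linearEquivAt ℝ x hx).symm
  else ((trivializationAt F S x).linearEquivAt ℝ x (mem_baseSet_trivializationAt F S x)).symm

lemma trivFrame_smooth (x₀ : M) : ∀ᶠ x in nhds x₀, FrameSmoothAt p q F S (trivFrame F S x₀) x := by
  have hn := (trivializationAt F S x₀).open_baseSet.mem_nhds (mem_baseSet_trivializationAt F S x₀)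
  filter_upwards [eventually_mem_nhds_iff.2 hn] with x hx s
  have hx' := mem_of_mem_nhds hx
  refine ((trivializationAt F S x₀).contMDiffAt_section_iff hx').2 ?_
  refine (contMDiffAt_const (c := s)).congr_of_eventuallyEq ?_
  filter_upwards [hx] with y hy
  simp only [trivFrame, hy, dif_pos]
  have := ((trivializationAt F S x₀).linearEquivAt ℝ y hy).apply_symm_apply s
  rwa [Trivialization.linearEquivAt_apply] at this

lemma SectionSmoothAt.coord_trivialization {t : ∀ x, S x} {x₀ : M}
    (ht : SectionSmoothAt (p := p) (q := q) F S t x₀) :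
    ContMDiffAt (𝓡 (p + q)) 𝓘(ℝ, F) ∞ (fun x => (trivializationAt F S x₀ ⟨x, t x⟩).2) x₀ :=
  (contMDiffAt_section x₀).1 ht

/-- The coordinates of a smooth section in a smooth frame are smooth. -/
lemma SectionSmoothAt.coord [FiniteDimensional ℝ F] [FiniteDimensional ℝ S₀]
    {f : ∀ x, S₀ ≃ₗ[ℝ] S x} {t : ∀ x, S x} {x₀ : M}
    (ht : SectionSmoothAt (p := p) (q := q) F S t x₀) (hf : FrameSmoothAt p q F S f x₀)
    (ℓ : S₀ →ₗ[ℝ] ℝ) :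
    ContMDiffAt (𝓡 (p + q)) 𝓘(ℝ) ∞ (fun x => ℓ ((f x).symm (t x))) x₀ := by
  set e := trivializationAt F S x₀ with he
  let B := Module.finBasis ℝ S₀
  let N := Fin (Module.finrank ℝ S₀)
  -- In the trivialization the frame is a smooth family of operators, invertible on the base set.
  -- Inversion of operators is smooth, and the coordinates are the inverse family applied to the
  -- section.
  let G : M → (N → ℝ) →L[ℝ] F := fun x =>
    LinearMap.toContinuousLinearMap
      ((e.linearMapAt ℝ x ∘ₗ (f x).toLinearMap) ∘ₗ B.equivFun.symm.toLinearMap)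
  have hG : ContMDiffAt (𝓡 (p + q)) 𝓘(ℝ, (N → ℝ) →L[ℝ] F) ∞ G x₀ := by
    refine contMDiffAt_clm_of_apply fun w => ?_
    refine (hf (B.equivFun.symm w)).coord_trivialization.congr_of_eventuallyEq ?_
    filter_upwards [e.open_baseSet.mem_nhds (mem_baseSet_trivializationAt F S x₀)] with x hx
    exact congrFun (Trivialization.coe_linearMapAt_of_mem e hx) _
  have hbase := mem_baseSet_trivializationAt F S x₀
  let Ge : ∀ x, x ∈ e.baseSet → (N → ℝ) ≃L[ℝ] F := fun x hx =>
    ((B.equivFun.symm.trans (f x)).trans (e.linearEquivAt ℝ x hx)).toContinuousLinearEquiv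
  have hGe : ∀ x hx, (Ge x hx : (N → ℝ) →L[ℝ] F) = G x := by
    intro x hx
    refine ContinuousLinearMap.ext fun w => ?_
    exact (congrFun (Trivialization.coe_linearMapAt_of_mem e hx) (f x (B.equivFun.symm w))).symm
  have hinv : ContMDiffAt (𝓡 (p + q)) 𝓘(ℝ, F →L[ℝ] (N → ℝ)) ∞
      (fun x => ContinuousLinearMap.inverse (G x)) x₀ := by
    refine ContDiffAt.comp_contMDiffAt (g := ContinuousLinearMap.inverse) ?_ hG
    rw [← hGe x₀ hbase]
    exact contDiffAt_map_inverse (Ge x₀ hbase)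
  have hc := hinv.clm_apply ht.coord_trivialization
  let L : (N → ℝ) →L[ℝ] ℝ := LinearMap.toContinuousLinearMap (ℓ ∘ₗ B.equivFun.symm.toLinearMap)
  refine (L.contDiff.contMDiff.contMDiffAt.comp x₀ hc).congr_of_eventuallyEq ?_
  filter_upwards [e.open_baseSet.mem_nhds hbase] with x hx
  have h1 : (trivializationAt F S x₀ ⟨x, t x⟩).2 = Ge x hx (B.equivFun ((f x).symm (t x))) := by
    simp [Ge, he]
  simp only [Function.comp_apply, h1, ← hGe x hx, ContinuousLinearMap.inverse_equiv]
  simp [L]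


/-- The determinant is a polynomial in the frame coordinates of the sections `A x (B i)`.
Invertibility of `A x` is not required, so the lemma can be used to detect it. -/
lemma det_coord_smooth {S₁ : Type*} [AddCommGroup S₁] [Module ℝ S₁]
    [FiniteDimensional ℝ F] [FiniteDimensional ℝ S₁]
    {f : ∀ x, S₁ ≃ₗ[ℝ] S x} {A : ∀ x, S₁ →ₗ[ℝ] S x} {x₀ : M} (hf : FrameSmoothAt p q F S f x₀)
    (hA : ∀ s, SectionSmoothAt (p := p) (q := q) F S (fun x => A x s) x₀) :
    ContMDiffAt (𝓡 (p + q)) 𝓘(ℝ) ∞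
      (fun x => LinearMap.det ((f x).symm.toLinearMap ∘ₗ A x)) x₀ := by
  let B := Module.finBasis ℝ S₁
  have h1 : (fun x => LinearMap.det ((f x).symm.toLinearMap ∘ₗ A x)) = fun x =>
      ∑ σ : Equiv.Perm (Fin (Module.finrank ℝ S₁)), ((Equiv.Perm.sign σ : ℤ) : ℝ) *
        ∏ i, B.coord (σ i) ((f x).symm (A x (B i))) := by
    funext x
    rw [← LinearMap.det_toMatrix B, Matrix.det_apply']
    simp [LinearMap.toMatrix_apply]
  rw [h1]
  refine ContMDiffAt.sum fun σ _ => contMDiffAt_const.mul ?_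
  refine contMDiffAt_finsetProd fun i _ => ?_
  exact SectionSmoothAt.coord (hA (B i)) hf _

variable (F S) in
lemma fiber_finiteDimensional [FiniteDimensional ℝ F] (x : M) : FiniteDimensional ℝ (S x) :=
  LinearEquiv.finiteDimensional (trivFrame F S x x)

variable (F S) in
include F in
lemma fiber_t2Space (x : M) : T2Space (S x) :=
  ((trivializationAt F S x).continuousLinearEquivAt ℝ x
    (mem_baseSet_trivializationAt F S x)).toHomeomorph.symm.t2Space

section End
variable [∀ x, IsTopologicalAddGroup (S x)] [∀ x, ContinuousSMul ℝ (S x)]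
  {T T' : ∀ x, S x →L[ℝ] S x} {x₀ : M}

lemma EndSmoothAt.apply (hT : EndSmoothAt (p := p) (q := q) F S T x₀) {s : ∀ x, S x}
    (hs : SectionSmoothAt (p := p) (q := q) F S s x₀) :
    SectionSmoothAt (p := p) (q := q) F S (fun x => T x (s x)) x₀ :=
  ContMDiffAt.clm_bundle_apply hT hs

/-- It suffices to test on the sections that are constant in the trivialization at `x₀`. This
reduces sums, products and multiples of endomorphism fields to statements about sections of `S`. -/
lemma endSmoothAt_of_apply [FiniteDimensional ℝ F]
    (hT : ∀ s : ∀ x, S x, SectionSmoothAt (p := p) (q := q) F S s x₀ →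
      SectionSmoothAt (p := p) (q := q) F S (fun x => T x (s x)) x₀) :
    EndSmoothAt (p := p) (q := q) F S T x₀ := by
  refine (contMDiffAt_hom_bundle _).2 ⟨contMDiffAt_id, ?_⟩
  refine contMDiffAt_clm_of_apply fun w => ?_
  have h1 := (hT _ ((trivFrame_smooth (p := p) (q := q) (F := F) (S := S)
      x₀).self_of_nhds w)).coord_trivialization
  refine h1.congr_of_eventuallyEq ?_
  filter_upwards [(trivializationAt F S x₀).open_baseSet.mem_nhds
    (mem_baseSet_trivializationAt F S x₀)] with x hx
  simp only [ContinuousLinearMap.inCoordinates, trivFrame, hx, dif_pos]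
  have h2 : ∀ v, (trivializationAt F S x₀).continuousLinearMapAt ℝ x v =
      (trivializationAt F S x₀ ⟨x, v⟩).2 := fun v =>
    congrFun (Trivialization.coe_linearMapAt_of_mem _ hx) v
  have h3 : (trivializationAt F S x₀).symmL ℝ x w =
      ((trivializationAt F S x₀).linearEquivAt ℝ x hx).symm w := by
    rw [LinearEquiv.eq_symm_apply, Trivialization.linearEquivAt_apply]
    exact (h2 _).symm.trans (Trivialization.continuousLinearMapAt_symmL _ hx w)
  simp only [ContinuousLinearMap.comp_apply, h2, h3]

lemma EndSmoothAt.congr (hT : EndSmoothAt (p := p) (q := q) F S T x₀)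
    (h : ∀ᶠ x in nhds x₀, T' x = T x) : EndSmoothAt (p := p) (q := q) F S T' x₀ :=
  ContMDiffAt.congr_of_eventuallyEq hT (h.mono fun x hx => by simp only [hx])

variable [FiniteDimensional ℝ F]

lemma EndSmoothAt.add (hT : EndSmoothAt (p := p) (q := q) F S T x₀)
    (hT' : EndSmoothAt (p := p) (q := q) F S T' x₀) :
    EndSmoothAt (p := p) (q := q) F S (fun x => T x + T' x) x₀ :=
  endSmoothAt_of_apply fun _ hs => (hT.apply hs).add (hT'.apply hs)

lemma EndSmoothAt.sub (hT : EndSmoothAt (p := p) (q := q) F S T x₀)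
    (hT' : EndSmoothAt (p := p) (q := q) F S T' x₀) :
    EndSmoothAt (p := p) (q := q) F S (fun x => T x - T' x) x₀ :=
  endSmoothAt_of_apply fun _ hs => (hT.apply hs).sub (hT'.apply hs)

lemma EndSmoothAt.mul (hT : EndSmoothAt (p := p) (q := q) F S T x₀)
    (hT' : EndSmoothAt (p := p) (q := q) F S T' x₀) :
    EndSmoothAt (p := p) (q := q) F S (fun x => T x * T' x) x₀ :=
  endSmoothAt_of_apply fun _ hs => hT.apply (hT'.apply hs)

lemma EndSmoothAt.smul {c : M → ℝ} (hc : ContMDiffAt (𝓡 (p + q)) 𝓘(ℝ) ∞ c x₀)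
    (hT : EndSmoothAt (p := p) (q := q) F S T x₀) :
    EndSmoothAt (p := p) (q := q) F S (fun x => c x • T x) x₀ :=
  endSmoothAt_of_apply fun _ hs => (hT.apply hs).smul hc

lemma endSmoothAt_one : EndSmoothAt (p := p) (q := q) F S (fun _ => 1) x₀ :=
  endSmoothAt_of_apply fun _ hs => hs

lemma endSmoothAt_of_frame [FiniteDimensional ℝ S₀] {f : ∀ x, S₀ ≃ₗ[ℝ] S x}
    (hf : FrameSmoothAt p q F S f x₀)
    (hT : ∀ s, SectionSmoothAt (p := p) (q := q) F S (fun x => T x (f x s)) x₀) :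
    EndSmoothAt (p := p) (q := q) F S T x₀ := by
  refine endSmoothAt_of_apply fun s hs => ?_
  let B := Module.finBasis ℝ S₀
  have h1 : (fun x => T x (s x)) =
      fun x => ∑ i, B.coord i ((f x).symm (s x)) • T x (f x (B i)) := by
    funext x
    have : s x = ∑ i, B.coord i ((f x).symm (s x)) • f x (B i) := by
      simp only [← map_smul, ← map_sum, Module.Basis.coord_apply, B.sum_repr,
        LinearEquiv.apply_symm_apply]
    conv_lhs => rw [this]
    simp only [map_sum, map_smul]
  rw [h1]
  exact SectionSmoothAt.sum _ fun i _ => (hT (B i)).smul (hs.coord hf _)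

/-- An endomorphism which is constant in a smooth frame is smooth. -/
lemma endSmoothAt_of_conj [FiniteDimensional ℝ S₀] {f : ∀ x, S₀ ≃ₗ[ℝ] S x}
    (hf : FrameSmoothAt p q F S f x₀) (A : Module.End ℝ S₀)
    (hT : ∀ᶠ x in nhds x₀, ∀ s, T x (f x s) = f x (A s)) :
    EndSmoothAt (p := p) (q := q) F S T x₀ :=
  endSmoothAt_of_frame hf fun s => (hf (A s)).congr (hT.mono fun _ hx => hx s)

/-- The trace is computed in a smooth local frame. Coefficients and signs in the Schur bundle are
later read off from such traces. -/
lemma EndSmoothAt.trace (hT : EndSmoothAt (p := p) (q := q) F S T x₀) :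
    ContMDiffAt (𝓡 (p + q)) 𝓘(ℝ) ∞
      (fun x => LinearMap.trace ℝ (S x) (T x : S x →ₗ[ℝ] S x)) x₀ := by
  let B := Module.finBasis ℝ F
  have hf := (trivFrame_smooth (p := p) (q := q) (F := F) (S := S) x₀).self_of_nhds
  have h1 : (fun x => LinearMap.trace ℝ (S x) (T x : S x →ₗ[ℝ] S x)) = fun x =>
      ∑ i, B.coord i ((trivFrame F S x₀ x).symm (T x (trivFrame F S x₀ x (B i)))) := by
    funext x
    rw [← LinearMap.trace_conj' (T x : S x →ₗ[ℝ] S x) (trivFrame F S x₀ x).symm,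
      LinearMap.trace_eq_matrix_trace ℝ B, Matrix.trace]
    simp [LinearMap.toMatrix_apply, LinearEquiv.conj_apply]
  rw [h1]
  exact ContMDiffAt.sum fun i _ => (hT.apply (hf (B i))).coord hf _

end End

end Frame
end SmoothToolbox
end PinorGeom
end

noncomputable section
namespace PinorGeom

set_option linter.unusedSectionVars false

/-! ### Smooth signed frames and local volume elements -/

section TangentFrames

variable {p q : ℕ} {M : Type*} [TopologicalSpace M]
  [ChartedSpace (EuclideanSpace ℝ (Fin (p + q))) M] [IsManifold (𝓡 (p + q)) ∞ M]
  (g : PseudoRiemannianMetric p q M)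

variable (p q M) in
/-- Smoothness at `x₀` of vector fields. -/
abbrev VectorSmoothAt (X : ∀ x : M, TangentSpace (𝓡 (p + q)) x) (x₀ : M) : Prop :=
  SectionSmoothAt (p := p) (q := q) (EuclideanSpace ℝ (Fin (p + q))) (fun x : M => TangentSpace (𝓡
    (p + q)) x) X x₀

/-- A basis of a tangent space in which the metric is `diag(1, …, 1, -1, …, -1)`. -/
def IsSignedFrame (x : M) (e : Fin (p + q) → TangentSpace (𝓡 (p + q)) x) : Prop :=
  ∀ i j, g.inner x (e i) (e j) = if i = j then signs p q i else 0

variable {g}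

lemma inner_eq_of_quadOf (x : M) (v w : TangentSpace (𝓡 (p + q)) x) :
    g.inner x v w = 2⁻¹ * QuadraticMap.polar (quadOf (g.inner x)) v w := by
  have h1 : QuadraticMap.polar (quadOf (g.inner x)) v w = g.inner x v w + g.inner x w v := by
    simp only [QuadraticMap.polar]
    change g.inner x (v + w) (v + w) - g.inner x v v - g.inner x w w = _
    simp only [map_add, _root_.add_apply]
    ring
  rw [h1, g.symm x w v]
  ring

lemma quadOf_polar_self (x : M) (v : TangentSpace (𝓡 (p + q)) x) :
    QuadraticMap.polar (quadOf (g.inner x)) v v = 2 * quadOf (g.inner x) v := by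
  rw [QuadraticMap.polar_self, two_nsmul, two_mul]

lemma inner_smooth {X Y : ∀ x : M, TangentSpace (𝓡 (p + q)) x} {x₀ : M}
    (hX : VectorSmoothAt p q M X x₀) (hY : VectorSmoothAt p q M Y x₀) :
    ContMDiffAt (𝓡 (p + q)) 𝓘(ℝ) ∞ (fun x => g.inner x (X x) (Y x)) x₀ := by
  have h1 : ContMDiffAt (𝓡 (p + q)) ((𝓡 (p + q)).prod 𝓘(ℝ)) ∞
      (fun x => TotalSpace.mk' ℝ (E := Bundle.Trivial M ℝ) x (g.inner x (X x) (Y x))) x₀ := by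
    apply ContMDiffAt.clm_bundle_apply₂ (F₁ := EuclideanSpace ℝ (Fin (p + q))) (F₂ :=
      EuclideanSpace ℝ (Fin (p + q)))
    · exact g.contMDiff x₀
    · exact hX
    · exact hY
  exact ((contMDiffAt_section x₀).1 h1)

lemma flat_smooth {X : ∀ x : M, TangentSpace (𝓡 (p + q)) x} {x₀ : M}
    (hX : VectorSmoothAt p q M X x₀)  :
    ContMDiffAt (𝓡 (p + q))
        ((𝓡 (p + q)).prod 𝓘(ℝ, EuclideanSpace ℝ (Fin (p + q)) →L[ℝ] ℝ)) ∞
        (fun x => TotalSpace.mk' (EuclideanSpace ℝ (Fin (p + q)) →L[ℝ] ℝ)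
          (E := fun x : M => Cotangent p q x) x (g.flat x (X x))) x₀ := 
  ContMDiffAt.clm_bundle_apply (g.contMDiff x₀) hX


/-- For an indefinite metric Gram–Schmidt may meet null vectors. Because the frame is already signed
at `x₀`, the step changes nothing there; the normalising function is `1` at `x₀` and stays positive
nearby. -/
lemma gramSchmidt_step {x₀ : M} (k : Fin (p + q)) (E : Fin (p + q) → ∀ x : M, TangentSpace (𝓡
    (p + q)) x)
    (h₀ : IsSignedFrame g x₀ fun i => E i x₀)
    (hE : ∀ᶠ x in nhds x₀, (∀ i, VectorSmoothAt p q M (E i) x) ∧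
      ∀ i j, i < k → j < k → g.inner x (E i x) (E j x) = if i = j then signs p q i else 0) :
    ∃ E' : Fin (p + q) → ∀ x : M, TangentSpace (𝓡 (p + q)) x,
      (IsSignedFrame g x₀ fun i => E' i x₀) ∧
      ∀ᶠ x in nhds x₀, (∀ i, VectorSmoothAt p q M (E' i) x) ∧
        ∀ i j, i ≤ k → j ≤ k → g.inner x (E' i x) (E' j x) = if i = j then signs p q i else 0 := by
  have hsg : ∀ i : Fin (p + q), signs p q i * signs p q i = 1 := fun i => by
    rcases signs_eq p q i with h | h <;> rw [h] <;> norm_num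
  let Y : ∀ x : M, TangentSpace (𝓡 (p + q)) x := fun x =>
    E k x - ∑ i with i < k, (signs p q i * g.inner x (E k x) (E i x)) • E i x
  let c : M → ℝ := fun x => signs p q k * g.inner x (Y x) (Y x)
  have hYx : Y x₀ = E k x₀ := by
    have : ∀ i ∈ Finset.univ.filter (fun i => i < k),
        (signs p q i * g.inner x₀ (E k x₀) (E i x₀)) • E i x₀ = 0 := by
      intro i hi
      rw [Finset.mem_filter] at hi
      rw [h₀ k i, if_neg hi.2.ne']
      simp
    simp only [Y]
    rw [Finset.sum_eq_zero this, sub_zero]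
  have hc₀ : c x₀ = 1 := by
    simp only [c]
    rw [hYx, h₀ k k, if_pos rfl, hsg]
  have hYs : ∀ᶠ x in nhds x₀, VectorSmoothAt p q M Y x := by
    filter_upwards [hE] with x hx
    refine (hx.1 k).sub (SectionSmoothAt.sum _ fun i _ => (hx.1 i).smul ?_)
    exact contMDiffAt_const.mul (inner_smooth (hx.1 k) (hx.1 i))
  have hcs : ∀ᶠ x in nhds x₀, ContMDiffAt (𝓡 (p + q)) 𝓘(ℝ) ∞ c x :=
    hYs.mono fun x hx => contMDiffAt_const.mul (inner_smooth hx hx)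
  have hcpos : ∀ᶠ x in nhds x₀, 0 < c x :=
    hcs.self_of_nhds.continuousAt.eventually (lt_mem_nhds (by rw [hc₀]; exact one_pos))
  let Z : ∀ x : M, TangentSpace (𝓡 (p + q)) x := fun x => (Real.sqrt (c x))⁻¹ • Y x
  have hZs : ∀ᶠ x in nhds x₀, VectorSmoothAt p q M Z x := by
    filter_upwards [hYs, hcs, hcpos] with x h1 h2 h3
    refine SectionSmoothAt.smul ?_ h1
    refine ContMDiffAt.inv₀ ?_ (Real.sqrt_pos.2 h3).ne'
    exact ContDiffAt.comp_contMDiffAt (Real.contDiffAt_sqrt h3.ne') h2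
  have hZx : Z x₀ = E k x₀ := by simp only [Z, hc₀, hYx]; simp
  refine ⟨Function.update E k Z, ?_, ?_⟩
  · have : (fun i => Function.update E k Z i x₀) = fun i => E i x₀ := by
      funext i
      by_cases hi : i = k
      · subst hi; simp [hZx]
      · simp [Function.update_of_ne hi]
    rw [this]
    exact h₀
  filter_upwards [hE, hZs, hcpos] with x hx hz hpos
  refine ⟨fun i => ?_, ?_⟩
  · by_cases hi : i = k
    · subst hi; simpa using hz
    · simpa [Function.update_of_ne hi] using hx.1 i
  have hYE : ∀ j, j < k → g.inner x (Y x) (E j x) = 0 := by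
    intro j hj
    simp only [Y, map_sub, map_sum, map_smul, _root_.sub_apply,
      _root_.sum_apply, _root_.smul_apply, smul_eq_mul]
    rw [Finset.sum_eq_single j]
    · rw [hx.2 j j hj hj, if_pos rfl]
      linear_combination -(g.inner x (E k x) (E j x)) * hsg j
    · intro i hi hij
      rw [hx.2 i j (Finset.mem_filter.1 hi).2 hj, if_neg hij, mul_zero]
    · intro h; simp [hj] at h
  have hZE : ∀ j, j < k → g.inner x (Z x) (E j x) = 0 := by
    intro j hj
    simp [Z, hYE j hj]
  have hZZ : g.inner x (Z x) (Z x) = signs p q k := by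
    have h1 : g.inner x (Y x) (Y x) = signs p q k * c x := by
      simp only [c]
      rw [← mul_assoc, hsg, one_mul]
    simp only [Z, map_smul, _root_.smul_apply, smul_eq_mul]
    rw [h1]
    have h2 := Real.mul_self_sqrt hpos.le
    have h3 := (Real.sqrt_pos.2 hpos).ne'
    field_simp
    rw [sq, h2, mul_comm]
  intro i j hi hj
  by_cases hik : i = k
  · by_cases hjk : j = k
    · rw [hik, hjk]; simpa using hZZ
    · rw [hik, if_neg (Ne.symm hjk), Function.update_self, Function.update_of_ne hjk]
      exact hZE j (lt_of_le_of_ne hj hjk)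
  · by_cases hjk : j = k
    · rw [hjk, if_neg hik, Function.update_self, Function.update_of_ne hik, g.symm]
      exact hZE i (lt_of_le_of_ne hi hik)
    · rw [Function.update_of_ne hik, Function.update_of_ne hjk]
      exact hx.2 i j (lt_of_le_of_ne hi hik) (lt_of_le_of_ne hj hjk)

variable (g) in
/-- A pseudo-Riemannian metric has smooth local orthonormal frames. -/
lemma exists_smooth_signedFrame (x₀ : M) :
    ∃ E : Fin (p + q) → ∀ x : M, TangentSpace (𝓡 (p + q)) x,
      ∀ᶠ x in nhds x₀, (∀ i, VectorSmoothAt p q M (E i) x) ∧ IsSignedFrame g x fun i => E i x := by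
  have key : ∀ k : ℕ, k ≤ p + q → ∃ E : Fin (p + q) → ∀ x : M, TangentSpace (𝓡 (p + q)) x,
      (IsSignedFrame g x₀ fun i => E i x₀) ∧
      ∀ᶠ x in nhds x₀, (∀ i, VectorSmoothAt p q M (E i) x) ∧
        ∀ i j : Fin (p + q), i.1 < k → j.1 < k →
          g.inner x (E i x) (E j x) = if i = j then signs p q i else 0 := by
    intro k
    induction k with
    | zero =>
      intro _
      -- The induction starts from a signed basis at `x₀`, extended by constant coordinates in the
      -- trivialization.
      obtain ⟨b, h1, h2⟩ := (g.signature x₀).exists_basis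
      let f := trivFrame (EuclideanSpace ℝ (Fin (p + q))) (fun x : M => TangentSpace (𝓡 (p + q)) x)
          x₀
      refine ⟨fun i x => f x ((f x₀).symm (b i)), ?_, ?_⟩
      · intro i j
        simp only [LinearEquiv.apply_symm_apply]
        rw [inner_eq_of_quadOf]
        by_cases hij : i = j
        · rw [if_pos hij, ← hij, quadOf_polar_self, h2]; ring
        · rw [if_neg hij, h1 i j hij, mul_zero]
      · filter_upwards [trivFrame_smooth (p := p) (q := q) (F := EuclideanSpace ℝ (Fin (p + q)))
          (S := fun x : M => TangentSpace (𝓡 (p + q)) x) x₀] with x hx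
        exact ⟨fun i => hx _, fun i j hi => absurd hi (Nat.not_lt_zero _)⟩
    | succ k ih =>
      intro hk
      obtain ⟨E, h0, hE⟩ := ih (by omega)
      obtain ⟨E', h0', hE'⟩ := gramSchmidt_step (g := g) ⟨k, hk⟩ E h0 (by
        filter_upwards [hE] with x hx
        exact ⟨hx.1, fun i j hi hj => hx.2 i j hi hj⟩)
      refine ⟨E', h0', ?_⟩
      filter_upwards [hE'] with x hx
      exact ⟨hx.1, fun i j hi hj => hx.2 i j (Nat.lt_succ_iff.1 hi) (Nat.lt_succ_iff.1 hj)⟩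
  obtain ⟨E, -, hE⟩ := key (p + q) le_rfl
  refine ⟨E, ?_⟩
  filter_upwards [hE] with x hx
  exact ⟨hx.1, fun i j => hx.2 i j i.2 j.2⟩


/-! ### Local frames of the complex orientation bundle -/

section Coframe

lemma dualForm_flat (x : M) (v : TangentSpace (𝓡 (p + q)) x) :
    g.dualForm x (g.flat x v) = quadOf (g.inner x) v := by
  change quadOf (g.inner x) ((g.flat x).symm (g.flat x v)) = _
  rw [LinearEquiv.symm_apply_apply]

lemma polar_dualForm_flat (x : M) (v w : TangentSpace (𝓡 (p + q)) x) :
    QuadraticMap.polar (g.dualForm x) (g.flat x v) (g.flat x w) =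
      QuadraticMap.polar (quadOf (g.inner x)) v w := by
  simp only [QuadraticMap.polar, ← map_add, dualForm_flat]

variable {x : M} {e : Fin (p + q) → TangentSpace (𝓡 (p + q)) x}

lemma IsSignedFrame.orth (he : IsSignedFrame g x e) (i j : Fin (p + q)) (hij : i ≠ j) :
    QuadraticMap.polar (g.dualForm x) (g.flat x (e i)) (g.flat x (e j)) = 0 := by
  have h1 := inner_eq_of_quadOf (g := g) x (e i) (e j)
  rw [he i j, if_neg hij] at h1
  rw [polar_dualForm_flat]
  linarith

lemma IsSignedFrame.unit (he : IsSignedFrame g x e) (i : Fin (p + q)) :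
    g.dualForm x (g.flat x (e i)) = signs p q i := by
  rw [dualForm_flat]
  have := he i i
  rw [if_pos rfl] at this
  exact this

lemma IsSignedFrame.isPseudoOrthonormal (he : IsSignedFrame g x e) :
    IsPseudoOrthonormal (g.dualForm x) fun i => g.flat x (e i) :=
  isPseudoOrthonormal_of_signs he.orth he.unit

lemma finrank_cotangent (x : M) : Module.finrank ℝ (Cotangent p q x) = p + q := by
  have h1 : Module.finrank ℝ (TangentSpace (𝓡 (p + q)) x) = p + q :=
    finrank_euclideanSpace_fin
  rw [← (LinearMap.toContinuousLinearMap (𝕜 := ℝ)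
      (E := TangentSpace (𝓡 (p + q)) x) (F' := ℝ)).finrank_eq]
  exact Subspace.dual_finrank_eq.trans h1

instance finiteDimensional_cotangent (x : M) : FiniteDimensional ℝ (Cotangent p q x) :=
  LinearEquiv.finiteDimensional (LinearMap.toContinuousLinearMap (𝕜 := ℝ)
    (E := TangentSpace (𝓡 (p + q)) x) (F' := ℝ))

/-- The coframe dual to a signed frame. -/
def IsSignedFrame.coframe (he : IsSignedFrame g x e) :
    Module.Basis (Fin (p + q)) ℝ (Cotangent p q x) :=
  he.isPseudoOrthonormal.basis (finrank_cotangent x)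

@[simp] lemma IsSignedFrame.coe_coframe (he : IsSignedFrame g x e) :
    ⇑he.coframe = fun i => g.flat x (e i) :=
  he.isPseudoOrthonormal.coe_basis (finrank_cotangent x)

lemma IsSignedFrame.coframe_apply (he : IsSignedFrame g x e) (i : Fin (p + q)) :
    he.coframe i = g.flat x (e i) := congrFun he.coe_coframe i

lemma IsSignedFrame.coframe_orthonormal (he : IsSignedFrame g x e) :
    IsPseudoOrthonormal (g.dualForm x) he.coframe := by
  rw [he.coe_coframe]; exact he.isPseudoOrthonormal

variable (g) in
/-- The volume element of a tangent frame. -/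
def volOf (x : M) (e : Fin (p + q) → TangentSpace (𝓡 (p + q)) x) : g.Cl x :=
  vol (g.dualForm x) fun i => g.flat x (e i)

lemma IsSignedFrame.vol_coframe (he : IsSignedFrame g x e) :
    vol (g.dualForm x) he.coframe = volOf g x e := by
  rw [he.coe_coframe]; rfl

lemma IsSignedFrame.volOf_sq (hpq : ((p : ℤ) - q) % 8 = 3 ∨ ((p : ℤ) - q) % 8 = 7)
    (he : IsSignedFrame g x e) : volOf g x e * volOf g x e = -1 :=
  vol_sq_of_signs hpq he.orth he.unit

lemma volOf_smooth {E : Fin (p + q) → ∀ x : M, TangentSpace (𝓡 (p + q)) x} {x₀ : M}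
    (hE : ∀ i, VectorSmoothAt p q M (E i) x₀) :
    g.CliffordSmoothAt x₀ fun x => volOf g x fun i => E i x := by
  have key : ∀ l : List (Fin (p + q)), g.CliffordSmoothAt x₀ fun x =>
      (l.map fun i => CliffordAlgebra.ι (g.dualForm x) (g.flat x (E i x))).prod := by
    intro l
    induction l with
    | nil =>
      simpa using PseudoRiemannianMetric.CliffordSmoothAt.function (g := g) (x₀ := x₀)
        (fun _ => 1) contMDiffAt_const
    | cons i l ih =>
      simp only [List.map_cons, List.prod_cons]
      exact .mul _ _ (.oneForm _ (flat_smooth (hE i))) ih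
  have := key (List.finRange (p + q))
  simpa only [volOf, vol, List.ofFn_eq_map] using this

/-- The top exterior power is spanned by the wedge product of the coframe, which corresponds to the
Clifford product since the covectors are orthogonal. -/
lemma IsSignedFrame.orientationLine_eq (he : IsSignedFrame g x e) :
    g.orientationLine x = Submodule.span ℝ {volOf g x e} := by
  have h1 : ⋀[ℝ]^(p + q) (Cotangent p q x) =
      Submodule.span ℝ {ExteriorAlgebra.ιMulti ℝ (p + q) he.coframe} := by
    rw [← ExteriorAlgebra.ιMulti_span_fixedDegree]
    refine le_antisymm (Submodule.span_le.2 ?_) (Submodule.span_mono ?_)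
    · rintro _ ⟨v, rfl⟩
      rw [SetLike.mem_coe, ιMulti_eq_det_smul he.coframe v]
      exact Submodule.mem_span_singleton.2 ⟨he.coframe.det v, rfl⟩
    · rintro _ rfl
      exact ⟨_, rfl⟩
  rw [PseudoRiemannianMetric.orientationLine, h1, Submodule.map_span, Set.image_singleton]
  congr 2
  rw [← equivExterior_vol he.coframe_orthonormal, he.vol_coframe]
  exact LinearEquiv.symm_apply_apply _ _

lemma IsSignedFrame.complexOrientation_eq (he : IsSignedFrame g x e) :
    g.complexOrientation x = Submodule.span ℝ {1, volOf g x e} := by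
  rw [PseudoRiemannianMetric.complexOrientation, he.orientationLine_eq, ← Submodule.span_union]
  rfl

lemma IsSignedFrame.mem_complexOrientation (he : IsSignedFrame g x e) {a : g.Cl x} :
    a ∈ g.complexOrientation x ↔ ∃ r s : ℝ, a = r • 1 + s • volOf g x e := by
  rw [he.complexOrientation_eq, Submodule.mem_span_pair]
  exact ⟨fun ⟨r, s, h⟩ => ⟨r, s, h.symm⟩, fun ⟨r, s, h⟩ => ⟨r, s, h.symm⟩⟩

end Coframe

end TangentFrames
end PinorGeom
end

noncomputable section
namespace PinorGeom

set_option linter.unusedSectionVars false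

/-! ### The Schur bundle as the image of the complex orientation bundle -/

section Schur

lemma trace_eq_zero_of_anticommute {W : Type*} [AddCommGroup W] [Module ℝ W]
    {T : Module.End ℝ W} (L : W ≃ₗ[ℝ] W) (h : ∀ s, T (L s) = -L (T s)) :
    LinearMap.trace ℝ W T = 0 := by
  have h1 : L.conj T = -T := by
    ext s
    rw [LinearEquiv.conj_apply]
    have := h (L.symm s)
    rw [LinearEquiv.apply_symm_apply] at this
    simp [this]
  have h2 := LinearMap.trace_conj' T L
  rw [h1, map_neg] at h2
  linarith

lemma IsIrreducibleRep.comp_surjective {A B W : Type*} [Ring A] [Algebra ℝ A] [Ring B]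
    [Algebra ℝ B] [AddCommGroup W] [Module ℝ W] {ρ : A →ₐ[ℝ] Module.End ℝ W}
    (hρ : IsIrreducibleRep ρ) {f : B →ₐ[ℝ] A} (hf : Function.Surjective f) :
    IsIrreducibleRep (ρ.comp f) :=
  ⟨hρ.1, fun U hU => hρ.2 U fun a u hu => by
    obtain ⟨b, rfl⟩ := hf a
    exact hU b u hu⟩

/-- The complex structure given by a volume element has vanishing real trace. -/
lemma trace_rep_vol {V : Type*} [AddCommGroup V] [Module ℝ V] {h : QuadraticForm ℝ V} {n : ℕ}
    {W : Type*} [AddCommGroup W] [Module ℝ W] {ρ : CliffordAlgebra h →ₐ[ℝ] Module.End ℝ W}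
    (b : Module.Basis (Fin n) ℝ V) (hb : IsPseudoOrthonormal h b) (hn : Odd n)
    (hsq : vol h b * vol h b = -1) (hρ : IsIrreducibleRep ρ) :
    LinearMap.trace ℝ W (ρ (vol h b)) = 0 := by
  -- Twisting by the grading involution gives another irreducible representation, equivalent to `ρ`
  -- by uniqueness. The equivalence conjugates `ρ(ν)` to `-ρ(ν)`.
  obtain ⟨L, hL⟩ := exists_intertwiner_equiv b hb hn hsq
    (hρ.comp_surjective (f := CliffordAlgebra.involute)
      CliffordAlgebra.involute_involutive.surjective) hρ
  refine trace_eq_zero_of_anticommute L fun s => ?_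
  rw [hL, AlgHom.comp_apply, involute_vol hn, map_neg, LinearMap.neg_apply, map_neg]

/-- The coefficients of an element of the complex algebra generated by a traceless complex
structure. -/
lemma trace_coeff {W : Type*} [AddCommGroup W] [Module ℝ W] [FiniteDimensional ℝ W]
    {J : Module.End ℝ W}
    (hJ : J * J = -1) (htr : LinearMap.trace ℝ W J = 0) (r s : ℝ) :
    LinearMap.trace ℝ W (r • 1 + s • J) = r * Module.finrank ℝ W ∧
      LinearMap.trace ℝ W (J * (r • 1 + s • J)) = -(s * Module.finrank ℝ W) := by
  have h1 : J * (r • 1 + s • J) = r • J - s • 1 := by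
    rw [mul_add, mul_smul_comm, mul_smul_comm, hJ, mul_one]
    module
  rw [h1, map_add, map_sub, map_smul, map_smul, map_smul, map_smul, htr, LinearMap.trace_one]
  simp

variable {p q : ℕ} {M : Type*} [TopologicalSpace M]
  [ChartedSpace (EuclideanSpace ℝ (Fin (p + q))) M] [IsManifold (𝓡 (p + q)) ∞ M]
  {g : PseudoRiemannianMetric p q M}
  {F : Type*} [NormedAddCommGroup F] [NormedSpace ℝ F]
  {S : M → Type*} [∀ x, AddCommGroup (S x)] [∀ x, Module ℝ (S x)]
  [∀ x, TopologicalSpace (S x)] [∀ x, IsTopologicalAddGroup (S x)] [∀ x, ContinuousSMul ℝ (S x)]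
  [TopologicalSpace (TotalSpace F S)] [FiberBundle F S] [VectorBundle ℝ F S]
  (γ : ElementaryPinorStructure F S g)

/-- The Clifford representation on a fiber, with values in the linear endomorphisms. -/
def fiberRep (x : M) : g.Cl x →ₐ[ℝ] Module.End ℝ (S x) := (endHom (S x)).comp (γ.γ x)

@[simp] lemma fiberRep_apply (x : M) (a : g.Cl x) (s : S x) : fiberRep γ x a s = γ.γ x a s := rfl

lemma fiberRep_irreducible (x : M) : IsIrreducibleRep (fiberRep γ x) := γ.irreducible x

lemma endHom_injective (x : M) : Function.Injective (endHom (S x)) := fun _ _ h =>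
  ContinuousLinearMap.coe_injective h

include γ in
lemma γ_nontrivial (x : M) : Nontrivial (S x →L[ℝ] S x) := by
  have := (fiberRep_irreducible γ x).1
  refine ⟨⟨1, 0, fun h => ?_⟩⟩
  obtain ⟨s, hs⟩ := exists_ne (0 : S x)
  exact hs (by simpa using congrArg (fun T : S x →L[ℝ] S x => T s) h)

variable {γ} {x : M} {e : Fin (p + q) → TangentSpace (𝓡 (p + q)) x}
  (hpq : ((p : ℤ) - q) % 8 = 3 ∨ ((p : ℤ) - q) % 8 = 7)

section
variable (he : IsSignedFrame g x e)
include hpq he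

lemma γ_volOf_sq : γ.γ x (volOf g x e) * γ.γ x (volOf g x e) = -1 := by
  rw [← map_mul, he.volOf_sq hpq, map_neg, map_one]

lemma volOf_commute (a : g.Cl x) : Commute (volOf g x e) a := by
  have := vol_commute (odd_of_mod hpq) he.coframe_orthonormal a
  rwa [he.vol_coframe] at this

lemma trace_γ_volOf : LinearMap.trace ℝ (S x) (γ.γ x (volOf g x e) : S x →ₗ[ℝ] S x) = 0 := by
  have h2 := he.volOf_sq hpq
  rw [← he.vol_coframe] at h2
  have := trace_rep_vol he.coframe he.coframe_orthonormal (odd_of_mod hpq) h2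
    (fiberRep_irreducible γ x)
  rwa [he.vol_coframe] at this

lemma mem_schurAlgebra_iff [FiniteDimensional ℝ (S x)] {T : S x →L[ℝ] S x} : T ∈ schurAlgebra γ x ↔
    ∃ r s : ℝ, T = r • 1 + s • γ.γ x (volOf g x e) := by
  rw [schurAlgebra, Subalgebra.mem_centralizer_iff]
  constructor
  · intro hT
    have h2 := he.volOf_sq hpq
    rw [← he.vol_coframe] at h2
    obtain ⟨r, s, h3⟩ := exists_eq_of_commutes he.coframe he.coframe_orthonormal (odd_of_mod hpq) h2
      (fiberRep_irreducible γ x) (T := endHom (S x) T) (by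
        intro v
        have := congrArg (endHom (S x)) (hT _ ⟨v, rfl⟩)
        rw [map_mul, map_mul] at this
        exact this.symm)
    refine ⟨r, s, endHom_injective x ?_⟩
    rw [h3, he.vol_coframe, map_add, map_smul, map_smul, map_one]
    rfl
  · rintro ⟨r, s, rfl⟩ _ ⟨v, rfl⟩
    have h1 := (volOf_commute hpq he (CliffordAlgebra.ι (g.dualForm x) v)).map (γ.γ x)
    exact (((Commute.one_left _).smul_left r).add_left (h1.smul_left s)).eq.symm

lemma schur_linearIndependent (r s : ℝ) (h : r • (1 : S x →L[ℝ] S x) + s • γ.γ x (volOf g x e) = 0)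
    :
    r = 0 ∧ s = 0 :=
  have := γ_nontrivial γ x
  eq_zero_of_complex (γ_volOf_sq hpq he) h

lemma Cl_linearIndependent (γ : ElementaryPinorStructure F S g) (r s : ℝ)
    (h : r • (1 : g.Cl x) + s • volOf g x e = 0) : r = 0 ∧ s = 0 := by
  refine schur_linearIndependent (γ := γ) hpq he r s ?_
  have := congrArg (γ.γ x) h
  simpa using this

end

variable [FiniteDimensional ℝ F] [ContMDiffVectorBundle ∞ F S (𝓡 (p + q))]

lemma finrank_fiber (x : M) : Module.finrank ℝ (S x) = Module.finrank ℝ F :=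
  (trivFrame F S x x).finrank_eq.symm

/-- For the converse, write `σ = a + b ν` in a local frame. As `γ(ν)` is traceless with square `-1`,
the functions `a` and `b` are multiples of the traces of `γ(σ)` and `γ(ν) γ(σ)`, hence smooth. -/
lemma mem_complexOrientation_smooth_iff {σ : ∀ x, g.Cl x}
    (hpq : ((p : ℤ) - q) % 8 = 3 ∨ ((p : ℤ) - q) % 8 = 7)
    (hσ : ∀ x, σ x ∈ g.complexOrientation x) (x₀ : M) :
    g.CliffordSmoothAt x₀ σ ↔ EndSmoothAt (p := p) (q := q) F S (fun x => γ.γ x (σ x)) x₀ := by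
  refine ⟨γ.smooth σ x₀, fun h => ?_⟩
  obtain ⟨E, hE⟩ := exists_smooth_signedFrame g x₀
  have hν := volOf_smooth (g := g) hE.self_of_nhds.1
  have hJ := γ.smooth _ _ hν
  have hn : (Module.finrank ℝ F : ℝ) ≠ 0 := by
    have h1 := (fiberRep_irreducible γ x₀).1
    have h2 := fiber_finiteDimensional F S x₀
    rw [← finrank_fiber (F := F) (S := S) x₀]
    exact Nat.cast_ne_zero.2 Module.finrank_pos.ne'
  let a : M → ℝ := fun x => (Module.finrank ℝ F : ℝ)⁻¹ *
    LinearMap.trace ℝ (S x) (γ.γ x (σ x) : S x →ₗ[ℝ] S x)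
  let b : M → ℝ := fun x => -(Module.finrank ℝ F : ℝ)⁻¹ *
    LinearMap.trace ℝ (S x) ((γ.γ x (volOf g x fun i => E i x) * γ.γ x (σ x) : S x →L[ℝ] S x)
      : S x →ₗ[ℝ] S x)
  have ha : ContMDiffAt (𝓡 (p + q)) 𝓘(ℝ) ∞ a x₀ := contMDiffAt_const.mul h.trace
  have hb : ContMDiffAt (𝓡 (p + q)) 𝓘(ℝ) ∞ b x₀ := contMDiffAt_const.mul (hJ.mul h).trace
  refine .congr _ _ ?_ (.add _ _ (.function a ha) (.mul _ _ (.function b hb) hν))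
  filter_upwards [hE] with x hx
  obtain ⟨r, s, hrs⟩ := hx.2.mem_complexOrientation.1 (hσ x)
  have hJJ : fiberRep γ x (volOf g x fun i => E i x) * fiberRep γ x (volOf g x fun i => E i x) =
      -1 := by
    rw [← map_mul, hx.2.volOf_sq hpq, map_neg, map_one]
  have := fiber_finiteDimensional F S x
  obtain ⟨h1, h2⟩ := trace_coeff hJJ (trace_γ_volOf hpq hx.2) r s
  have h3 : fiberRep γ x (σ x) = r • 1 + s • fiberRep γ x (volOf g x fun i => E i x) := by
    rw [hrs, map_add, map_smul, map_smul, map_one]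
  rw [← h3, finrank_fiber (F := F)] at h1 h2
  have h4 : a x = r := by
    change (Module.finrank ℝ F : ℝ)⁻¹ * LinearMap.trace ℝ (S x) (fiberRep γ x (σ x)) = r
    rw [h1]; field_simp
  have h5 : b x = s := by
    change -(Module.finrank ℝ F : ℝ)⁻¹ * LinearMap.trace ℝ (S x) (fiberRep γ x _ * fiberRep γ x
      (σ x)) = s
    rw [h2]; field_simp
  rw [h4, h5, hrs, Algebra.algebraMap_eq_smul_one, Algebra.algebraMap_eq_smul_one, smul_mul_assoc,
    one_mul]

include hpq in
theorem restrictsToIsomorphism : RestrictsToIsomorphism γ where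
  mul_mem x a ha b hb := by
    obtain ⟨E, hE⟩ := exists_smooth_signedFrame g x
    have he := hE.self_of_nhds.2
    obtain ⟨r, s, rfl⟩ := he.mem_complexOrientation.1 ha
    obtain ⟨r', s', rfl⟩ := he.mem_complexOrientation.1 hb
    refine he.mem_complexOrientation.2 ⟨r * r' - s * s', r * s' + s * r', ?_⟩
    simp only [mul_add, add_mul, smul_mul_smul_comm, one_mul, mul_one, he.volOf_sq hpq]
    module
  source_frames x₀ := by
    obtain ⟨E, hE⟩ := exists_smooth_signedFrame g x₀
    refine ⟨fun i x => ![1, volOf g x fun i => E i x] i, ?_⟩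
    filter_upwards [hE] with x hx
    refine ⟨fun i => ?_, ?_, ?_⟩
    · fin_cases i
      · simpa using PseudoRiemannianMetric.CliffordSmoothAt.function (g := g) (x₀ := x)
          (fun _ => 1) contMDiffAt_const
      · exact volOf_smooth hx.1
    · refine LinearIndependent.pair_iff.2 fun r s h => ?_
      exact Cl_linearIndependent hpq hx.2 γ r s h
    · rw [hx.2.complexOrientation_eq]
      congr 1
      ext a
      simp [or_comm]
  target_frames x₀ := by
    obtain ⟨E, hE⟩ := exists_smooth_signedFrame g x₀
    refine ⟨fun i x => ![1, γ.γ x (volOf g x fun i => E i x)] i, ?_⟩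
    filter_upwards [hE] with x hx
    have := fiber_finiteDimensional F S x
    refine ⟨fun i => ?_, ?_, ?_⟩
    · fin_cases i
      · exact endSmoothAt_one
      · exact γ.smooth _ _ (volOf_smooth hx.1)
    · refine LinearIndependent.pair_iff.2 fun r s h => ?_
      exact schur_linearIndependent hpq hx.2 r s h
    · have h1 : (Set.range fun i => (![1, γ.γ x (volOf g x fun i => E i x)] : Fin 2 → S x →L[ℝ]
        S x) i) =
          {1, γ.γ x (volOf g x fun i => E i x)} := by
        ext a
        simp [or_comm]
      rw [h1]
      ext T
      rw [Submodule.mem_span_pair, Subalgebra.mem_toSubmodule, mem_schurAlgebra_iff hpq hx.2]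
      exact ⟨fun ⟨r, s, h⟩ => ⟨r, s, h.symm⟩, fun ⟨r, s, h⟩ => ⟨r, s, h.symm⟩⟩
  bijOn x := by
    obtain ⟨E, hE⟩ := exists_smooth_signedFrame g x
    have he := hE.self_of_nhds.2
    have := fiber_finiteDimensional F S x
    refine ⟨fun a ha => ?_, fun a ha b hb hab => ?_, fun T hT => ?_⟩
    · obtain ⟨r, s, rfl⟩ := he.mem_complexOrientation.1 ha
      exact (mem_schurAlgebra_iff hpq he).2 ⟨r, s, by simp⟩
    · obtain ⟨r, s, rfl⟩ := he.mem_complexOrientation.1 ha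
      obtain ⟨r', s', rfl⟩ := he.mem_complexOrientation.1 hb
      simp only [map_add, map_smul, map_one] at hab
      obtain ⟨h1, h2⟩ := schur_linearIndependent (γ := γ) hpq he (r - r') (s - s') (by
        rw [← sub_eq_zero] at hab
        rw [← hab]; module)
      rw [sub_eq_zero.1 h1, sub_eq_zero.1 h2]
    · obtain ⟨r, s, rfl⟩ := (mem_schurAlgebra_iff hpq he).1 hT
      exact ⟨_, he.mem_complexOrientation.2 ⟨r, s, rfl⟩, by simp⟩
  smooth_iff σ hσ x₀ := mem_complexOrientation_smooth_iff hpq hσ x₀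

end Schur
end PinorGeom
end

noncomputable section
namespace PinorGeom

set_option linter.unusedSectionVars false

/-! ### Smooth local adapted frames of the pinor bundle -/

section AdaptedFrames

lemma quad_eq_weightedSum {V : Type*} [AddCommGroup V] [Module ℝ V] {h : QuadraticForm ℝ V} {n : ℕ}
    (b : Module.Basis (Fin n) ℝ V) (hb : ∀ i j, i ≠ j → QuadraticMap.polar h (b i) (b j) = 0)
      (v : V) :
    h v = QuadraticMap.weightedSumSquares ℝ (fun i => h (b i)) (b.equivFun v) := by
  rw [← QuadraticMap.basisRepr_eq_of_iIsOrtho h b, QuadraticMap.basisRepr_apply, b.sum_equivFun]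
  intro i j hij
  change QuadraticMap.associated h (b i) (b j) = 0
  rw [QuadraticMap.associated_apply]
  have := hb i j hij
  rw [QuadraticMap.polar] at this
  rw [this, smul_zero]

/-- The isometry which identifies two orthogonal bases with the same squares. -/
def isometryOfBases {V W : Type*} [AddCommGroup V] [Module ℝ V] [AddCommGroup W] [Module ℝ W]
    {h : QuadraticForm ℝ V} {k : QuadraticForm ℝ W} {n : ℕ}
    (b : Module.Basis (Fin n) ℝ V) (hb : ∀ i j, i ≠ j → QuadraticMap.polar h (b i) (b j) = 0)
    (c : Module.Basis (Fin n) ℝ W) (hc : ∀ i j, i ≠ j → QuadraticMap.polar k (c i) (c j) = 0)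
    (hbc : ∀ i, h (b i) = k (c i)) : h.IsometryEquiv k :=
  { b.equiv c (Equiv.refl _) with
    map_app' := fun v => by
      change k (b.equiv c (Equiv.refl _) v) = h v
      rw [quad_eq_weightedSum b hb, quad_eq_weightedSum c hc]
      have h1 : c.equivFun (b.equiv c (Equiv.refl _) v) = b.equivFun v := by
        ext i
        simp [Module.Basis.equiv]
      rw [h1]
      simp only [hbc] }

lemma isometryOfBases_apply {V W : Type*} [AddCommGroup V] [Module ℝ V] [AddCommGroup W]
    [Module ℝ W]
    {h : QuadraticForm ℝ V} {k : QuadraticForm ℝ W} {n : ℕ}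
    (b : Module.Basis (Fin n) ℝ V) (hb : ∀ i j, i ≠ j → QuadraticMap.polar h (b i) (b j) = 0)
    (c : Module.Basis (Fin n) ℝ W) (hc : ∀ i j, i ≠ j → QuadraticMap.polar k (c i) (c j) = 0)
    (hbc : ∀ i, h (b i) = k (c i)) (i : Fin n) : isometryOfBases b hb c hc hbc (b i) = c i :=
  (b.equiv_apply i c (Equiv.refl _))

variable {p q : ℕ} {M : Type*} [TopologicalSpace M]
  [ChartedSpace (EuclideanSpace ℝ (Fin (p + q))) M] [IsManifold (𝓡 (p + q)) ∞ M]
  {g : PseudoRiemannianMetric p q M}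
  {F : Type*} [NormedAddCommGroup F] [NormedSpace ℝ F]
  {S : M → Type*} [∀ x, AddCommGroup (S x)] [∀ x, Module ℝ (S x)]
  [∀ x, TopologicalSpace (S x)] [∀ x, IsTopologicalAddGroup (S x)] [∀ x, ContinuousSMul ℝ (S x)]
  [TopologicalSpace (TotalSpace F S)] [FiberBundle F S] [VectorBundle ℝ F S]
  (γ : ElementaryPinorStructure F S g)
  {V : Type*} [AddCommGroup V] [Module ℝ V] {h : QuadraticForm ℝ V}
  {S₀ : Type*} [AddCommGroup S₀] [Module ℝ S₀]
  (γ₀ : CliffordAlgebra h →ₐ[ℝ] Module.End ℝ S₀)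

/-- A frame `S₀ ≃ S_x` is adapted if it intertwines Clifford multiplications up to an isometry
`V ≃ T*_x M`. -/
def IsAdaptedFrame (x : M) (f : S₀ ≃ₗ[ℝ] S x) : Prop :=
  ∃ φ : h.IsometryEquiv (g.dualForm x), ∀ v s,
    f (γ₀ (CliffordAlgebra.ι h v) s) = γ.γ x (CliffordAlgebra.ι (g.dualForm x) (φ v)) (f s)

/-- The pull back of Clifford multiplication on a fiber by an isometry `V ≃ T*_x M`. -/
def pullRep {x : M} (φ : h.IsometryEquiv (g.dualForm x)) :
    CliffordAlgebra h →ₐ[ℝ] Module.End ℝ (S x) :=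
  (fiberRep γ x).comp (CliffordAlgebra.equivOfIsometry φ).toAlgHom

lemma pullRep_ι {x : M} (φ : h.IsometryEquiv (g.dualForm x)) (v : V) (s : S x) :
    pullRep γ φ (CliffordAlgebra.ι h v) s = γ.γ x (CliffordAlgebra.ι (g.dualForm x) (φ v)) s := by
  simp only [pullRep, AlgHom.comp_apply, fiberRep_apply]
  congr 2
  exact CliffordAlgebra.map_apply_ι _ _

lemma pullRep_irreducible {x : M} (φ : h.IsometryEquiv (g.dualForm x)) :
    IsIrreducibleRep (pullRep γ φ) :=
  (fiberRep_irreducible γ x).comp_surjective (CliffordAlgebra.equivOfIsometry φ).surjective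

/-- The successive averages of a linear map `S₀ → S_x` over the vectors `b i` of a basis of `V` and
`E i` of a tangent frame, which make it an intertwiner. -/
def frameAvg (b : Fin (p + q) → V) (E : Fin (p + q) → ∀ x : M, TangentSpace (𝓡 (p + q)) x)
    (L : ∀ x, S₀ →ₗ[ℝ] S x) (x : M) : List (Fin (p + q)) → (S₀ →ₗ[ℝ] S x)
  | [] => L x
  | i :: l => (1 / 2 : ℝ) • (frameAvg b E L x l + signs p q i •
      (fiberRep γ x (CliffordAlgebra.ι (g.dualForm x) (g.flat x (E i x))) ∘ₗ
        frameAvg b E L x l ∘ₗ γ₀ (CliffordAlgebra.ι h (b i))))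

variable {γ γ₀}

variable [FiniteDimensional ℝ F] [ContMDiffVectorBundle ∞ F S (𝓡 (p + q))]

lemma frameAvg_smooth {b : Fin (p + q) → V} {E : Fin (p + q) → ∀ x : M, TangentSpace (𝓡 (p + q)) x}
    {L : ∀ x, S₀ →ₗ[ℝ] S x} {x₀ : M} (hE : ∀ i, VectorSmoothAt p q M (E i) x₀)
    (hL : ∀ s, SectionSmoothAt (p := p) (q := q) F S (fun x => L x s) x₀)
    (l : List (Fin (p + q))) (s : S₀) :
    SectionSmoothAt (p := p) (q := q) F S (fun x => frameAvg γ γ₀ b E L x l s) x₀ := by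
  induction l generalizing s with
  | nil => exact hL s
  | cons i l ih =>
    have h1 := γ.smooth _ _ (PseudoRiemannianMetric.CliffordSmoothAt.oneForm _ (flat_smooth (g :=
        g) (hE i)))
    exact ((ih s).add ((h1.apply (ih _)).const_smul _)).const_smul _

/-- `frameAvg` is defined at every point and visibly smooth. Where `E` is signed, it becomes the
average between `γ₀` and the pulled back Clifford multiplication. -/
lemma frameAvg_eq_avgList {b : Module.Basis (Fin (p + q)) ℝ V} (hb : ∀ i, h (b i) = signs p q i)
    {E : Fin (p + q) → ∀ x : M, TangentSpace (𝓡 (p + q)) x} {L : ∀ x, S₀ →ₗ[ℝ] S x} {x : M}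
    {φ : h.IsometryEquiv (g.dualForm x)} (hφ : ∀ i, φ (b i) = g.flat x (E i x))
    (l : List (Fin (p + q))) :
    frameAvg γ γ₀ b E L x l = avgList γ₀ (pullRep γ φ) (l.map b) (L x) := by
  induction l with
  | nil => rfl
  | cons i l ih =>
    ext s
    change _ = avg γ₀ (pullRep γ φ) (b i) (avgList γ₀ (pullRep γ φ) (l.map b) (L x)) s
    rw [avg_apply, ← ih, pullRep_ι, hφ, hb]
    rfl

/-- A pinor bundle has smooth local adapted frames. -/
lemma exists_smooth_adaptedFrame [FiniteDimensional ℝ S₀]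
    (hpq : ((p : ℤ) - q) % 8 = 3 ∨ ((p : ℤ) - q) % 8 = 7)
    (hsig : HasSignature h p q) (hγ₀ : IsIrreducibleRep γ₀) (x₀ : M) :
    ∃ f : ∀ x, S₀ ≃ₗ[ℝ] S x, ∀ᶠ x in nhds x₀,
      FrameSmoothAt p q F S f x ∧ IsAdaptedFrame γ γ₀ x (f x) := by
  obtain ⟨b, hb, hb'⟩ := hsig.exists_basis
  obtain ⟨E, hE⟩ := exists_smooth_signedFrame g x₀
  let φ : ∀ x, (IsSignedFrame g x fun i => E i x) → h.IsometryEquiv (g.dualForm x) := fun x he =>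
    isometryOfBases b hb he.coframe (fun i j hij => by
      rw [he.coframe_apply, he.coframe_apply]; exact he.orth i j hij) (fun i => by
      rw [he.coframe_apply, hb', he.unit])
  have hφ : ∀ x he i, φ x he (b i) = g.flat x (E i x) := fun x he i => by
    rw [← he.coframe_apply]; exact isometryOfBases_apply ..
  have hon := isPseudoOrthonormal_of_signs hb hb'
  -- Uniqueness of the irreducible representation gives an adapted frame at `x₀`, which the
  -- trivialization carries to nearby points. Averaging makes it an intertwiner there and leaves it
  -- unchanged at `x₀`, so it stays invertible nearby.
  obtain ⟨f₀, hf₀⟩ := exists_intertwiner_equiv b hon (odd_of_mod hpq) (vol_sq_of_signs hpq hb hb')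
    hγ₀ (pullRep_irreducible γ (φ x₀ hE.self_of_nhds.2))
  let T : ∀ x, F ≃ₗ[ℝ] S x := trivFrame F S x₀
  let L : ∀ x, S₀ ≃ₗ[ℝ] S x := fun x => f₀.trans ((T x₀).symm.trans (T x))
  have hL : ∀ᶠ x in nhds x₀, FrameSmoothAt p q F S L x := by
    filter_upwards [trivFrame_smooth (p := p) (q := q) (F := F) (S := S) x₀] with x hx s
    exact hx _
  let A : ∀ x, S₀ →ₗ[ℝ] S x := fun x =>
    frameAvg γ γ₀ b E (fun x => (L x).toLinearMap) x (List.finRange (p + q))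
  have hA : ∀ᶠ x in nhds x₀, ∀ s, SectionSmoothAt (p := p) (q := q) F S (fun y => A y s) x := by
    filter_upwards [hE, hL] with x h1 h2 s
    exact frameAvg_smooth h1.1 h2 _ s
  have hu : ∀ v ∈ (List.finRange (p + q)).map b, h v * h v = 1 := by
    intro v hv
    obtain ⟨i, -, rfl⟩ := List.mem_map.1 hv
    exact hon.unit_sq i
  have hl : ∀ v ∈ (List.finRange (p + q)).map b, ∀ w ∈ (List.finRange (p + q)).map b, v ≠ w →
      QuadraticMap.polar h v w = 0 := by
    intro v hv w hw hvw
    obtain ⟨i, -, rfl⟩ := List.mem_map.1 hv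
    obtain ⟨j, -, rfl⟩ := List.mem_map.1 hw
    exact hb i j fun hij => hvw (by rw [hij])
  have hAx : A x₀ = (L x₀).toLinearMap := by
    refine (frameAvg_eq_avgList hb' (hφ x₀ hE.self_of_nhds.2) _).trans ?_
    refine avgList_eq_self _ hu _ fun v _ s => ?_
    simpa [L] using hf₀ (CliffordAlgebra.ι h v) s
  let d : M → ℝ := fun x => LinearMap.det ((L x).symm.toLinearMap ∘ₗ A x)
  have hd₀ : d x₀ = 1 := by
    simp only [d, hAx]
    simp
  have hd : ∀ᶠ x in nhds x₀, d x ≠ 0 :=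
    (det_coord_smooth hL.self_of_nhds hA.self_of_nhds).continuousAt.eventually_ne
      (by change d x₀ ≠ 0; rw [hd₀]; exact one_ne_zero)
  classical
  let f : ∀ x, S₀ ≃ₗ[ℝ] S x := fun x => if hx : d x ≠ 0 then
    (LinearMap.equivOfDetNeZero _ hx).trans (L x) else L x
  have hf : ∀ x, d x ≠ 0 → ∀ s, f x s = A x s := by
    intro x hx s
    simp only [f, dif_pos hx]
    simp [LinearMap.equivOfDetNeZero]
  refine ⟨f, ?_⟩
  filter_upwards [hE, hA, eventually_eventually_nhds.2 hd] with x h1 h2 h3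
  refine ⟨fun s => (h2 s).congr (h3.mono fun y hy => hf y hy s), φ x h1.2, fun v s => ?_⟩
  have h4 : A x = avgList γ₀ (pullRep γ (φ x h1.2)) ((List.finRange (p + q)).map b)
      (L x).toLinearMap :=
    frameAvg_eq_avgList hb' (hφ x h1.2) _
  have h5 := intertwines_of_basis (γ₁ := γ₀) (γ₂ := pullRep γ (φ x h1.2)) b (L := A x)
      (fun i s => by
    rw [h4]
    exact avgList_comm _ hu hl _ _ (List.mem_map.2 ⟨i, List.mem_finRange i, rfl⟩) s)
  rw [hf x h3.self_of_nhds, hf x h3.self_of_nhds, ← pullRep_ι, h5]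

end AdaptedFrames
end PinorGeom
end

/-! ### Densities and the existence of an adapted `Spin^o` structure -/

noncomputable section
namespace PinorGeom

set_option linter.unusedSectionVars false

/-- A connected, paracompact, locally compact space is σ-compact. -/
lemma sigmaCompactSpace_of_paracompact (X : Type*) [TopologicalSpace X] [ConnectedSpace X]
    [ParacompactSpace X] [WeaklyLocallyCompactSpace X] : SigmaCompactSpace X := by
  choose K hK hKx using fun x : X => exists_compact_mem_nhds x
  obtain ⟨v, hvo, hvc, hvf, hvK⟩ := precise_refinement (fun x => interior (K x))
    (fun x => isOpen_interior)
    (Set.eq_univ_of_forall fun x => Set.mem_iUnion.2 ⟨x, mem_interior_iff_mem_nhds.2 (hKx x)⟩)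
  obtain ⟨x₀⟩ := (inferInstance : Nonempty X)
  -- Each stage gathers the compact sets `K i` whose `v i` meets the previous stage, finitely many
  -- by local finiteness. The union of the stages is open and closed.
  let C : ℕ → Set X := fun n => Nat.rec {x₀} (fun _ A => ⋃ i ∈ {i | (v i ∩ A).Nonempty}, K i) n
  have hCs : ∀ n, C (n + 1) = ⋃ i ∈ {i | (v i ∩ C n).Nonempty}, K i := fun n => rfl
  have hC : ∀ n, IsCompact (C n) := by
    intro n
    induction n with
    | zero => exact isCompact_singleton
    | succ n ih =>
      rw [hCs]
      exact (hvf.finite_nonempty_inter_compact ih).isCompact_biUnion fun i _ => hK i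
  have hv : ∀ y, ∃ i, y ∈ v i := fun y => Set.mem_iUnion.1 (hvc ▸ Set.mem_univ y)
  have hstep : ∀ i n, (v i ∩ C n).Nonempty → v i ⊆ C (n + 1) := by
    intro i n hin y hy
    rw [hCs]
    exact Set.mem_biUnion hin (interior_subset (hvK i hy))
  have hopen : IsOpen (⋃ n, C n) := by
    refine isOpen_iff_mem_nhds.2 fun y hy => ?_
    obtain ⟨n, hn⟩ := Set.mem_iUnion.1 hy
    obtain ⟨i, hi⟩ := hv y
    exact Filter.mem_of_superset ((hvo i).mem_nhds hi)
      ((hstep i n ⟨y, hi, hn⟩).trans (Set.subset_iUnion C (n + 1)))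
  have hclosed : IsClosed (⋃ n, C n) := by
    refine ⟨isOpen_iff_mem_nhds.2 fun y hy => ?_⟩
    obtain ⟨i, hi⟩ := hv y
    refine Filter.mem_of_superset ((hvo i).mem_nhds hi) fun z hz hz' => hy ?_
    obtain ⟨n, hn⟩ := Set.mem_iUnion.1 hz'
    exact Set.mem_iUnion.2 ⟨n + 1, hstep i n ⟨z, hz, hn⟩ hi⟩
  exact ⟨⟨C, hC, IsClopen.eq_univ ⟨hclosed, hopen⟩ ⟨x₀, Set.mem_iUnion.2 ⟨0, rfl⟩⟩⟩⟩

section SpinOStructure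

variable {p q : ℕ} {M : Type*} [TopologicalSpace M]
  [ChartedSpace (EuclideanSpace ℝ (Fin (p + q))) M] [IsManifold (𝓡 (p + q)) ∞ M]
  {g : PseudoRiemannianMetric p q M}
  {F : Type*} [NormedAddCommGroup F] [NormedSpace ℝ F]
  {S : M → Type*} [∀ x, AddCommGroup (S x)] [∀ x, Module ℝ (S x)]
  [∀ x, TopologicalSpace (S x)]
  [TopologicalSpace (TotalSpace F S)] [FiberBundle F S] [VectorBundle ℝ F S]
  {S₀ : Type*} [AddCommGroup S₀] [Module ℝ S₀] [FiniteDimensional ℝ S₀]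
  [FiniteDimensional ℝ F] [ContMDiffVectorBundle ∞ F S (𝓡 (p + q))]

variable (p q F S) in
/-- A vector bundle over a connected paracompact manifold has a smooth positive density. -/
lemma exists_smooth_density [T2Space M] [ConnectedSpace M] [ParacompactSpace M] (e : S₀ ≃ₗ[ℝ] F) :
    ∃ r : ∀ x, (S₀ ≃ₗ[ℝ] S x) → ℝ, (∀ x f, 0 < r x f) ∧
      (∀ x (f f' : S₀ ≃ₗ[ℝ] S x) (A : Module.End ℝ S₀), (∀ s, f' s = f (A s)) →
        r x f' = r x f * LinearMap.det A ^ 2) ∧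
      ∀ (f : ∀ x, S₀ ≃ₗ[ℝ] S x) x₀, FrameSmoothAt p q F S f x₀ →
        ContMDiffAt (𝓡 (p + q)) 𝓘(ℝ) ∞ (fun x => r x (f x)) x₀ := by
  have : LocallyCompactSpace M := Manifold.locallyCompact_of_finiteDimensional (𝓡 (p + q))
  have : SigmaCompactSpace M := sigmaCompactSpace_of_paracompact M
  choose U hU hUo hUx using fun i : M =>
    eventually_nhds_iff.1 (trivFrame_smooth (p := p) (q := q) (F := F) (S := S) i)
  obtain ⟨ρ, hρ⟩ := SmoothPartitionOfUnity.exists_isSubordinate (𝓡 (p + q)) (s := Set.univ)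
    isClosed_univ U hUo fun x _ => Set.mem_iUnion.2 ⟨x, hUx x⟩
  -- The squared determinant in a local trivialization is positive and scales by `det A ^ 2` under a
  -- change of frame. Both properties survive a partition of unity.
  let d : M → ∀ x, (S₀ ≃ₗ[ℝ] S x) → ℝ := fun i x f =>
    LinearMap.det ((e.trans (trivFrame F S i x)).symm.toLinearMap ∘ₗ f.toLinearMap) ^ 2
  have hd : ∀ i x f, 0 < d i x f := by
    intro i x f
    refine sq_pos_of_ne_zero ?_
    exact (LinearEquiv.isUnit_det' (f.trans (e.trans (trivFrame F S i x)).symm)).ne_zero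
  refine ⟨fun x f => ∑ᶠ i, ρ i x • d i x f, fun x f => ?_, fun x f f' A hA => ?_, fun f x₀ hf => ?_⟩
  · change 0 < ∑ᶠ i, ρ i x • d i x f
    rw [← ρ.sum_finsupport_smul_eq_finsum x (fun i y => d i x f)]
    obtain ⟨i, hi⟩ := ρ.exists_pos_of_mem (Set.mem_univ x)
    refine Finset.sum_pos' (fun j _ => mul_nonneg (ρ.nonneg j x) (hd j x f).le) ⟨i, ?_, mul_pos hi
      (hd i x f)⟩
    exact (ρ.mem_finsupport x).2 hi.ne'
  · change ∑ᶠ i, ρ i x • d i x f' = (∑ᶠ i, ρ i x • d i x f) * _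
    rw [finsum_mul]
    refine finsum_congr fun i => ?_
    have h1 : f'.toLinearMap = f.toLinearMap ∘ₗ A := LinearMap.ext hA
    simp only [d, smul_eq_mul]
    rw [h1, ← LinearMap.comp_assoc, LinearMap.det_comp]
    ring
  · refine ρ.contMDiffAt_finsum fun i hi => ?_
    refine ContMDiffAt.pow ?_ 2
    exact det_coord_smooth (f := fun x => e.trans (trivFrame F S i x))
      (fun s => hU i x₀ (hρ i hi) _) hf

variable [∀ x, IsTopologicalAddGroup (S x)] [∀ x, ContinuousSMul ℝ (S x)]
  {γ : ElementaryPinorStructure F S g}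
  {V : Type*} [AddCommGroup V] [Module ℝ V] {h : QuadraticForm ℝ V}
  {γ₀ : CliffordAlgebra h →ₐ[ℝ] Module.End ℝ S₀}
  {γ₂ : CliffordTwo (alpha p q) →ₐ[ℝ] Module.End ℝ S₀}

lemma IsAdaptedFrame.comp {x : M} {f f' : S₀ ≃ₗ[ℝ] S x} (hf : IsAdaptedFrame γ γ₀ x f)
    {A : Module.End ℝ S₀} (hA : ∀ s, f' s = f (A s)) {R : h.IsometryEquiv h}
    (hR : ∀ v, A * γ₀ (CliffordAlgebra.ι h v) = γ₀ (CliffordAlgebra.ι h (R v)) * A) :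
    IsAdaptedFrame γ γ₀ x f' := by
  obtain ⟨φ, hφ⟩ := hf
  refine ⟨R.trans φ, fun v s => ?_⟩
  rw [hA, hA]
  have := congrArg (fun T : Module.End ℝ S₀ => T s) (hR v)
  simp only [Module.End.mul_apply] at this
  rw [this, hφ]
  rfl

/-- Two adapted frames of the same fiber differ by an automorphism covering an isometry. -/
lemma IsAdaptedFrame.exists_transition {x : M} {f f' : S₀ ≃ₗ[ℝ] S x}
    (hf : IsAdaptedFrame γ γ₀ x f) (hf' : IsAdaptedFrame γ γ₀ x f') :
    ∃ R : h.IsometryEquiv h, ∀ v,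
      (f'.trans f.symm).toLinearMap * γ₀ (CliffordAlgebra.ι h v) =
        γ₀ (CliffordAlgebra.ι h (R v)) * (f'.trans f.symm).toLinearMap := by
  obtain ⟨φ, hφ⟩ := hf
  obtain ⟨φ', hφ'⟩ := hf'
  refine ⟨φ'.trans φ.symm, fun v => LinearMap.ext fun s => ?_⟩
  change f.symm (f' (γ₀ _ s)) = γ₀ (CliffordAlgebra.ι h (φ.symm (φ' v))) (f.symm (f' s))
  rw [LinearEquiv.symm_apply_eq, hφ, hφ', LinearEquiv.apply_symm_apply]
  congr 3
  exact (φ.toLinearEquiv.apply_symm_apply (φ' v)).symm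

/-- Normalised adapted frames form an adapted `Spin^o` structure. -/
theorem exists_isAdaptedSpinO [T2Space M] [ConnectedSpace M] [ParacompactSpace M]
    (hpq : ((p : ℤ) - q) % 8 = 3 ∨ ((p : ℤ) - q) % 8 = 7) (hsig : HasSignature h p q)
    (hγ₀ : IsIrreducibleRep γ₀) (hc : IsCompatible h (alpha p q) γ₀ γ₂) :
    ∃ Q : ∀ x, Set (S₀ ≃ₗ[ℝ] S x), IsAdaptedSpinO γ h γ₀ γ₂ hc Q := by
  obtain ⟨b, hm⟩ := exists_isPinorModel hpq hsig hγ₀ hc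
  obtain ⟨x₁⟩ := (inferInstance : Nonempty M)
  obtain ⟨f₁, -⟩ := exists_smooth_adaptedFrame (γ := γ) hpq hsig hγ₀ x₁
  obtain ⟨r, hr, hrA, hrs⟩ := exists_smooth_density p q F S ((f₁ x₁).trans
    (trivFrame F S x₁ x₁).symm)
  have := hγ₀.1
  have hn : (Module.finrank ℝ S₀ : ℝ) ≠ 0 := Nat.cast_ne_zero.2 Module.finrank_pos.ne'
  -- Adapted frames may still be rescaled. Unit density restricts transitions to determinant `±1`,
  -- which is exactly the image of `Spin^o`.
  refine ⟨fun x => {f | IsAdaptedFrame γ γ₀ x f ∧ r x f = 1}, ⟨⟨fun x f hf f' => ?_, fun x₀ => ?_⟩,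
    fun x f hf => hf.1⟩⟩
  · constructor
    · intro hf'
      obtain ⟨R, hR⟩ := hf.1.exists_transition hf'.1
      have hA : ∀ s, f' s = f ((f'.trans f.symm).toLinearMap s) := fun s => by simp
      have hdet := hrA x f f' _ hA
      rw [hf.2, hf'.2, one_mul] at hdet
      obtain ⟨k, hk⟩ := hm.exists_rep_eq hc R hR hdet.symm
      refine ⟨k, ⟨Subgroup.mem_top k, fun s => by rw [hk]; exact hA s⟩, fun k' hk' => ?_⟩
      refine hm.rep_injective hc (Units.ext (LinearMap.ext fun s => ?_))
      apply f.injective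
      rw [← hk'.2, hk, ← hA]
    · rintro ⟨k, ⟨-, hk⟩, -⟩
      obtain ⟨⟨R, hR⟩, hdet⟩ := hm.rep_covers hc k
      exact ⟨hf.1.comp hk hR, by rw [hrA x f f' _ hk, hf.2, hdet, one_mul]⟩
  · obtain ⟨f, hf⟩ := exists_smooth_adaptedFrame (γ := γ) hpq hsig hγ₀ x₀
    -- Scaling a frame by `c` multiplies its density by `c` to the power `2 dim S₀`, whence the
    -- exponent.
    let c : M → ℝ := fun x => r x (f x) ^ (-(2 * (Module.finrank ℝ S₀ : ℝ))⁻¹)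
    have hc0 : ∀ x, 0 < c x := fun x => Real.rpow_pos_of_pos (hr x (f x)) _
    have hcs : ∀ x, FrameSmoothAt p q F S f x → ContMDiffAt (𝓡 (p + q)) 𝓘(ℝ) ∞ c x := fun x hx =>
      ContDiffAt.comp_contMDiffAt (f := fun x => r x (f x))
        (g := fun t : ℝ => t ^ (-(2 * (Module.finrank ℝ S₀ : ℝ))⁻¹))
          (Real.contDiffAt_rpow_const_of_ne (hr x (f x)).ne') (hrs f x hx)
    refine ⟨fun x => (LinearEquiv.smulOfNeZero ℝ S₀ (c x) (hc0 x).ne').trans (f x), ?_⟩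
    filter_upwards [hf] with x hx
    refine ⟨⟨?_, ?_⟩, fun s => ?_⟩
    · obtain ⟨φ, hφ⟩ := hx.2
      refine ⟨φ, fun v s => ?_⟩
      simp [hφ]
    · have hA : ∀ s, (LinearEquiv.smulOfNeZero ℝ S₀ (c x) (hc0 x).ne').trans (f x) s =
          f x ((c x • (1 : Module.End ℝ S₀)) s) := fun s => rfl
      rw [hrA x (f x) _ _ hA, LinearMap.det_smul, map_one, mul_one, ← pow_mul]
      have h1 : c x ^ (Module.finrank ℝ S₀ * 2) = (r x (f x))⁻¹ := by
        rw [← Real.rpow_natCast, ← Real.rpow_mul (hr x (f x)).le, ← Real.rpow_neg_one (r x (f x))]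
        congr 1
        push_cast
        field_simp
      rw [h1, mul_inv_cancel₀ (hr x (f x)).ne']
    · have : (fun y => (LinearEquiv.smulOfNeZero ℝ S₀ (c y) (hc0 y).ne').trans (f y) s) =
          fun y => c y • f y s := by
        funext y
        simp
      rw [this]
      exact (hx.1 s).smul (hcs x hx.1)

end SpinOStructure
end PinorGeom
end

noncomputable section
namespace PinorGeom

set_option linter.unusedSectionVars false

/-! ### Complex structures in the Schur bundle and its trivializations -/

section ComplexStructure

variable {p q : ℕ} {M : Type*} [TopologicalSpace M]
  [ChartedSpace (EuclideanSpace ℝ (Fin (p + q))) M] [IsManifold (𝓡 (p + q)) ∞ M]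
  {g : PseudoRiemannianMetric p q M}
  {F : Type*} [NormedAddCommGroup F] [NormedSpace ℝ F]
  {S : M → Type*} [∀ x, AddCommGroup (S x)] [∀ x, Module ℝ (S x)]
  [∀ x, TopologicalSpace (S x)] [∀ x, IsTopologicalAddGroup (S x)] [∀ x, ContinuousSMul ℝ (S x)]
  [TopologicalSpace (TotalSpace F S)] [FiberBundle F S] [VectorBundle ℝ F S]
  (γ : ElementaryPinorStructure F S g)

/-- A smooth section of square `-1` of the Schur bundle. -/
structure IsSchurComplexStructure (J : ∀ x, S x →L[ℝ] S x) : Prop where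
  mem : ∀ x, J x ∈ schurAlgebra γ x
  sq : ∀ x, J x * J x = -1
  smooth : ∀ x, EndSmoothAt (p := p) (q := q) F S J x

variable {γ} [FiniteDimensional ℝ F] [ContMDiffVectorBundle ∞ F S (𝓡 (p + q))]
  {J T : ∀ x, S x →L[ℝ] S x} {x₀ : M}

include γ in
lemma finrank_pos_of_pinor (x : M) : 0 < Module.finrank ℝ F := by
  have h1 := (fiberRep_irreducible γ x).1
  have h2 := fiber_finiteDimensional F S x
  rw [← finrank_fiber (F := F) (S := S) x]
  exact Module.finrank_pos

include γ in
-- The trace of `T J` is minus the rank where `T = J` and plus the rank where `T = -J`. It is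
-- continuous and negative at `x₀`.
lemma eventually_eq_of_sign (hT : EndSmoothAt (p := p) (q := q) F S T x₀)
    (hJ : EndSmoothAt (p := p) (q := q) F S J x₀) (hJ2 : ∀ᶠ x in nhds x₀, J x * J x = -1)
    (hs : ∀ᶠ x in nhds x₀, T x = J x ∨ T x = -J x) (h₀ : T x₀ = J x₀) :
    ∀ᶠ x in nhds x₀, T x = J x := by
  have hn : (0 : ℝ) < Module.finrank ℝ F := Nat.cast_pos.2 (finrank_pos_of_pinor (γ := γ) x₀)
  have htr : ∀ x, J x * J x = -1 →
      LinearMap.trace ℝ (S x) ((J x * J x : S x →L[ℝ] S x) : S x →ₗ[ℝ] S x) =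
        -(Module.finrank ℝ F : ℝ) := by
    intro x hx
    have := fiber_finiteDimensional F S x
    rw [hx]
    change LinearMap.trace ℝ (S x) (-1) = _
    rw [map_neg, LinearMap.trace_one, finrank_fiber (F := F)]
  have h1 := (hT.mul hJ).trace.continuousAt
  have h2 : ∀ᶠ x in nhds x₀,
      LinearMap.trace ℝ (S x) ((T x * J x : S x →L[ℝ] S x) : S x →ₗ[ℝ] S x) < 0 := by
    refine h1.eventually (gt_mem_nhds ?_)
    change LinearMap.trace ℝ (S x₀) ((T x₀ * J x₀ : S x₀ →L[ℝ] S x₀) : S x₀ →ₗ[ℝ] S x₀) < 0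
    rw [h₀, htr x₀ hJ2.self_of_nhds]
    linarith
  filter_upwards [h2, hJ2, hs] with x h2 hJ2 hs
  rcases hs with hs | hs
  · exact hs
  · exfalso
    rw [hs, neg_mul] at h2
    change LinearMap.trace ℝ (S x) (-((J x * J x : S x →L[ℝ] S x) : S x →ₗ[ℝ] S x)) < 0 at h2
    rw [map_neg, htr x hJ2] at h2
    linarith

/-- The trace of continuous endomorphisms. -/
def opTrace (W : Type*) [AddCommGroup W] [Module ℝ W] [TopologicalSpace W]
    [IsTopologicalAddGroup W] [ContinuousConstSMul ℝ W] : (W →L[ℝ] W) →ₗ[ℝ] ℝ :=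
  LinearMap.trace ℝ W ∘ₗ (endHom W).toLinearMap

lemma opTrace_smooth (hT : EndSmoothAt (p := p) (q := q) F S T x₀) :
    ContMDiffAt (𝓡 (p + q)) 𝓘(ℝ) ∞ (fun x => opTrace (S x) (T x)) x₀ := hT.trace

variable (F) in
lemma opTrace_one (x : M) : opTrace (S x) 1 = Module.finrank ℝ F := by
  have := fiber_finiteDimensional F S x
  exact (LinearMap.trace_one ℝ (S x)).trans (by rw [finrank_fiber (F := F)])

section
variable {x : M} {e : Fin (p + q) → TangentSpace (𝓡 (p + q)) x}
  (hpq : ((p : ℤ) - q) % 8 = 3 ∨ ((p : ℤ) - q) % 8 = 7) (he : IsSignedFrame g x e)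
include hpq he

/-- The only square roots of `-1` in a fiber of the Schur bundle are given by volume elements. -/
lemma eq_or_eq_neg_of_mem_schur {A : S x →L[ℝ] S x} (hA : A ∈ schurAlgebra γ x) (hA2 : A * A = -1) :
    A = γ.γ x (volOf g x e) ∨ A = -γ.γ x (volOf g x e) := by
  have := fiber_finiteDimensional F S x
  obtain ⟨r, s, rfl⟩ := (mem_schurAlgebra_iff hpq he).1 hA
  have h1 : (r * r - s * s + 1) • (1 : S x →L[ℝ] S x) + (2 * (r * s)) • γ.γ x (volOf g x e) = 0 :=
      by
    simp only [mul_add, add_mul, smul_mul_smul_comm, one_mul, mul_one, γ_volOf_sq hpq he] at hA2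
    rw [← sub_eq_zero] at hA2
    rw [← hA2]
    module
  obtain ⟨h2, h3⟩ := schur_linearIndependent (γ := γ) hpq he _ _ h1
  have h4 : r * s = 0 := by linarith
  rcases mul_eq_zero.1 h4 with rfl | rfl
  · have h5 : s * s = 1 := by linarith
    rcases mul_self_eq_one_iff.1 h5 with rfl | rfl
    · left; module
    · right; module
  · nlinarith [mul_self_nonneg r]

lemma opTrace_volOf (γ : ElementaryPinorStructure F S g) :
    opTrace (S x) (γ.γ x (volOf g x e)) = 0 := trace_γ_volOf hpq he

/-- A traceless nonzero element of a fiber of the Schur bundle has negative square. -/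
lemma sq_of_opTrace_eq_zero {W : S x →L[ℝ] S x} (hW : W ∈ schurAlgebra γ x)
    (htr : opTrace (S x) W = 0) (hW0 : W ≠ 0) :
    0 < -(Module.finrank ℝ F : ℝ)⁻¹ * opTrace (S x) (W * W) ∧
      W * W = -(-(Module.finrank ℝ F : ℝ)⁻¹ * opTrace (S x) (W * W)) • 1 := by
  have := fiber_finiteDimensional F S x
  have hn : (0 : ℝ) < Module.finrank ℝ F := Nat.cast_pos.2 (finrank_pos_of_pinor (γ := γ) x)
  obtain ⟨r, s, hrs⟩ := (mem_schurAlgebra_iff hpq he).1 hW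
  have hr : r = 0 := by
    rw [hrs, map_add, map_smul, map_smul, opTrace_one F, opTrace_volOf hpq he, smul_zero, add_zero,
      smul_eq_mul] at htr
    exact (mul_eq_zero.1 htr).resolve_right hn.ne'
  rw [hr, zero_smul, zero_add] at hrs
  have hs : s ≠ 0 := by
    rintro rfl
    exact hW0 (by rw [hrs, zero_smul])
  have hWW : W * W = -(s * s) • 1 := by
    rw [hrs, smul_mul_smul_comm, γ_volOf_sq hpq he]
    module
  have hc : -(Module.finrank ℝ F : ℝ)⁻¹ * opTrace (S x) (W * W) = s * s := by
    rw [hWW, map_smul, opTrace_one F, smul_eq_mul]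
    field_simp
  rw [hc]
  exact ⟨mul_self_pos.2 hs, hWW⟩

end

section
variable (hpq : ((p : ℤ) - q) % 8 = 3 ∨ ((p : ℤ) - q) % 8 = 7)
include hpq

lemma IsSchurComplexStructure.mem_iff (hJ : IsSchurComplexStructure γ J) (x : M)
    {A : S x →L[ℝ] S x} : A ∈ schurAlgebra γ x ↔ ∃ r s : ℝ, A = r • 1 + s • J x := by
  obtain ⟨E, hE⟩ := exists_smooth_signedFrame g x
  have he := hE.self_of_nhds.2
  have := fiber_finiteDimensional F S x
  rw [mem_schurAlgebra_iff hpq he]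
  rcases eq_or_eq_neg_of_mem_schur hpq he (hJ.mem x) (hJ.sq x) with h | h
  · rw [h]
  · rw [h]
    constructor
    · rintro ⟨r, s, rfl⟩
      exact ⟨r, -s, by module⟩
    · rintro ⟨r, s, rfl⟩
      exact ⟨r, -s, by module⟩

lemma IsSchurComplexStructure.trivialAlgebra (hJ : IsSchurComplexStructure γ J) :
    SchurTrivialAlgebraBundle γ := by
  have hφ : ∀ x, ∃ φ : ℂ ≃ₐ[ℝ] schurAlgebra γ x,
      ∀ z : ℂ, (φ z : S x →L[ℝ] S x) = z.re • 1 + z.im • J x := by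
    intro x
    have hnt := γ_nontrivial γ x
    let j : schurAlgebra γ x := ⟨J x, hJ.mem x⟩
    have hj : j * j = -1 := Subtype.ext (hJ.sq x)
    let φ : ℂ →ₐ[ℝ] schurAlgebra γ x := Complex.lift ⟨j, hj⟩
    have h1 : ∀ z : ℂ, (φ z : S x →L[ℝ] S x) = z.re • 1 + z.im • J x := by
      intro z
      have h2 : φ z = algebraMap ℝ _ z.re + z.im • j := Complex.liftAux_apply j hj z
      rw [h2, Algebra.algebraMap_eq_smul_one]
      rfl
    refine ⟨AlgEquiv.ofBijective φ ⟨?_, ?_⟩, h1⟩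
    · have : Nontrivial (schurAlgebra γ x) := ⟨⟨1, 0, fun h => one_ne_zero
        (congrArg Subtype.val h)⟩⟩
      exact φ.toRingHom.injective
    · rintro ⟨A, hA⟩
      obtain ⟨r, s, rfl⟩ := (hJ.mem_iff hpq x).1 hA
      exact ⟨⟨r, s⟩, Subtype.ext (h1 _)⟩
  choose φ hφ using hφ
  refine ⟨φ, fun z x₀ => ?_⟩
  simp only [hφ]
  exact (endSmoothAt_one.smul contMDiffAt_const).add ((hJ.smooth x₀).smul contMDiffAt_const)

omit hpq [FiniteDimensional ℝ F] [ContMDiffVectorBundle ∞ F S (𝓡 (p + q))] in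
lemma exists_complexStructure_of_trivialAlgebra (h : SchurTrivialAlgebraBundle γ) :
    ∃ J, IsSchurComplexStructure γ J := by
  obtain ⟨φ, hφ⟩ := h
  refine ⟨fun x => (φ x Complex.I : S x →L[ℝ] S x), fun x => (φ x Complex.I).2, fun x => ?_,
    hφ Complex.I⟩
  have h1 : φ x Complex.I * φ x Complex.I = -1 := by
    rw [← map_mul, Complex.I_mul_I, map_neg, map_one]
  exact congrArg Subtype.val h1

lemma IsSchurComplexStructure.trivialVector (hJ : IsSchurComplexStructure γ J) :
    SchurTrivialVectorBundle γ := by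
  refine ⟨fun i x => ![1, J x] i, fun i x => ?_, fun x => ⟨?_, ?_⟩⟩
  · fin_cases i
    · exact endSmoothAt_one
    · exact hJ.smooth x
  · have := γ_nontrivial γ x
    exact LinearIndependent.pair_iff.2 fun r s h => eq_zero_of_complex (hJ.sq x) h
  · have h1 : (Set.range fun i => (![1, J x] : Fin 2 → S x →L[ℝ] S x) i) = {1, J x} := by
      ext a
      simp [or_comm]
    rw [h1]
    ext A
    rw [Submodule.mem_span_pair, Subalgebra.mem_toSubmodule, hJ.mem_iff hpq x]
    exact ⟨fun ⟨r, s, h⟩ => ⟨r, s, h.symm⟩, fun ⟨r, s, h⟩ => ⟨r, s, h.symm⟩⟩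

omit hpq [FiniteDimensional ℝ F] [ContMDiffVectorBundle ∞ F S (𝓡 (p + q))] in
-- If the combination vanished, independence would make both `T i` traceless, and with them the
-- whole span, which contains `1`.
lemma traceless_combination_ne_zero {x : M} {T : Fin 2 → S x →L[ℝ] S x} (hT : LinearIndependent ℝ T)
    (h1 : (1 : S x →L[ℝ] S x) ∈ Submodule.span ℝ (Set.range T)) (htr : opTrace (S x) 1 ≠ 0) :
    opTrace (S x) (T 0) • T 1 - opTrace (S x) (T 1) • T 0 ≠ 0 := by
  intro h0
  have h2 := Fintype.linearIndependent_iff.1 hT ![-opTrace (S x) (T 1), opTrace (S x) (T 0)] (by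
    rw [Fin.sum_univ_two, ← h0]
    simp only [Matrix.cons_val_zero, Matrix.cons_val_one]
    module)
  have h3 : Submodule.span ℝ (Set.range T) ≤ LinearMap.ker (opTrace (S x)) := by
    rw [Submodule.span_le]
    rintro _ ⟨i, rfl⟩
    rw [SetLike.mem_coe, LinearMap.mem_ker]
    fin_cases i
    · exact h2 1
    · exact neg_eq_zero.1 (h2 0)
  exact htr (LinearMap.mem_ker.1 (h3 h1))

/-- A trivialization as a vector bundle suffices: it provides a global, nowhere zero, traceless
section `W`. Traceless elements of a fibre are multiples of `γ(ν)`, so `W² = -c` with `c > 0`, and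
`W` is divided by the square root of `c`. -/
lemma exists_complexStructure_of_trivialVector (h : SchurTrivialVectorBundle γ) :
    ∃ J, IsSchurComplexStructure γ J := by
  obtain ⟨T, hT, hT'⟩ := h
  let W : ∀ x, S x →L[ℝ] S x := fun x =>
    opTrace (S x) (T 0 x) • T 1 x - opTrace (S x) (T 1 x) • T 0 x
  let c : M → ℝ := fun x => -(Module.finrank ℝ F : ℝ)⁻¹ * opTrace (S x) (W x * W x)
  have hW : ∀ x, EndSmoothAt (p := p) (q := q) F S W x := fun x =>
    ((hT 1 x).smul (opTrace_smooth (hT 0 x))).sub ((hT 0 x).smul (opTrace_smooth (hT 1 x)))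
  have hcs : ∀ x, ContMDiffAt (𝓡 (p + q)) 𝓘(ℝ) ∞ c x := fun x =>
    contMDiffAt_const.mul (opTrace_smooth ((hW x).mul (hW x)))
  have hmem : ∀ x i, T i x ∈ schurAlgebra γ x := by
    intro x i
    have h1 : T i x ∈ Submodule.span ℝ (Set.range fun i => T i x) := Submodule.subset_span ⟨i, rfl⟩
    rwa [(hT' x).2, Subalgebra.mem_toSubmodule] at h1
  have hWmem : ∀ x, W x ∈ schurAlgebra γ x := fun x =>
    sub_mem (Subalgebra.smul_mem _ (hmem x 1) _) (Subalgebra.smul_mem _ (hmem x 0) _)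
  have key : ∀ x, 0 < c x ∧ W x * W x = -c x • 1 := by
    intro x
    obtain ⟨E, hE⟩ := exists_smooth_signedFrame g x
    refine sq_of_opTrace_eq_zero hpq hE.self_of_nhds.2 (hWmem x) ?_ ?_
    · simp only [W, map_sub, map_smul, smul_eq_mul]
      ring
    · refine traceless_combination_ne_zero (T := fun i => T i x) (hT' x).1 ?_ ?_
      · rw [(hT' x).2, Subalgebra.mem_toSubmodule]
        exact one_mem _
      · rw [opTrace_one F]
        exact Nat.cast_ne_zero.2 (finrank_pos_of_pinor (γ := γ) x).ne'
  refine ⟨fun x => (Real.sqrt (c x))⁻¹ • W x, fun x => Subalgebra.smul_mem _ (hWmem x) _,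
    fun x => ?_,
    fun x => ?_⟩
  · have h2 := Real.mul_self_sqrt (key x).1.le
    rw [smul_mul_smul_comm, (key x).2, smul_smul, ← mul_inv, h2, mul_neg,
      inv_mul_cancel₀ (key x).1.ne', neg_smul, one_smul]
  · refine (hW x).smul (ContMDiffAt.inv₀ ?_ (Real.sqrt_pos.2 (key x).1).ne')
    exact ContDiffAt.comp_contMDiffAt (Real.contDiffAt_sqrt (key x).1.ne') (hcs x)

end

end ComplexStructure
end PinorGeom
end

noncomputable section
namespace PinorGeom

set_option linter.unusedSectionVars false

/-! ### Complex structures and reductions to `Spin^c` -/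

section Reduction

variable {p q : ℕ} {M : Type*} [TopologicalSpace M]
  [ChartedSpace (EuclideanSpace ℝ (Fin (p + q))) M] [IsManifold (𝓡 (p + q)) ∞ M]
  {g : PseudoRiemannianMetric p q M}
  {F : Type*} [NormedAddCommGroup F] [NormedSpace ℝ F]
  {S : M → Type*} [∀ x, AddCommGroup (S x)] [∀ x, Module ℝ (S x)]
  [∀ x, TopologicalSpace (S x)] [∀ x, IsTopologicalAddGroup (S x)] [∀ x, ContinuousSMul ℝ (S x)]
  [TopologicalSpace (TotalSpace F S)] [FiberBundle F S] [VectorBundle ℝ F S]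
  {γ : ElementaryPinorStructure F S g}
  {V : Type*} [AddCommGroup V] [Module ℝ V] {h : QuadraticForm ℝ V}
  {S₀ : Type*} [AddCommGroup S₀] [Module ℝ S₀]
  {γ₀ : CliffordAlgebra h →ₐ[ℝ] Module.End ℝ S₀}
  {γ₂ : CliffordTwo (alpha p q) →ₐ[ℝ] Module.End ℝ S₀}

lemma IsAdaptedFrame.intertwines {n : ℕ} (b : Module.Basis (Fin n) ℝ V) {x : M} {f : S₀ ≃ₗ[ℝ] S x}
    (hf : IsAdaptedFrame γ γ₀ x f) : ∃ φ : h.IsometryEquiv (g.dualForm x), ∀ a s,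
      f (γ₀ a s) = pullRep γ φ a (f s) := by
  obtain ⟨φ, hφ⟩ := hf
  refine ⟨φ, fun a s => ?_⟩
  exact (intertwines_of_basis (γ₁ := γ₀) (γ₂ := pullRep γ φ) b (L := f.toLinearMap)
    (fun i s => (pullRep_ι γ φ (b i) (f s)).trans (hφ (b i) s).symm) a s).symm

/-- In an adapted frame the complex structure of the model is Clifford multiplication by a central
square root of `-1`. -/
lemma IsAdaptedFrame.exists_central {n : ℕ} {b : Module.Basis (Fin n) ℝ V}
    (hm : IsPinorModel h (alpha p q) γ₀ γ₂ b) {x : M} {f : S₀ ≃ₗ[ℝ] S x}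
    (hf : IsAdaptedFrame γ γ₀ x f) : ∃ u : g.Cl x, (∀ a, Commute u a) ∧ u * u = -1 ∧
      ∀ s, f (γ₀ (vol h b) s) = γ.γ x u (f s) := by
  obtain ⟨φ, hφ⟩ := hf.intertwines b
  let Φ := CliffordAlgebra.equivOfIsometry φ
  refine ⟨Φ (vol h b), fun a => ?_, ?_, fun s => hφ _ s⟩
  · have := (vol_commute hm.odd hm.orth (Φ.symm a)).map Φ
    rwa [AlgEquiv.apply_symm_apply] at this
  · rw [← map_mul, hm.vol_sq, map_neg, map_one]

lemma mem_schurAlgebra_of_commute {x : M} {u : g.Cl x} (hu : ∀ a, Commute u a) :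
    γ.γ x u ∈ schurAlgebra γ x := by
  rw [schurAlgebra, Subalgebra.mem_centralizer_iff]
  rintro _ ⟨v, rfl⟩
  exact ((hu (CliffordAlgebra.ι (g.dualForm x) v)).map (γ.γ x)).eq.symm

/-- The endomorphism of a fiber which corresponds to the complex structure of the model in a
frame of an adapted `Spin^o` structure. -/
lemma IsAdaptedFrame.exists_complexStructure {n : ℕ} {b : Module.Basis (Fin n) ℝ V}
    (hm : IsPinorModel h (alpha p q) γ₀ γ₂ b) {x : M} {f : S₀ ≃ₗ[ℝ] S x}
    (hf : IsAdaptedFrame γ γ₀ x f) : ∃ A ∈ schurAlgebra γ x, A * A = -1 ∧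
      ∀ s, f (γ₀ (vol h b) s) = A (f s) := by
  obtain ⟨u, h1, h2, h3⟩ := hf.exists_central hm
  exact ⟨γ.γ x u, mem_schurAlgebra_of_commute h1, by rw [← map_mul, h2, map_neg, map_one], h3⟩

variable [FiniteDimensional ℝ S₀] [FiniteDimensional ℝ F] [ContMDiffVectorBundle ∞ F S (𝓡 (p + q))]
  {J : ∀ x, S x →L[ℝ] S x} {hc : IsCompatible h (alpha p q) γ₀ γ₂} {Q : ∀ x, Set (S₀ ≃ₗ[ℝ] S x)}

lemma eq_or_eq_neg_of_mem_schur_pair (hpq : ((p : ℤ) - q) % 8 = 3 ∨ ((p : ℤ) - q) % 8 = 7) {x : M}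
    {A B : S x →L[ℝ] S x} (hA : A ∈ schurAlgebra γ x) (hA2 : A * A = -1)
    (hB : B ∈ schurAlgebra γ x) (hB2 : B * B = -1) : A = B ∨ A = -B := by
  obtain ⟨E, hE⟩ := exists_smooth_signedFrame g x
  have he := hE.self_of_nhds.2
  rcases eq_or_eq_neg_of_mem_schur hpq he hA hA2 with h1 | h1 <;>
    rcases eq_or_eq_neg_of_mem_schur hpq he hB hB2 with h2 | h2 <;> rw [h1, h2] <;> simp

/-- A smooth section of `-1`-square roots of the Schur bundle reduces an adapted `Spin^o` structure
to `Spin^c`. -/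
lemma IsSchurComplexStructure.reducesToSpinC
    (hpq : ((p : ℤ) - q) % 8 = 3 ∨ ((p : ℤ) - q) % 8 = 7)
    {b : Module.Basis (Fin (p + q)) ℝ V}
    (hm : IsPinorModel h (alpha p q) γ₀ γ₂ b) (hJ : IsSchurComplexStructure γ J)
    (hQ : IsAdaptedSpinO γ h γ₀ γ₂ hc Q) : ReducesToSpinC p q F S h γ₀ γ₂ hc Q := by
  -- The reduction consists of the complex linear frames in `Q`. Two of them differ by an element
  -- commuting with `γ₀(ν)`, which means an element of `Spin^c`.
  refine ⟨fun x => {f | f ∈ Q x ∧ ∀ s, f (γ₀ (vol h b) s) = J x (f s)}, fun x f hf => hf.1,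
    ⟨fun x f hf f' => ?_, fun x₀ => ?_⟩⟩
  · constructor
    · rintro ⟨hf', hf'J⟩
      obtain ⟨k, ⟨-, hk⟩, hu⟩ := (hQ.principal.simply_transitive x f hf.1 f').1 hf'
      refine ⟨k, ⟨(hm.mem_spinC_iff hc k).2 (LinearMap.ext fun s => f.injective ?_), hk⟩,
        fun k' hk' => hu k' ⟨Subgroup.mem_top _, hk'.2⟩⟩
      rw [Module.End.mul_apply, Module.End.mul_apply, ← hk, hf'J, hk, hf.2]
    · rintro ⟨k, ⟨hkC, hk⟩, -⟩
      refine ⟨(hQ.principal.simply_transitive x f hf.1 f').2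
        ⟨k, ⟨Subgroup.mem_top _, hk⟩, fun k' hk' => hm.rep_injective hc (Units.ext
          (LinearMap.ext fun s => f.injective ?_))⟩, fun s => ?_⟩
      · rw [← hk'.2, hk]
      · have h1 := (hm.mem_spinC_iff hc k).1 hkC
        have h2 := congrArg (fun T : Module.End ℝ S₀ => T s) h1
        simp only [Module.End.mul_apply] at h2
        rw [hk, h2, hf.2, hk]
  -- A local section of `Q` carries `γ₀(ν)` to `J` or to `-J` at `x₀`. In the second case the class
  -- of `(1, e₁)`, acting by `D`, reverses the sign.
  · have hmain : ∃ f : ∀ x, S₀ ≃ₗ[ℝ] S x, (∀ᶠ x in nhds x₀, f x ∈ Q x ∧ FrameSmoothAt p q F S f x) ∧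
        ∀ s, f x₀ (γ₀ (vol h b) s) = J x₀ (f x₀ s) := by
      obtain ⟨f, hf⟩ := hQ.principal.local_sections x₀
      obtain ⟨A, hA, hA2, hAf⟩ := IsAdaptedFrame.exists_complexStructure hm
        (hQ.adapted x₀ (f x₀) hf.self_of_nhds.1)
      rcases eq_or_eq_neg_of_mem_schur_pair hpq hA hA2 (hJ.mem x₀) (hJ.sq x₀) with h1 | h1
      · exact ⟨f, hf, fun s => by rw [hAf, h1]⟩
      · let k := reflO h (alpha_mul_alpha p q)
        let U : S₀ ≃ₗ[ℝ] S₀ := LinearMap.GeneralLinearGroup.generalLinearEquiv ℝ S₀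
          (twistedRep h (alpha p q) γ₀ γ₂ hc k)
        have hU : ∀ s, U s = γ₂ (e₁ (alpha p q)) s := fun s => by
          rw [← hm.rep_reflO hc]; rfl
        refine ⟨fun x => U.trans (f x), ?_, fun s => ?_⟩
        · filter_upwards [hf] with x hx
          refine ⟨(hQ.principal.simply_transitive x (f x) hx.1 _).2
            ⟨k, ⟨Subgroup.mem_top _, fun s => rfl⟩, fun k' hk' => hm.rep_injective hc (Units.ext
              (LinearMap.ext fun s => (f x).injective ?_))⟩, fun s => hx.2 (U s)⟩
          rw [← hk'.2]; rfl
        · simp only [LinearEquiv.trans_apply, hU]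
          have h2 := congrArg (fun T : Module.End ℝ S₀ => T s) hm.anti
          simp only [Module.End.mul_apply, LinearMap.neg_apply] at h2
          rw [h2, map_neg, hAf, h1, _root_.neg_apply, neg_neg]
    obtain ⟨f, hf, hf₀⟩ := hmain
    have hfd := fun x => fiber_finiteDimensional F S x
    have ht2 := fun x => fiber_t2Space F S x
    let T : ∀ x, S x →L[ℝ] S x := fun x =>
      LinearMap.toContinuousLinearMap ((f x).conj (γ₀ (vol h b)))
    have hTf : ∀ x s, T x (f x s) = f x (γ₀ (vol h b) s) := by
      intro x s
      simp [T, LinearEquiv.conj_apply]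
    have hT : EndSmoothAt (p := p) (q := q) F S T x₀ :=
      endSmoothAt_of_conj hf.self_of_nhds.2 (γ₀ (vol h b)) (Filter.Eventually.of_forall hTf)
    -- The transported structure `T` is `±J` near `x₀` and equals `J` at `x₀`, so the sign persists.
    have hTJ := eventually_eq_of_sign (γ := γ) hT (hJ.smooth x₀) (Filter.Eventually.of_forall hJ.sq)
      (by
        filter_upwards [hf] with x hx
        obtain ⟨A, hA, hA2, hAf⟩ := IsAdaptedFrame.exists_complexStructure hm
          (hQ.adapted x (f x) hx.1)
        have h1 : T x = A := ContinuousLinearMap.ext fun s => by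
          rw [← (f x).apply_symm_apply s, hTf, hAf]
        rw [h1]
        exact eq_or_eq_neg_of_mem_schur_pair hpq hA hA2 (hJ.mem x) (hJ.sq x))
      (ContinuousLinearMap.ext fun s => by
        rw [← (f x₀).apply_symm_apply s, hTf, hf₀])
    refine ⟨f, ?_⟩
    filter_upwards [hf, hTJ] with x hx hxJ
    exact ⟨⟨hx.1, fun s => by rw [← hTf, hxJ]⟩, hx.2⟩

/-- A reduction of an adapted `Spin^o` structure to `Spin^c` gives a complex structure in the Schur
bundle. -/
lemma exists_complexStructure_of_reducesToSpinC
    {b : Module.Basis (Fin (p + q)) ℝ V}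
    (hm : IsPinorModel h (alpha p q) γ₀ γ₂ b)
    (hQ : IsAdaptedSpinO γ h γ₀ γ₂ hc Q) (hred : ReducesToSpinC p q F S h γ₀ γ₂ hc Q) :
    ∃ J, IsSchurComplexStructure γ J := by
  obtain ⟨P, hPQ, hP⟩ := hred
  -- The frames of `P` at a point differ by elements commuting with `γ₀(ν)`, so they all transport
  -- it to the same endomorphism.
  have hJ : ∀ x, ∃ A ∈ schurAlgebra γ x, A * A = -1 ∧
      ∀ f ∈ P x, ∀ s, f (γ₀ (vol h b) s) = A (f s) := by
    intro x
    obtain ⟨f, hf⟩ := hP.local_sections x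
    have hfx := hf.self_of_nhds.1
    obtain ⟨A, hA, hA2, hAf⟩ := IsAdaptedFrame.exists_complexStructure hm
      (hQ.adapted x (f x) (hPQ x hfx))
    refine ⟨A, hA, hA2, fun f' hf' s => ?_⟩
    obtain ⟨k, ⟨hkC, hk⟩, -⟩ := (hP.simply_transitive x (f x) hfx f').1 hf'
    have h1 := (hm.mem_spinC_iff hc k).1 hkC
    have h2 := congrArg (fun T : Module.End ℝ S₀ => T s) h1
    simp only [Module.End.mul_apply] at h2
    rw [hk, h2, hAf, hk]
  choose J hJ using hJ
  refine ⟨J, fun x => (hJ x).1, fun x => (hJ x).2.1, fun x₀ => ?_⟩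
  obtain ⟨f, hf⟩ := hP.local_sections x₀
  refine endSmoothAt_of_conj (f := f) hf.self_of_nhds.2 (γ₀ (vol h b)) ?_
  filter_upwards [hf] with x hx s
  exact ((hJ x).2.2 (f x) hx.1 s).symm

end Reduction
end PinorGeom
end

noncomputable section
namespace PinorGeom

set_option linter.unusedSectionVars false

/-! ### Orientations and volume elements -/

section Orientability

variable {p q : ℕ} {M : Type*} [TopologicalSpace M]
  [ChartedSpace (EuclideanSpace ℝ (Fin (p + q))) M] [IsManifold (𝓡 (p + q)) ∞ M]
  {g : PseudoRiemannianMetric p q M}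

section Pointwise

variable {x : M} {e e' : Fin (p + q) → TangentSpace (𝓡 (p + q)) x}

/-- The basis of the tangent space given by a signed frame. -/
def IsSignedFrame.tangentBasis (he : IsSignedFrame g x e) :
    Module.Basis (Fin (p + q)) ℝ (TangentSpace (𝓡 (p + q)) x) :=
  he.coframe.map (g.flat x).symm

@[simp] lemma IsSignedFrame.tangentBasis_apply (he : IsSignedFrame g x e) (i : Fin (p + q)) :
    he.tangentBasis i = e i := by
  simp [IsSignedFrame.tangentBasis]

lemma IsSignedFrame.neg (he : IsSignedFrame g x e) : IsSignedFrame g x fun i => -e i := by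
  intro i j
  have := he i j
  simpa using this

lemma volOf_neg (hn : Odd (p + q)) : (volOf g x fun i => -e i) = -volOf g x e := by
  rw [volOf, volOf, ← vol_neg hn]
  congr 1
  funext i
  simp

variable (hpq : ((p : ℤ) - q) % 8 = 3 ∨ ((p : ℤ) - q) % 8 = 7)
include hpq

/-- The musical isomorphism carries tangent frames to coframes and preserves the determinant of a
change of basis. -/
lemma IsSignedFrame.volOf_eq (he : IsSignedFrame g x e) (he' : IsSignedFrame g x e') :
    volOf g x e' = he.tangentBasis.det e' • volOf g x e ∧
      (he.tangentBasis.det e' = 1 ∨ he.tangentBasis.det e' = -1) := by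
  have h1 : he.tangentBasis.det e' = he.coframe.det fun i => g.flat x (e' i) := by
    rw [IsSignedFrame.tangentBasis, Module.Basis.det_map]
    rfl
  have h2 := vol_eq_det_smul he.coframe he.coframe_orthonormal he'.isPseudoOrthonormal
  have hsq := he.volOf_sq hpq
  rw [← he.vol_coframe] at hsq
  rw [h1]
  refine ⟨?_, det_eq_one_or_neg_one he.coframe he.coframe_orthonormal hsq he'.isPseudoOrthonormal⟩
  rw [he.vol_coframe] at h2
  exact h2

lemma IsSignedFrame.volOf_eq_or_neg (he : IsSignedFrame g x e) (he' : IsSignedFrame g x e') :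
    volOf g x e' = volOf g x e ∨ volOf g x e' = -volOf g x e := by
  obtain ⟨h1, h2 | h2⟩ := he.volOf_eq hpq he' <;> rw [h1, h2] <;> simp

lemma IsSignedFrame.volOf_ne_neg (he : IsSignedFrame g x e) : volOf g x e ≠ -volOf g x e := by
  intro h0
  have h1 : (2 : ℝ) • volOf g x e = 0 := by
    rw [two_smul]
    nth_rewrite 2 [h0]
    exact add_neg_cancel _
  have h2 := (smul_eq_zero.1 h1).resolve_left two_ne_zero
  have h3 := he.volOf_sq hpq
  rw [h2, mul_zero] at h3
  have h4 : algebraMap ℝ (g.Cl x) 0 = algebraMap ℝ (g.Cl x) (-1) := by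
    rw [map_zero, map_neg, map_one, h3]
  have h5 := algebraMap_injective' h4
  norm_num at h5

/-- Two signed frames induce the same orientation if and only if they have the same volume
element. -/
lemma IsSignedFrame.orientation_eq_iff (he : IsSignedFrame g x e) (he' : IsSignedFrame g x e') :
    he'.tangentBasis.orientation = he.tangentBasis.orientation ↔ volOf g x e' = volOf g x e := by
  have h0 : ⇑he'.tangentBasis = e' := funext he'.tangentBasis_apply
  rw [eq_comm, Module.Basis.orientation_eq_iff_det_pos, h0]
  obtain ⟨h1, h2 | h2⟩ := he.volOf_eq hpq he'
  · rw [h1, h2]; simp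
  · rw [h1, h2, neg_smul, one_smul]
    refine ⟨fun h => by norm_num at h, fun h => absurd h.symm (he.volOf_ne_neg hpq)⟩

/-- In odd dimension, negating all vectors reverses the orientation, so both orientations are
reached without permuting the signed basis. -/
lemma IsSignedFrame.exists_orientation (he : IsSignedFrame g x e)
    (o : Orientation ℝ (TangentSpace (𝓡 (p + q)) x) (Fin (p + q))) :
    he.tangentBasis.orientation = o ∨ he.neg.tangentBasis.orientation = o := by
  rcases he.tangentBasis.orientation_eq_or_eq_neg o with h1 | h1
  · exact Or.inl h1.symm
  · right
    rcases he.tangentBasis.orientation_eq_or_eq_neg he.neg.tangentBasis.orientation with h2 | h2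
    · rw [he.orientation_eq_iff hpq, volOf_neg (odd_of_mod hpq)] at h2
      exact absurd h2.symm (he.volOf_ne_neg hpq)
    · rw [h1, h2]

end Pointwise

/-- The orientation of a smooth local frame is locally constant. -/
lemma orientation_locally_constant {E : Fin (p + q) → ∀ x : M, TangentSpace (𝓡 (p + q)) x} {x₀ : M}
    (hE : ∀ i, VectorSmoothAt p q M (E i) x₀) (he : IsSignedFrame g x₀ fun i => E i x₀) :
    ∃ o₁ : Orientation ℝ (EuclideanSpace ℝ (Fin (p + q))) (Fin (p + q)),
      ∀ᶠ x in nhds x₀, ∀ (he : IsSignedFrame g x fun i => E i x)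
        (hx : x ∈ (trivializationAt (EuclideanSpace ℝ (Fin (p + q)))
          (TangentSpace (𝓡 (p + q))) x₀).baseSet),
        Orientation.map (Fin (p + q)) ((trivializationAt (EuclideanSpace ℝ (Fin (p + q)))
            (TangentSpace (𝓡 (p + q))) x₀).linearEquivAt ℝ x hx) he.tangentBasis.orientation =
              o₁ := by
  set T := trivializationAt (EuclideanSpace ℝ (Fin (p + q)))
    (TangentSpace (𝓡 (p + q)) : M → Type) x₀ with hT
  have hx₀ : x₀ ∈ T.baseSet := mem_baseSet_trivializationAt _ _ x₀
  let B := he.tangentBasis.map (T.linearEquivAt ℝ x₀ hx₀)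
  -- `G x` compares the frame at `x` with the frame at `x₀` inside the trivialization. It is the
  -- identity at `x₀`, so its determinant stays positive nearby.
  let G : M → Matrix (Fin (p + q)) (Fin (p + q)) ℝ := fun x =>
    B.toMatrix fun i => (T ⟨x, E i x⟩).2
  have hG : ContinuousAt G x₀ := by
    refine continuousAt_pi.2 fun i => continuousAt_pi.2 fun j => ?_
    have h1 := (hE j).coord_trivialization.continuousAt
    exact (LinearMap.continuous_of_finiteDimensional (B.coord i)).continuousAt.comp h1
  have hdet : ContinuousAt (fun x => (G x).det) x₀ :=
    (Continuous.matrix_det continuous_id).continuousAt.comp hG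
  have hG₀ : G x₀ = 1 := by
    have : (fun i => (T ⟨x₀, E i x₀⟩).2) = ⇑B := by
      funext i
      simp [B]
    simp only [G, this, Module.Basis.toMatrix_self]
  have hpos : ∀ᶠ x in nhds x₀, 0 < (G x).det :=
    hdet.eventually (lt_mem_nhds (by simp only [hG₀, Matrix.det_one]; exact one_pos))
  refine ⟨B.orientation, ?_⟩
  filter_upwards [hpos] with x hxpos he hx
  rw [← Module.Basis.orientation_map, eq_comm, Module.Basis.orientation_eq_iff_det_pos,
    Module.Basis.det_apply]
  have : (⇑(he.tangentBasis.map (T.linearEquivAt ℝ x hx))) = fun i => (T ⟨x, E i x⟩).2 := by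
    funext i
    simp
  rw [this]
  exact hxpos

/-- A smooth local signed frame with negated vectors. -/
lemma neg_signedFrame_smooth {E : Fin (p + q) → ∀ x : M, TangentSpace (𝓡 (p + q)) x} {x₀ : M}
    (hE : ∀ᶠ x in nhds x₀, (∀ i, VectorSmoothAt p q M (E i) x) ∧ IsSignedFrame g x fun i => E i x) :
    ∀ᶠ x in nhds x₀, (∀ i, VectorSmoothAt p q M (fun y => -E i y) x) ∧
      IsSignedFrame g x fun i => -E i x := by
  filter_upwards [hE] with x hx
  refine ⟨fun i => ?_, hx.2.neg⟩
  have := (hx.1 i).const_smul (-1)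
  simpa using this

variable {F : Type*} [NormedAddCommGroup F] [NormedSpace ℝ F]
  {S : M → Type*} [∀ x, AddCommGroup (S x)] [∀ x, Module ℝ (S x)]
  [∀ x, TopologicalSpace (S x)] [∀ x, IsTopologicalAddGroup (S x)] [∀ x, ContinuousSMul ℝ (S x)]
  [TopologicalSpace (TotalSpace F S)] [FiberBundle F S] [VectorBundle ℝ F S]
  {γ : ElementaryPinorStructure F S g} [FiniteDimensional ℝ F]
  [ContMDiffVectorBundle ∞ F S (𝓡 (p + q))] {J : ∀ x, S x →L[ℝ] S x}
  (hpq : ((p : ℤ) - q) % 8 = 3 ∨ ((p : ℤ) - q) % 8 = 7)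
include hpq

/-- An oriented manifold has smooth local oriented signed frames. -/
lemma exists_oriented_frame {o : ∀ x : M, Orientation ℝ (TangentSpace (𝓡 (p + q)) x) (Fin (p + q))}
    {x₀ : M} {o₀ : Orientation ℝ (EuclideanSpace ℝ (Fin (p + q))) (Fin (p + q))}
    (ho : ∀ᶠ x in nhds x₀, ∀ hx : x ∈ (trivializationAt (EuclideanSpace ℝ (Fin (p + q)))
          (TangentSpace (𝓡 (p + q))) x₀).baseSet,
        Orientation.map (Fin (p + q))
          ((trivializationAt (EuclideanSpace ℝ (Fin (p + q)))
            (TangentSpace (𝓡 (p + q))) x₀).linearEquivAt ℝ x hx) (o x) = o₀)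
              (g : PseudoRiemannianMetric p q M) :
    ∃ E : Fin (p + q) → ∀ x : M, TangentSpace (𝓡 (p + q)) x,
      ∀ᶠ x in nhds x₀, (∀ i, VectorSmoothAt p q M (E i) x) ∧
        ∃ he : IsSignedFrame g x fun i => E i x, he.tangentBasis.orientation = o x := by
  have hx₀ := mem_baseSet_trivializationAt (EuclideanSpace ℝ (Fin (p + q)))
    (TangentSpace (𝓡 (p + q)) : M → Type) x₀
  -- The orientation of the frame and `o` are both locally constant in the trivialization, so
  -- agreement at `x₀` propagates.
  have key : ∀ E : Fin (p + q) → ∀ x : M, TangentSpace (𝓡 (p + q)) x,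
      (∀ᶠ x in nhds x₀, (∀ i, VectorSmoothAt p q M (E i) x) ∧ IsSignedFrame g x fun i => E i x) →
      (∀ he : IsSignedFrame g x₀ fun i => E i x₀, he.tangentBasis.orientation = o x₀) →
      ∀ᶠ x in nhds x₀, (∀ i, VectorSmoothAt p q M (E i) x) ∧
        ∃ he : IsSignedFrame g x fun i => E i x, he.tangentBasis.orientation = o x := by
    intro E hE h₀
    obtain ⟨o₁, ho₁⟩ := orientation_locally_constant hE.self_of_nhds.1 hE.self_of_nhds.2
    have h1 : o₀ = o₁ := by
      rw [← ho.self_of_nhds hx₀, ← ho₁.self_of_nhds hE.self_of_nhds.2 hx₀, h₀]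
    filter_upwards [hE, ho₁, ho, (trivializationAt (EuclideanSpace ℝ (Fin (p + q)))
      (TangentSpace (𝓡 (p + q)) : M → Type) x₀).open_baseSet.mem_nhds hx₀] with x h2 h3 h4 h5
    refine ⟨h2.1, h2.2, (Orientation.map (Fin (p + q)) _).injective ((h3 h2.2 h5).trans ?_)⟩
    rw [← h1, ← h4 h5]
  obtain ⟨E, hE⟩ := exists_smooth_signedFrame g x₀
  rcases hE.self_of_nhds.2.exists_orientation hpq (o x₀) with h1 | h1
  · exact ⟨E, key E hE fun _ => h1⟩
  · exact ⟨fun i y => -E i y, key _ (neg_signedFrame_smooth hE) fun _ => h1⟩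

lemma exists_complexStructure_of_orientable (γ : ElementaryPinorStructure F S g)
    (h : IsOrientable p q M) :
    ∃ J, IsSchurComplexStructure γ J := by
  obtain ⟨o, ho⟩ := h
  choose o₀ ho using ho
  choose E hE using fun x₀ => exists_oriented_frame hpq (ho x₀) g
  have hfd := fun x => fiber_finiteDimensional F S x
  choose he heo using fun x => (hE x).self_of_nhds.2
  -- `E x` is the frame chosen around `x`, evaluated at its own centre. Near `x₀` it has the
  -- orientation of `E x₀`, hence the same volume element, so the section agrees with a smooth one.
  refine ⟨fun x => γ.γ x (volOf g x fun i => E x i x), fun x => ?_, fun x => γ_volOf_sq hpq (he x),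
    fun x₀ => ?_⟩
  · exact (mem_schurAlgebra_iff hpq (he x)).2 ⟨0, 1, by simp⟩
  · refine (γ.smooth _ x₀ (volOf_smooth (hE x₀).self_of_nhds.1)).congr ?_
    filter_upwards [hE x₀] with x hx
    obtain ⟨-, hx, hxo⟩ := hx
    rw [← heo x] at hxo
    rw [(he x).orientation_eq_iff hpq hx] at hxo
    rw [hxo]

lemma IsSchurComplexStructure.exists_frame (hJ : IsSchurComplexStructure γ J) (x₀ : M) :
    ∃ E : Fin (p + q) → ∀ x : M, TangentSpace (𝓡 (p + q)) x,
      ∀ᶠ x in nhds x₀, ((∀ i, VectorSmoothAt p q M (E i) x) ∧ IsSignedFrame g x fun i => E i x) ∧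
        J x = γ.γ x (volOf g x fun i => E i x) := by
  have key : ∀ E : Fin (p + q) → ∀ x : M, TangentSpace (𝓡 (p + q)) x,
      (∀ᶠ x in nhds x₀, (∀ i, VectorSmoothAt p q M (E i) x) ∧ IsSignedFrame g x fun i => E i x) →
      J x₀ = γ.γ x₀ (volOf g x₀ fun i => E i x₀) →
      ∀ᶠ x in nhds x₀, ((∀ i, VectorSmoothAt p q M (E i) x) ∧ IsSignedFrame g x fun i => E i x) ∧
        J x = γ.γ x (volOf g x fun i => E i x) := by
    intro E hE h₀
    refine hE.and (eventually_eq_of_sign (γ := γ) (hJ.smooth x₀)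
      (γ.smooth _ x₀ (volOf_smooth hE.self_of_nhds.1)) ?_ ?_ h₀)
    · filter_upwards [hE] with x hx
      exact γ_volOf_sq hpq hx.2
    · filter_upwards [hE] with x hx
      exact eq_or_eq_neg_of_mem_schur hpq hx.2 (hJ.mem x) (hJ.sq x)
  obtain ⟨E, hE⟩ := exists_smooth_signedFrame g x₀
  rcases eq_or_eq_neg_of_mem_schur hpq hE.self_of_nhds.2 (hJ.mem x₀) (hJ.sq x₀) with h1 | h1
  · exact ⟨E, key E hE h1⟩
  · refine ⟨fun i y => -E i y, key _ (neg_signedFrame_smooth hE) ?_⟩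
    rw [h1, volOf_neg (odd_of_mod hpq), map_neg]

lemma IsSchurComplexStructure.isOrientable (hJ : IsSchurComplexStructure γ J) :
    IsOrientable p q M := by
  choose E hE using fun x₀ => hJ.exists_frame hpq x₀
  have he := fun x => (hE x).self_of_nhds.1.2
  -- Each tangent space is oriented by a frame whose volume element represents `J`. Near `x₀` this
  -- volume element is also that of `E x₀`; the opposite sign would give `J = -J`.
  refine ⟨fun x => (he x).tangentBasis.orientation, fun x₀ => ?_⟩
  obtain ⟨o₁, ho₁⟩ := orientation_locally_constant (hE x₀).self_of_nhds.1.1 (he x₀)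
  refine ⟨o₁, ?_⟩
  filter_upwards [ho₁, hE x₀] with x h1 h2 hx
  have h3 : volOf g x (fun i => E x i x) = volOf g x fun i => E x₀ i x := by
    rcases h2.1.2.volOf_eq_or_neg hpq (he x) with h4 | h4
    · exact h4
    · exfalso
      have h5 := (hE x).self_of_nhds.2
      rw [h4, map_neg, h2.2] at h5
      have := γ_nontrivial γ x
      have h6 := eq_zero_of_complex (r := 0) (s := 2) (γ_volOf_sq (γ := γ) hpq h2.1.2) (by
        rw [two_smul]
        nth_rewrite 2 [h5]
        simp)
      exact two_ne_zero h6.2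
  rw [← h1 h2.1.2 hx, (h2.1.2.orientation_eq_iff hpq (he x)).2 h3]

end Orientability
end PinorGeom
end

/-! ### The main theorem: each implication passes through a complex structure in the Schur bundle -/

theorem mainTheorem6
    -- a smooth connected paracompact pseudo-Riemannian manifold of signature `(p, q)`
    (p q : ℕ) (hpq : ((p : ℤ) - q) % 8 = 3 ∨ ((p : ℤ) - q) % 8 = 7)
    {M : Type*} [TopologicalSpace M] [ChartedSpace (EuclideanSpace ℝ (Fin (p + q))) M]
    [IsManifold (𝓡 (p + q)) ∞ M] [T2Space M] [ConnectedSpace M] [ParacompactSpace M]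
    (g : PinorGeom.PseudoRiemannianMetric p q M)
    -- an elementary real pinor bundle `(S, γ)`
    {F : Type*} [NormedAddCommGroup F] [NormedSpace ℝ F] [FiniteDimensional ℝ F]
    {S : M → Type*} [∀ x, AddCommGroup (S x)] [∀ x, Module ℝ (S x)]
    [∀ x, TopologicalSpace (S x)] [∀ x, IsTopologicalAddGroup (S x)]
    [∀ x, ContinuousSMul ℝ (S x)]
    [TopologicalSpace (TotalSpace F S)] [FiberBundle F S] [VectorBundle ℝ F S]
    [ContMDiffVectorBundle ∞ F S (𝓡 (p + q))]
    (γ : PinorGeom.ElementaryPinorStructure F S g)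
    -- the algebraic model: a quadratic space, an elementary pinor representation `γ₀` and a
    -- compatible representation `γ₂` of `Cl₂(α)`
    {V : Type*} [AddCommGroup V] [Module ℝ V] [FiniteDimensional ℝ V]
    (h : QuadraticForm ℝ V) (hsig : PinorGeom.HasSignature h p q)
    {S₀ : Type*} [AddCommGroup S₀] [Module ℝ S₀] [FiniteDimensional ℝ S₀]
    (γ₀ : CliffordAlgebra h →ₐ[ℝ] Module.End ℝ S₀) (hγ₀ : PinorGeom.IsIrreducibleRep γ₀)
    (γ₂ : PinorGeom.CliffordTwo (PinorGeom.alpha p q) →ₐ[ℝ] Module.End ℝ S₀)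
    (hc : PinorGeom.IsCompatible h (PinorGeom.alpha p q) γ₀ γ₂) :
    PinorGeom.RestrictsToIsomorphism γ ∧
    (∃ Q : ∀ x, Set (S₀ ≃ₗ[ℝ] S x), PinorGeom.IsAdaptedSpinO γ h γ₀ γ₂ hc Q) ∧
    ∀ Q : ∀ x, Set (S₀ ≃ₗ[ℝ] S x), PinorGeom.IsAdaptedSpinO γ h γ₀ γ₂ hc Q →
      List.TFAE [
        PinorGeom.IsOrientable p q M,
        PinorGeom.SchurTrivialVectorBundle γ,
        PinorGeom.SchurTrivialAlgebraBundle γ,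
        PinorGeom.ReducesToSpinC p q F S h γ₀ γ₂ hc Q] := by
  refine ⟨PinorGeom.restrictsToIsomorphism hpq, PinorGeom.exists_isAdaptedSpinO hpq hsig hγ₀ hc,
    fun Q hQ => ?_⟩
  obtain ⟨b, hm⟩ := PinorGeom.exists_isPinorModel hpq hsig hγ₀ hc
  have hOJ : PinorGeom.IsOrientable p q M → ∃ J, PinorGeom.IsSchurComplexStructure γ J :=
    PinorGeom.exists_complexStructure_of_orientable hpq γ
  tfae_have 1 → 2 := fun h =>
    (hOJ h).elim fun _ hJ => hJ.trivialVector hpq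
  tfae_have 2 → 3 := fun h =>
    (PinorGeom.exists_complexStructure_of_trivialVector hpq h).elim fun _ hJ => hJ.trivialAlgebra hpq
  tfae_have 3 → 4 := fun h =>
    (PinorGeom.exists_complexStructure_of_trivialAlgebra h).elim fun _ hJ =>
      hJ.reducesToSpinC hpq hm hQ
  tfae_have 4 → 1 := fun h =>
    (PinorGeom.exists_complexStructure_of_reducesToSpinC hm hQ h).elim fun _ hJ =>
      hJ.isOrientable hpq
  tfae_finish
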